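/- **Setting.** A labelled pushdown system (PDS) $\mathcal P=(P,\Gamma,\Delta,\sharp)$ has finite sets $P$ (control locations) and $\Gamma$ (stack symbols), a bottom symbol $\sharp\notin\Gamma$, and a finite set $\Delta$ of rules of the forms $\langle p,\gamma\rangle\xrightarrow{call}\langle q,\gamma_1\gamma_2\rangle$, $\langle p,\gamma\rangle\xrightarrow{ret}\langle q,\varepsilon\rangle$, $\langle p,\gamma\rangle\xrightarrow{int}\langle q,\omega\rangle$ with $\gamma,\gamma_1,\gamma_2\in\Gamma$, $\omega\in\Gamma^*$. Configurations are pairs $\langle p,\omega\rangle\in P\times\Gamma^*$; a rule $\langle p,\gamma\rangle\xrightarrow{t}\langle q,\omega\rangle$ gives steps $\langle p,\gamma\omega'\rangle\Rightarrow\langle q,\omega\omega'\rangle$ (corresponding to a call, return or simple statement according to $t$). A run is an infinite sequence $c_0\Rightarrow c_1\Rightarrow\cdots$. On a run, the global-successor of $c_i$ is $c_{i+1}$. The abstract-successor of $c_i$ is: $c_{i+1}$ if $c_i\Rightarrow c_{i+1}$ is a simple statement; $\bot$ if it is a return; and if it is a call, $c_i=\langle p,\gamma\omega''\rangle\Rightarrow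 c_{i+1}=\langle q,\gamma_1\gamma_2\omega''\rangle$, it is the corresponding return-point if there is one, and $\bot$ otherwise. Here the return-point is the configuration $c_k$, $k>i+1$, whose stack is $\gamma_2\omega''$, such that the stacks of $c_{i+1},\dots,c_{k-1}$ are all strictly higher than $\gamma_2\omega''$ and $c_{k-1}\Rightarrow c_k$ is a return. The global- (abstract-) successors of a configuration $c$ are those of position $0$ on the runs from $c$. Global-paths are the infinite sequences of configurations in which each element is a global-successor of the previous one; abstract-paths are the sequences in which each element is an abstract-successor of the previous one, and which are infinite or end as soon as $\bot$ is reached (equivalently, stay at $\bot$ forever). BCARET formulas over a finite set $AP$ are given by ($b\in\{g,a\}$, $e\in AP$) $$\varphi::=true\mid false\mid e\mid\neg e\mid\varphi\vee\varphi\mid\varphi\wedge\varphi\mid EX^b\varphi\mid AX^b\varphi\mid E[\varphi U^b\varphi]\mid A[\varphi U^b\varphi]\mid E[\varphi R^b\varphi]\mid A[\varphi R^b\varphi].$$ $\bot$ satisfies no formula. Given $f:AP\to 2^P$, the standard valuation is $\lambda_f(e)=\{\langle p,\omega\rangle\mid p\in f(e),\ \omega\in\Gamma^*\}$, and $\vDash_{\lambda_f}$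 at configurations is defined by: $e$ (resp. $\neg e$) holds at $c$ iff $c\in\lambda_f(e)$ (resp. $c\notin\lambda_f(e)$); Boolean connectives as usual; $EX^b\varphi$ (resp. $AX^b\varphi$) iff some (resp. every) global- ($b=g$) or abstract- ($b=a$) successor satisfies $\varphi$; $E[\varphi_1U^b\varphi_2]$ (resp. $A$) iff some (resp. every) global- or abstract-path $c_0c_1\cdots$ from $c$ has an $i\ge 0$ with $c_i\vDash\varphi_2$ and $c_j\vDash\varphi_1$ for all $0\le j<i$; $E[\varphi_1R^b\varphi_2]$ (resp. $A$) iff some (resp. every) such path has the property that for every $i\geq 0$ with $c_i\nvDash\varphi_2$ there is $0\le j<i$ with $c_j\vDash\varphi_1$. **Sizes and cost.** $|\varphi|$ is the number of nodes of the syntax tree of $\varphi$ (a literal $e$ or $\neg e$ is one node), $|\omega|$ the length of $\omega$, and $|\Delta|$ the size of the rule set, where a rule with right-hand side word $u$ counts $1+|u|$. Time is the number of steps of a random access machine with uniform cost, whose operations are constants, copying, addition, truncated subtraction, indirect access to arrays, and tests for zero. The input is given by numbering $P$, $\Gamma$ and $AP$: the numbers $|P|,|\Gamma|,|AP|,p,|\omega|$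 and the number of rules are in registers, and $\omega$, a list of the rules, $\varphi$ in prefix notation, and the membership table of $f$ are in arrays. **Theorem.** There is an algorithm (one fixed machine program) that, given a PDS $\mathcal P=(P,\Gamma,\Delta,\sharp)$, a finite set $AP$, a labelling function $f:AP\to2^P$, a BCARET formula $\varphi$ over $AP$ and a configuration $\langle p,\omega\rangle\in P\times\Gamma^*$, always halts and decides whether $\langle p,\omega\rangle\vDash_{\lambda_f}\varphi$. Its running time is $$\mathcal O\Big(|P|^2|\varphi|^3|\Gamma|\big(|P||\Gamma||\Delta||\varphi|\,2^{5|P||\varphi|}+2^{|P||\varphi|}|\omega|\big)\Big)$$ with an absolute constant, for all inputs except those with both $\Delta=\emptyset$ and $\omega=\varepsilon$ (where the bound is $0$). -/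

import Mathlib

namespace BCARET

/-! ### Labelled pushdown systems -/

/-- The type of a transition: call, return, or simple (internal) statement. -/
inductive Kind where
  | call
  | ret
  | int

/-- The three forms of transition rules of a labelled pushdown system:
`⟨p, γ⟩ →call ⟨q, γ₁ γ₂⟩`, `⟨p, γ⟩ →ret ⟨q, ε⟩`, `⟨p, γ⟩ →int ⟨q, ω⟩`. -/
inductive Rule (P Γ : Type*) where
  | call (p : P) (γ : Γ) (q : P) (γ₁ γ₂ : Γ)
  | ret (p : P) (γ : Γ) (q : P)
  | int (p : P) (γ : Γ) (q : P) (ω : List Γ)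

namespace Rule
variable {P Γ : Type*}

def kind : Rule P Γ → Kind
  | call .. => .call
  | ret .. => .ret
  | int .. => .int

/-- The control location on the left-hand side. -/
def src : Rule P Γ → P
  | call p _ _ _ _ => p
  | ret p _ _ => p
  | int p _ _ _ => p

/-- The stack symbol on the left-hand side. -/
def top : Rule P Γ → Γ
  | call _ γ _ _ _ => γ
  | ret _ γ _ => γ
  | int _ γ _ _ => γ

/-- The control location on the right-hand side. -/
def tgt : Rule P Γ → P
  | call _ _ q _ _ => q
  | ret _ _ q => q
  | int _ _ q _ => q

/-- The stack word on the right-hand side. -/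
def word : Rule P Γ → List Γ
  | call _ _ _ γ₁ γ₂ => [γ₁, γ₂]
  | ret _ _ _ => []
  | int _ _ _ ω => ω

end Rule

/-- A labelled pushdown system with control locations `P`, stack alphabet `Γ` and a finite set `Δ`
of rules. The bottom stack symbol `♯` is not an element of `Γ`, so it occurs neither in a rule nor
in a stack content `ω ∈ Γ*`; it needs no representation. -/
structure PDS (P Γ : Type*) where
  Δ : Finset (Rule P Γ)

/-- A configuration `⟨p, ω⟩`; the head of the list is the top of the stack. -/
abbrev Config (P Γ : Type*) := P × List Γ

namespace PDS
variable {P Γ : Type*} (S : PDS P Γ)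

/-- `c` has the immediate successor `d` through a rule of type `t`. -/
def StepOf (t : Kind) (c d : Config P Γ) : Prop :=
  ∃ r ∈ S.Δ, r.kind = t ∧ ∃ ω' : List Γ, c = (r.src, r.top :: ω') ∧ d = (r.tgt, r.word ++ ω')

/-- The transition relation `⇒`. -/
def Step (c d : Config P Γ) : Prop := ∃ t, S.StepOf t c d

/-- A run from `c` (an element of `Traces(c)`): an infinite sequence of configurations. -/
def IsRun (c : Config P Γ) (π : ℕ → Config P Γ) : Prop :=
  π 0 = c ∧ ∀ i, S.Step (π i) (π (i + 1))

/-- `π k` is the return-point on the run `π` that corresponds to the call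
`π i = ⟨p, γ ω''⟩ ⇒ π (i+1) = ⟨q, γ₁ γ₂ ω''⟩`: position `k` is the first one after `i` at which the
stack content is back to `γ₂ ω''` (until then `γ₂ ω''` lies strictly below the top of the stack),
and it is reached by a return statement. -/
def IsReturnPoint (π : ℕ → Config P Γ) (i k : ℕ) : Prop :=
  i + 1 < k ∧
  (π k).2 = (π (i + 1)).2.tail ∧
  (∀ j, i < j → j < k → (π (i + 1)).2.tail.length < (π j).2.length) ∧
  S.StepOf .ret (π (k - 1)) (π k)

/-- `d` is an abstract-successor of position `i` on the run `π`; `none` stands for `⊥`. -/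
def AbsSuccOn (π : ℕ → Config P Γ) (i : ℕ) (d : Option (Config P Γ)) : Prop :=
  (S.StepOf .call (π i) (π (i + 1)) ∧
    ((∃ k, S.IsReturnPoint π i k ∧ d = some (π k)) ∨
      ((¬ ∃ k, S.IsReturnPoint π i k) ∧ d = none))) ∨
  (S.StepOf .int (π i) (π (i + 1)) ∧ d = some (π (i + 1))) ∨
  (S.StepOf .ret (π i) (π (i + 1)) ∧ d = none)

end PDS

/-! ### The logic -/

/-- The superscript of an operator: `g` (global) or `a` (abstract). -/
inductive Mode where
  | g
  | a

namespace PDS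
variable {P Γ : Type*} (S : PDS P Γ)

/-- `d` is a global-successor (mode `g`), respectively an abstract-successor (mode `a`), of the
configuration `c`: it is one of position `0` on some run from `c`. An abstract-successor may be `⊥`,
written `none`; a global-successor is always a configuration. -/
def Succ (b : Mode) (c : Config P Γ) (d : Option (Config P Γ)) : Prop :=
  ∃ π, S.IsRun c π ∧
    match b with
    | .g => d = some (π 1)
    | .a => S.AbsSuccOn π 0 d

/-- Global-paths (mode `g`) and abstract-paths (mode `a`) from `c`. An abstract-path that reaches
`⊥` is a finite abstract-path; here it is continued by `⊥` forever. -/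
def IsPath (b : Mode) (c : Config P Γ) (σ : ℕ → Option (Config P Γ)) : Prop :=
  σ 0 = some c ∧ ∀ i,
    match σ i with
    | some x => S.Succ b x (σ (i + 1))
    | none => σ (i + 1) = none

end PDS

/-- BCARET formulas in positive normal form over the atomic propositions `AP`. -/
inductive Formula (AP : Type*) where
  | tt
  | ff
  | atom (e : AP)
  | natom (e : AP)
  | or (φ ψ : Formula AP)
  | and (φ ψ : Formula AP)
  | EX (b : Mode) (φ : Formula AP)
  | AX (b : Mode) (φ : Formula AP)
  | EU (b : Mode) (φ ψ : Formula AP)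
  | AU (b : Mode) (φ ψ : Formula AP)
  | ER (b : Mode) (φ ψ : Formula AP)
  | AR (b : Mode) (φ ψ : Formula AP)

/-- The size `|φ|`: the number of nodes of the syntax tree, a literal `e` or `¬ e` counting as one
node. -/
def Formula.size {AP : Type*} : Formula AP → ℕ
  | .tt => 1
  | .ff => 1
  | .atom _ => 1
  | .natom _ => 1
  | .or φ ψ => φ.size + ψ.size + 1
  | .and φ ψ => φ.size + ψ.size + 1
  | .EX _ φ => φ.size + 1
  | .AX _ φ => φ.size + 1
  | .EU _ φ ψ => φ.size + ψ.size + 1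
  | .AU _ φ ψ => φ.size + ψ.size + 1
  | .ER _ φ ψ => φ.size + ψ.size + 1
  | .AR _ φ ψ => φ.size + ψ.size + 1

/-- A set of configurations, seen as a property of configurations and `⊥`: `⊥` (that is, `none`)
satisfies no formula. -/
def Holds {C : Type*} (X : C → Prop) : Option C → Prop
  | some c => X c
  | none => False

/-- The satisfaction relation `c ⊨ φ` with respect to a labelling `lam : AP → 2^(P × Γ*)`. -/
def Sat {P Γ AP : Type*} (S : PDS P Γ) (lam : AP → Set (Config P Γ)) :
    Formula AP → Config P Γ → Prop
  | .tt => fun _ => True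
  | .ff => fun _ => False
  | .atom e => fun c => c ∈ lam e
  | .natom e => fun c => c ∉ lam e
  | .or φ ψ => fun c => Sat S lam φ c ∨ Sat S lam ψ c
  | .and φ ψ => fun c => Sat S lam φ c ∧ Sat S lam ψ c
  | .EX b φ => fun c => ∃ d, S.Succ b c d ∧ Holds (Sat S lam φ) d
  | .AX b φ => fun c => ∀ d, S.Succ b c d → Holds (Sat S lam φ) d
  | .EU b φ ψ => fun c => ∃ σ, S.IsPath b c σ ∧
      ∃ i, Holds (Sat S lam ψ) (σ i) ∧ ∀ j < i, Holds (Sat S lam φ) (σ j)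
  | .AU b φ ψ => fun c => ∀ σ, S.IsPath b c σ →
      ∃ i, Holds (Sat S lam ψ) (σ i) ∧ ∀ j < i, Holds (Sat S lam φ) (σ j)
  | .ER b φ ψ => fun c => ∃ σ, S.IsPath b c σ ∧
      ∀ i, ¬ Holds (Sat S lam ψ) (σ i) → ∃ j < i, Holds (Sat S lam φ) (σ j)
  | .AR b φ ψ => fun c => ∀ σ, S.IsPath b c σ →
      ∀ i, ¬ Holds (Sat S lam ψ) (σ i) → ∃ j < i, Holds (Sat S lam φ) (σ j)

/-- The standard valuation `λ_f` of `f : AP → 2^P`: an atomic proposition holds at a configuration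
according to its control location only. -/
def stdVal {P AP : Type*} (Γ : Type*) (f : AP → Finset P) (e : AP) : Set (Config P Γ) :=
  {c | c.1 ∈ f e}

/-- The size of the rule set: every rule counts one plus the length of its right-hand side word. -/
def PDS.ruleSize {P Γ : Type*} (S : PDS P Γ) : ℕ := ∑ r ∈ S.Δ, (1 + r.word.length)

/-! ### Random access machines

A program works on registers holding natural numbers and on arrays of natural numbers, with
indirect access to the array cells. Each basic instruction and each evaluation of a test costs one
step. The only arithmetic is addition and truncated subtraction. -/

namespace RAM

structure State where
  reg : ℕ → ℕ
  arr : ℕ → ℕ → ℕ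

def State.setReg (s : State) (r v : ℕ) : State :=
  { s with reg := Function.update s.reg r v }

def State.setArr (s : State) (a i v : ℕ) : State :=
  { s with arr := Function.update s.arr a (Function.update (s.arr a) i v) }

/-- Programs. Register and array names are constants of the program. -/
inductive Cmd where
  /-- `r := k` -/
  | const (r k : ℕ)
  /-- `r := u` -/
  | copy (r u : ℕ)
  /-- `r := u + v` -/
  | add (r u v : ℕ)
  /-- `r := max (u - v) 0` -/
  | sub (r u v : ℕ)
  /-- `r := a[u]` -/
  | load (r a u : ℕ)
  /-- `a[u] := v` -/
  | store (a u v : ℕ)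
  /-- `c; d` -/
  | seq (c d : Cmd)
  /-- if `r ≠ 0` then `c` else `d` -/
  | ite (r : ℕ) (c d : Cmd)
  /-- while `r ≠ 0` do `c` -/
  | loop (r : ℕ) (c : Cmd)

/-- `Exec c s s' t`: the program `c`, started in state `s`, halts in state `s'` after exactly `t`
steps. -/
inductive Exec : Cmd → State → State → ℕ → Prop where
  | const (s r k) : Exec (.const r k) s (s.setReg r k) 1
  | copy (s r u) : Exec (.copy r u) s (s.setReg r (s.reg u)) 1
  | add (s r u v) : Exec (.add r u v) s (s.setReg r (s.reg u + s.reg v)) 1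
  | sub (s r u v) : Exec (.sub r u v) s (s.setReg r (s.reg u - s.reg v)) 1
  | load (s r a u) : Exec (.load r a u) s (s.setReg r (s.arr a (s.reg u))) 1
  | store (s a u v) : Exec (.store a u v) s (s.setArr a (s.reg u) (s.reg v)) 1
  | seq {c d s s₁ s₂ t₁ t₂} (h₁ : Exec c s s₁ t₁) (h₂ : Exec d s₁ s₂ t₂) :
      Exec (.seq c d) s s₂ (t₁ + t₂)
  | iteTrue {r c d s s₁ t} (hr : s.reg r ≠ 0) (h : Exec c s s₁ t) :
      Exec (.ite r c d) s s₁ (t + 1)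
  | iteFalse {r c d s s₁ t} (hr : s.reg r = 0) (h : Exec d s s₁ t) :
      Exec (.ite r c d) s s₁ (t + 1)
  | loopStop {r c s} (hr : s.reg r = 0) : Exec (.loop r c) s s 1
  | loopStep {r c s s₁ s₂ t₁ t₂} (hr : s.reg r ≠ 0) (h₁ : Exec c s s₁ t₁)
      (h₂ : Exec (.loop r c) s₁ s₂ t₂) : Exec (.loop r c) s s₂ (t₁ + t₂ + 1)

end RAM

/-! ### Encoding of the input -/

/-- A rule is written as: type, source, read symbol, target, length of the word, word. -/
def encRule {m n : ℕ} (r : Rule (Fin m) (Fin n)) : List ℕ :=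
  (match r.kind with | .call => 0 | .ret => 1 | .int => 2) ::
    r.src.val :: r.top.val :: r.tgt.val :: r.word.length :: r.word.map Fin.val

/-- Formulas are written in prefix notation. -/
def encFormula {k : ℕ} : Formula (Fin k) → List ℕ
  | .tt => [0]
  | .ff => [1]
  | .atom e => [2, e]
  | .natom e => [3, e]
  | .or φ ψ => 4 :: (encFormula φ ++ encFormula ψ)
  | .and φ ψ => 5 :: (encFormula φ ++ encFormula ψ)
  | .EX .g φ => 6 :: encFormula φ
  | .EX .a φ => 7 :: encFormula φ
  | .AX .g φ => 8 :: encFormula φ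
  | .AX .a φ => 9 :: encFormula φ
  | .EU .g φ ψ => 10 :: (encFormula φ ++ encFormula ψ)
  | .EU .a φ ψ => 11 :: (encFormula φ ++ encFormula ψ)
  | .AU .g φ ψ => 12 :: (encFormula φ ++ encFormula ψ)
  | .AU .a φ ψ => 13 :: (encFormula φ ++ encFormula ψ)
  | .ER .g φ ψ => 14 :: (encFormula φ ++ encFormula ψ)
  | .ER .a φ ψ => 15 :: (encFormula φ ++ encFormula ψ)
  | .AR .g φ ψ => 16 :: (encFormula φ ++ encFormula ψ)
  | .AR .a φ ψ => 17 :: (encFormula φ ++ encFormula ψ)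

/-- The membership table of `f`, row by row; the entry for `e` and `q` is at position
`e * m + q`. -/
def encLabels {m k : ℕ} (f : Fin k → Finset (Fin m)) : List ℕ :=
  (List.finRange k).flatMap fun e => (List.finRange m).map fun q => if q ∈ f e then 1 else 0

/-- The start state: registers `0, …, 5` hold `|P|`, `|Γ|`, `|AP|`, the control location `p`, `|ω|`
and the number of rules; arrays `0, …, 3` hold the stack content `ω`, a list `rs` of the rules, the
formula and the labelling. Everything else is zero. -/
def inputState {m n k : ℕ} (rs : List (Rule (Fin m) (Fin n))) (f : Fin k → Finset (Fin m))
    (φ : Formula (Fin k)) (p : Fin m) (ω : List (Fin n)) : RAM.State where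
  reg i := [m, n, k, (p : ℕ), ω.length, rs.length].getD i 0
  arr a i := ([ω.map Fin.val, rs.flatMap encRule, encFormula φ, encLabels f].getD a []).getD i 0

end BCARET

set_option linter.unusedSimpArgs false

/-! A pushdown system never looks below the top of its stack, so what happens at `⟨q, u v⟩` depends
on `v` only through the truth values at the configurations `⟨q', v⟩`. These finitely many bits form
the type of `v`: for every control location one bit per node of the formula, and one bit telling
that no run starts there (the configuration is dead). With `m` locations and `N` nodes a type is a
number below `2 ^ ((N + 1) * m)`. The type of `g :: v` is a function of `g` and of the type of `v`,
stored in a table `F g T`; the type of a whole stack is obtained by applying the table symbol by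
symbol (`evalW`), starting from the type of the empty stack.

The table is a least fixed point. A node is stored positively or negated (`Formula.pol`), so that
release operators turn into until operators and `AX` into `EX`; then every stored set is the least
fixed point of a one-step operator (`IsLfp`, `isLfp_EU`, `isLfp_AR`, `isLfp_AU`, `isLfp_ER`, with
`EUs.ind` and `AUs.ind` behind them). The value `⊥` satisfies no formula and hence every negated
one, which is why each node carries a separate value for `⊥`. The nodes are treated in reverse
prefix order, so that subformulas come before their parents. For one node the `m` bits of its block
are switched on in rounds until nothing changes; as there are `m` bits in each cell, as many rounds
as there are bits suffice (`upd_stable`). `table_correct` shows that the saturated table is right: a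
bit that is set is justified by induction on the rounds, and a bit that should be set is set by
induction on the least fixed point. `exists_nodeSem` feeds all kinds of nodes into this one theorem.

Abstract successors need more than one step. By `succ_a_iff`, a call leads to a return-point if the
pushed symbol is popped by a return, and to `⊥` if it is popped by another statement or never
popped. Popping is read off an auxiliary table of the same kind (`popTable_ret`, `popTable_nonret`).
Never popping the symbol `g` means being alive at the one-symbol stack `g` (`PDS.div_iff`), which
the dead bits tell.

The machine version is a chain of statements `Tri` about total correctness with a time bound. What a
program leaves untouched is computed from its text (`Frame`), so such side conditions hold by
evaluation. There are `N + 2` saturations, each of `m * cells` rounds over `cells` cells, and a cell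
costs about `m * (m * K)` per unit of rule size, where `K = (N + 1) * m`. Up to a constant the sum
is `N² m⁴ n² 2^(2 (N+1) m) |Δ| + |ω|`, and the factor `5` in the exponent of the claimed bound
absorbs one factor `m` as well. Without rules this table would be too expensive; then no
configuration has a successor, and a single cell describing all of `ω` is enough. -/

namespace BCARET

/-! ### Runs and successors -/

/-- Prepend an element to a sequence. -/
def scons {α : Type*} (a : α) (π : ℕ → α) : ℕ → α
  | 0 => a
  | n + 1 => π n

namespace PDS
variable {P Γ : Type*} (S : PDS P Γ)

/-- Some run starts in `c`. -/
def Alive (c : Config P Γ) : Prop := ∃ π, S.IsRun c π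

variable {S}

theorem IsRun.tail {c : Config P Γ} {π} (h : S.IsRun c π) (k : ℕ) :
    S.IsRun (π k) (fun n => π (n + k)) :=
  ⟨by simp, fun i => by have := h.2 (i + k); rwa [show i + k + 1 = i + 1 + k by ring] at this⟩

theorem IsRun.alive {c : Config P Γ} {π} (h : S.IsRun c π) (k : ℕ) : S.Alive (π k) :=
  ⟨_, h.tail k⟩

theorem IsRun.cons {c d : Config P Γ} {π} (h : S.IsRun d π) (hs : S.Step c d) :
    S.IsRun c (scons c π) := by
  refine ⟨rfl, fun i => ?_⟩
  cases i with
  | zero => simpa [scons, h.1] using hs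
  | succ i => exact h.2 i

theorem Alive.exists_step {c : Config P Γ} (h : S.Alive c) : ∃ d, S.Step c d ∧ S.Alive d := by
  obtain ⟨π, hπ⟩ := h
  exact ⟨π 1, by have := hπ.2 0; rwa [hπ.1] at this, hπ.alive 1⟩

/-- An infinite sequence obtained from a total relation on a set. -/
theorem exists_seq {α : Type*} {R : α → α → Prop} {Z : α → Prop}
    (hZ : ∀ c, Z c → ∃ d, R c d ∧ Z d) {c : α} (hc : Z c) :
    ∃ π : ℕ → α, π 0 = c ∧ (∀ i, R (π i) (π (i + 1))) ∧ ∀ i, Z (π i) := by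
  choose! f hf hf' using hZ
  have hall : ∀ i, Z (f^[i] c) := by
    intro i
    induction i with
    | zero => exact hc
    | succ i ih => rw [Function.iterate_succ_apply']; exact hf' _ ih
  refine ⟨fun i => f^[i] c, rfl, fun i => ?_, hall⟩
  beta_reduce
  rw [Function.iterate_succ_apply']
  exact hf _ (hall i)

theorem alive_coind {Z : Config P Γ → Prop} (hZ : ∀ c, Z c → ∃ d, S.Step c d ∧ Z d)
    {c : Config P Γ} (hc : Z c) : S.Alive c :=
  let ⟨π, h0, hs, _⟩ := exists_seq hZ hc
  ⟨π, h0, hs⟩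

/-- A run through a given first step exists as soon as its target is alive, so the quantifier over
runs reduces to one step and `Alive`. -/
theorem succ_g_iff {c : Config P Γ} {d} :
    S.Succ .g c d ↔ ∃ e, d = some e ∧ S.Step c e ∧ S.Alive e := by
  constructor
  · rintro ⟨π, hπ, rfl⟩
    exact ⟨_, rfl, by have := hπ.2 0; rwa [hπ.1] at this, hπ.alive 1⟩
  · rintro ⟨e, rfl, hs, π, hπ⟩
    exact ⟨_, hπ.cons hs, by simp [scons, hπ.1]⟩

variable (S) in
/-- From `c` one gets to `⟨q, v⟩` with all stacks before strictly higher than `v`; the flag says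
whether the last step is a return. -/
inductive Pops (v : List Γ) : Config P Γ → P → Bool → Prop
  | last {c q κ} (hl : v.length < c.2.length) (h : S.Step c (q, v))
      (hκ : κ = true ↔ S.StepOf .ret c (q, v)) : Pops v c q κ
  | step {c d q κ} (hl : v.length < c.2.length) (h : S.Step c d) (hd : Pops v d q κ) : Pops v c q κ

variable (S) in
/-- Some run from `c` always keeps its stack strictly higher than `v`. -/
def Div (v : List Γ) (c : Config P Γ) : Prop :=
  ∃ π, S.IsRun c π ∧ ∀ j, v.length < (π j).2.length

theorem Pops.exists_run {v : List Γ} {c q κ} (h : S.Pops v c q κ) (ha : S.Alive (q, v)) :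
    ∃ π k, S.IsRun c π ∧ π (k + 1) = (q, v) ∧ (∀ j ≤ k, v.length < (π j).2.length) ∧
      (κ = true ↔ S.StepOf .ret (π k) (π (k + 1))) := by
  induction h with
  | last hl h hκ =>
    obtain ⟨π, hπ⟩ := ha
    refine ⟨_, 0, hπ.cons h, by simp [scons, hπ.1], ?_, by simpa [scons, hπ.1] using hκ⟩
    intro j hj
    obtain rfl : j = 0 := by omega
    exact hl
  | step hl h hd ih =>
    obtain ⟨π, k, h1, h2, h3, h4⟩ := ih ha
    refine ⟨_, k + 1, h1.cons h, h2, ?_, h4⟩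
    intro j hj
    cases j with
    | zero => exact hl
    | succ j => exact h3 j (by omega)

theorem pops_of_run {v : List Γ} {q κ} (k : ℕ) : ∀ {π : ℕ → Config P Γ},
    (∀ i, S.Step (π i) (π (i + 1))) → π (k + 1) = (q, v) →
    (∀ j ≤ k, v.length < (π j).2.length) → (κ = true ↔ S.StepOf .ret (π k) (π (k + 1))) →
    S.Pops v (π 0) q κ := by
  induction k with
  | zero =>
    intro π hs hk hl hκ
    rw [hk] at hκ
    exact .last (hl 0 le_rfl) (by simpa [hk] using hs 0) hκ
  | succ k ih =>
    intro π hs hk hl hκ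
    exact .step (hl 0 (by omega)) (hs 0)
      (ih (π := fun n => π (n + 1)) (fun i => hs _) hk (fun j hj => hl _ (by omega)) hκ)

/-- As long as something lies above `v`, a step cannot see `v`. The compositionality of stack types
rests on this. -/
theorem Step.exists_append {u v : List Γ} {q : P} {d : Config P Γ} (hu : u ≠ [])
    (h : S.Step (q, u ++ v) d) : ∃ q' u', d = (q', u' ++ v) ∧ S.Step (q, u) (q', u') := by
  obtain ⟨t, r, hr, hk, ω', hc, rfl⟩ := h
  cases u with
  | nil => exact absurd rfl hu
  | cons γ u =>
    simp only [List.cons_append, Prod.mk.injEq, List.cons.injEq] at hc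
    obtain ⟨rfl, rfl, rfl⟩ := hc
    exact ⟨r.tgt, r.word ++ u, by simp, t, r, hr, hk, u, rfl, rfl⟩

theorem StepOf.append {t} {u u' : List Γ} {q q' : P} (v : List Γ) (h : S.StepOf t (q, u) (q', u')) :
    S.StepOf t (q, u ++ v) (q', u' ++ v) := by
  obtain ⟨r, hr, hk, ω', hc, hd⟩ := h
  simp only [Prod.mk.injEq] at hc hd
  obtain ⟨rfl, rfl⟩ := hc
  obtain ⟨rfl, rfl⟩ := hd
  exact ⟨r, hr, hk, ω' ++ v, by simp, by simp⟩

theorem not_step_nil {q : P} {d : Config P Γ} : ¬ S.Step (q, []) d := by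
  rintro ⟨t, r, hr, hk, ω', hc, rfl⟩
  simp at hc

theorem not_alive_nil {q : P} : ¬ S.Alive (q, []) := fun h =>
  let ⟨_, h, _⟩ := h.exists_step
  not_step_nil h

/-- Diverging above `v` does not depend on `v`. -/
theorem div_iff {u v : List Γ} {q : P} (hu : u ≠ []) : S.Div v (q, u ++ v) ↔ S.Alive (q, u) := by
  constructor
  · rintro ⟨π, hπ, hl⟩
    -- Cut `v` off from every stack of the diverging run; the rest is never empty because the stacks
    -- stay strictly higher than `v`.
    apply alive_coind (Z := fun c => c.2 ≠ [] ∧ S.Div v (c.1, c.2 ++ v)) _ ⟨hu, π, hπ, hl⟩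
    rintro ⟨q, u⟩ ⟨hu, π, hπ, hl⟩
    have h := hπ.2 0
    rw [hπ.1] at h
    obtain ⟨q', u', h1, h2⟩ := h.exists_append hu
    refine ⟨(q', u'), h2, ?_, _, h1 ▸ hπ.tail 1, fun j => hl _⟩
    rintro h0
    have := hl 1
    simp only at h0
    simp [h1, h0] at this
  · rintro ⟨π, hπ⟩
    refine ⟨fun j => ((π j).1, (π j).2 ++ v), ⟨by simp [hπ.1], fun i => ?_⟩, fun j => ?_⟩
    · obtain ⟨t, h⟩ := hπ.2 i
      exact ⟨t, h.append v⟩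
    · have : (π j).2 ≠ [] := by
        intro h0
        have := hπ.2 j
        rw [show π j = ((π j).1, []) from Prod.ext rfl h0] at this
        exact not_step_nil this
      have := List.length_pos_iff.2 this
      simp only [List.length_append]; omega

theorem exists_suffix_of_run {v : List Γ} {π : ℕ → Config P Γ}
    (hs : ∀ i, S.Step (π i) (π (i + 1))) (h0 : ∃ u, (π 0).2 = u ++ v) :
    ∀ k, (∀ j < k, v.length < (π j).2.length) → ∃ u, (π k).2 = u ++ v := by
  intro k
  induction k with
  | zero => intro _; exact h0
  | succ k ih =>
    intro hl
    obtain ⟨u, hu⟩ := ih (fun j hj => hl j (by omega))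
    have hne : u ≠ [] := by
      rintro rfl
      have := hl k (by omega)
      simp [hu] at this
    have := hs k
    rw [show π k = ((π k).1, u ++ v) from Prod.ext rfl hu] at this
    obtain ⟨q', u', h1, _⟩ := this.exists_append hne
    exact ⟨u', by rw [h1]⟩

/-- At the first position whose stack is not higher than `v`, the word `v` has not been touched yet
and is still a suffix, so the stack is exactly `v`. -/
theorem Pops.div_or {v : List Γ} {c : Config P Γ} {π} (hπ : S.IsRun c π)
    (h0 : ∃ u, c.2 = u ++ v) (hlt : v.length < c.2.length) :
    (∀ j, v.length < (π j).2.length) ∨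
      ∃ k, (∀ j ≤ k, v.length < (π j).2.length) ∧ (π (k + 1)).2 = v := by
  classical
  by_cases h : ∀ j, v.length < (π j).2.length
  · exact .inl h
  · right
    push Not at h
    have hk := Nat.find_spec h
    have hmin := fun j (hj : j < Nat.find h) => Nat.find_min h hj
    set k := Nat.find h
    cases hk' : k with
    | zero => rw [hk', hπ.1] at hk; omega
    | succ k' =>
      refine ⟨k', fun j hj => not_le.1 (hmin j (by omega)), ?_⟩
      obtain ⟨u, hu⟩ := exists_suffix_of_run hπ.2 (v := v) (by rw [hπ.1]; exact h0) k
        (fun j hj => not_le.1 (hmin j hj))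
      rw [hk'] at hu hk
      have : u = [] := by
        rw [hu, List.length_append] at hk
        exact List.length_eq_zero_iff.1 (by omega)
      simpa [this] using hu

/-- The abstract-successors of `c`. -/
theorem succ_a_iff {c : Config P Γ} {d} : S.Succ .a c d ↔
    (∃ e, S.StepOf .int c e ∧ S.Alive e ∧ d = some e) ∨
    (∃ e, S.StepOf .ret c e ∧ S.Alive e ∧ d = none) ∨
    (∃ e, S.StepOf .call c e ∧
      ((∃ q, S.Pops e.2.tail e q true ∧ S.Alive (q, e.2.tail) ∧ d = some (q, e.2.tail)) ∨
        (d = none ∧ (S.Div e.2.tail e ∨ ∃ q, S.Pops e.2.tail e q false ∧ S.Alive (q, e.2.tail))))) := by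
  have hcall : ∀ {e : Config P Γ}, S.StepOf .call c e →
      (∃ u, e.2 = u ++ e.2.tail) ∧ e.2.tail.length < e.2.length := by
    rintro e ⟨r, hr, hk, ω', hc, rfl⟩
    cases r with
    | call p γ q γ₁ γ₂ => exact ⟨⟨[γ₁], by simp [Rule.word]⟩, by simp [Rule.word]⟩
    | ret => simp [Rule.kind] at hk
    | int => simp [Rule.kind] at hk
  constructor
  · rintro ⟨π, hπ, h⟩
    have hfst : π 0 = c := hπ.1
    simp only [AbsSuccOn, zero_add, hfst] at h
    rcases h with ⟨hc, h⟩ | ⟨hi, rfl⟩ | ⟨hr, rfl⟩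
    · refine .inr (.inr ⟨_, hc, ?_⟩)
      obtain ⟨hu, hlt⟩ := hcall hc
      rcases h with ⟨k, ⟨h1, h2, h3, h4⟩, rfl⟩ | ⟨hno, rfl⟩
      · left
        obtain ⟨k, rfl⟩ : ∃ k', k = k' + 2 := ⟨k - 2, by omega⟩
        refine ⟨(π (k + 2)).1, ?_, ?_, ?_⟩
        · apply pops_of_run k (π := fun n => π (n + 1)) (fun i => hπ.2 _)
          · exact Prod.ext rfl h2
          · intro j hj
            exact h3 _ (by omega) (by omega)
          · simpa using h4
        · have := hπ.alive (k + 2)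
          rwa [show π (k + 2) = ((π (k + 2)).1, (π (0 + 1)).2.tail) from Prod.ext rfl h2] at this
        · exact congrArg some (Prod.ext rfl h2)
      · right
        refine ⟨rfl, ?_⟩
        rcases Pops.div_or (hπ.tail 1) hu hlt with h | ⟨k, h1, h2⟩
        · exact .inl ⟨_, hπ.tail 1, h⟩
        · right
          refine ⟨(π (k + 2)).1, ?_, ?_⟩
          · apply pops_of_run k (π := fun n => π (n + 1)) (fun i => hπ.2 _)
            · exact Prod.ext rfl h2
            · exact h1
            · simp only [Bool.false_eq_true, false_iff]
              intro h4
              refine hno ⟨k + 2, by omega, h2, fun j hj hj' => ?_, h4⟩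
              obtain ⟨j, rfl⟩ : ∃ j', j = j' + 1 := ⟨j - 1, by omega⟩
              exact h1 j (by omega)
          · have := hπ.alive (k + 2)
            rwa [show π (k + 2) = ((π (k + 2)).1, (π (0 + 1)).2.tail) from Prod.ext rfl h2] at this
    · exact .inl ⟨_, hi, hπ.alive 1, rfl⟩
    · exact .inr (.inl ⟨_, hr, hπ.alive 1, rfl⟩)
  -- For a call, the run is `c` followed by a run from `e`; all that remains is whether position `0`
  -- has a return-point on it.
  · have key : ∀ {e : Config P Γ} {π}, S.StepOf .call c e → S.IsRun e π →
        ((∃ k, S.IsReturnPoint (scons c π) 0 k ∧ d = some (scons c π k)) ∨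
          ((¬ ∃ k, S.IsReturnPoint (scons c π) 0 k) ∧ d = none)) → S.Succ .a c d := by
      intro e π hc hπ h
      exact ⟨_, hπ.cons ⟨_, hc⟩, .inl ⟨by simpa [scons, hπ.1] using hc, h⟩⟩
    rintro (⟨e, hi, ⟨π, hπ⟩, rfl⟩ | ⟨e, hr, ⟨π, hπ⟩, rfl⟩ |
      ⟨e, hc, ⟨q, hp, ha, rfl⟩ | ⟨rfl, ⟨π, hπ, hd⟩ | ⟨q, hp, ha⟩⟩⟩)
    · exact ⟨_, hπ.cons ⟨_, hi⟩, .inr (.inl ⟨by simpa [scons, hπ.1] using hi, by simp [scons, hπ.1]⟩)⟩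
    · exact ⟨_, hπ.cons ⟨_, hr⟩, .inr (.inr ⟨by simpa [scons, hπ.1] using hr, rfl⟩)⟩
    · obtain ⟨π, k, h1, h2, h3, h4⟩ := hp.exists_run ha
      refine key hc h1 (.inl ⟨k + 2, ⟨by omega, ?_, ?_, ?_⟩, ?_⟩)
      · simp [scons, h2, h1.1]
      · intro j hj hj'
        obtain ⟨j, rfl⟩ : ∃ j', j = j' + 1 := ⟨j - 1, by omega⟩
        simpa [scons, h1.1] using h3 j (by omega)
      · exact h4.1 rfl
      · simp [scons, h2]
    · refine key hc hπ (.inr ⟨?_, rfl⟩)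
      rintro ⟨k, h1, h2, -, -⟩
      obtain ⟨k, rfl⟩ : ∃ k', k = k' + 1 := ⟨k - 1, by omega⟩
      have := hd k
      simp only [scons, hπ.1] at h2
      rw [h2] at this
      exact lt_irrefl _ this
    · obtain ⟨π, k, h1, h2, h3, h4⟩ := hp.exists_run ha
      refine key hc h1 (.inr ⟨?_, rfl⟩)
      rintro ⟨k', h1', h2', h3', h4'⟩
      obtain ⟨k', rfl⟩ : ∃ k'', k' = k'' + 2 := ⟨k' - 2, by omega⟩
      simp only [scons, h1.1] at h2' h3'
      -- A return-point can only be the first arrival at `v`: before it the stack is too high, and a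
      -- later one would have that arrival strictly in between. The first arrival itself is not by a
      -- return.
      rcases lt_trichotomy k' k with h | rfl | h
      · have := h3 (k' + 1) (by omega)
        rw [h2'] at this
        exact lt_irrefl _ this
      · exact Bool.false_ne_true (h4.2 h4')
      · have := h3' (k + 2) (by omega) (by omega)
        simp only [h2, scons] at this
        exact lt_irrefl _ this

theorem Succ.alive {b} {c : Config P Γ} {d} (h : S.Succ b c d) : S.Alive c :=
  let ⟨π, hπ, _⟩ := h
  ⟨π, hπ⟩

theorem Succ.alive_some {b} {c e : Config P Γ} (h : S.Succ b c (some e)) : S.Alive e := by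
  cases b with
  | g => obtain ⟨_, h, _, h'⟩ := succ_g_iff.1 h; cases h; exact h'
  | a =>
    rcases succ_a_iff.1 h with ⟨e, _, ha, h'⟩ | ⟨e, _, _, h⟩ | ⟨e, _, ⟨q, _, ha, h'⟩ | ⟨h, _⟩⟩
    · cases h'; exact ha
    · cases h
    · cases h'; exact ha
    · cases h

theorem Alive.exists_succ {c : Config P Γ} (h : S.Alive c) (b) : ∃ d, S.Succ b c d := by
  obtain ⟨π, hπ⟩ := h
  cases b with
  | g => exact ⟨_, π, hπ, rfl⟩
  | a =>
    obtain ⟨t, ht⟩ := hπ.2 0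
    cases t with
    | call =>
      by_cases hk : ∃ k, S.IsReturnPoint π 0 k
      · obtain ⟨k, hk⟩ := hk
        exact ⟨_, π, hπ, .inl ⟨ht, .inl ⟨k, hk, rfl⟩⟩⟩
      · exact ⟨_, π, hπ, .inl ⟨ht, .inr ⟨hk, rfl⟩⟩⟩
    | ret => exact ⟨_, π, hπ, .inr (.inr ⟨ht, rfl⟩)⟩
    | int => exact ⟨_, π, hπ, .inr (.inl ⟨ht, rfl⟩)⟩

end PDS

/-! ### Until as a least fixed point -/

/-- The extension of a set of configurations to `⊥`, with a given truth value at `⊥`. -/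
def Ext {C : Type*} (Y : C → Prop) (n : Prop) : Option C → Prop
  | some c => Y c
  | none => n

theorem Ext.mono {C : Type*} {Y Z : C → Prop} {n : Prop} (h : ∀ c, Y c → Z c) {d} :
    Ext Y n d → Ext Z n d := by
  cases d <;> simp only [Ext]
  · exact id
  · exact h _

section Until
variable {P Γ : Type*} {S : PDS P Γ} {b : Mode} {A B : Option (Config P Γ) → Prop}

-- `A` and `B` are predicates on configurations and `⊥`, not formulas, because complements of
-- formulas hold at `⊥`. Thus `EUs` also covers the negation of `AR`, and `AUs` that of `ER`.
variable (S b A B) in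
def EUs (c : Config P Γ) : Prop :=
  ∃ σ, S.IsPath b c σ ∧ ∃ i, B (σ i) ∧ ∀ j < i, A (σ j)

variable (S b A B) in
def AUs (c : Config P Γ) : Prop :=
  ∀ σ, S.IsPath b c σ → ∃ i, B (σ i) ∧ ∀ j < i, A (σ j)

theorem PDS.IsPath.none {c : Config P Γ} {σ} (h : S.IsPath b c σ) {i : ℕ} (hi : σ i = none) :
    ∀ k, σ (i + k) = none := by
  intro k
  induction k with
  | zero => exact hi
  | succ k ih => have := h.2 (i + k); rw [ih] at this; exact this

theorem PDS.IsPath.tail {c d : Config P Γ} {σ} (h : S.IsPath b c σ) (h1 : σ 1 = some d) :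
    S.IsPath b d (fun n => σ (n + 1)) :=
  ⟨h1, fun i => h.2 (i + 1)⟩

theorem PDS.IsPath.cons {c d : Config P Γ} {σ} (h : S.IsPath b d σ) (hs : S.Succ b c (some d)) :
    S.IsPath b c (scons (some c) σ) := by
  refine ⟨rfl, fun i => ?_⟩
  cases i with
  | zero => simpa [scons, h.1] using hs
  | succ i => exact h.2 i

theorem isPath_none {c : Config P Γ} (hs : S.Succ b c none) :
    S.IsPath b c (scons (some c) fun _ => none) := by
  refine ⟨rfl, fun i => ?_⟩
  cases i with
  | zero => simpa [scons] using hs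
  | succ i => rfl

theorem PDS.IsPath.succ {c : Config P Γ} {σ} (h : S.IsPath b c σ) : S.Succ b c (σ 1) := by
  have := h.2 0
  rw [h.1] at this
  exact this

/-- A path from a live configuration that keeps to a set as long as possible. -/
theorem exists_isPath {c : Config P Γ} (hc : S.Alive c) (Z : Config P Γ → Prop) (n : Prop)
    (W : Config P Γ → Prop)
    (hZ : ∀ c, Z c → W c → ∃ d, S.Succ b c d ∧ Ext Z n d) :
    ∃ σ, S.IsPath b c σ ∧ ∀ i e, σ i = some e → Z e → W e → Ext Z n (σ (i + 1)) := by
  have := PDS.exists_seq (α := Option (Config P Γ)) (Z := Ext S.Alive True)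
    (R := fun x y => match x with
      | some e => S.Succ b e y ∧ (Z e → W e → Ext Z n y)
      | none => y = none) (c := some c) ?_ hc
  · obtain ⟨σ, h0, h1, h2⟩ := this
    refine ⟨σ, ⟨h0, fun i => ?_⟩, fun i e he => ?_⟩
    · have := h1 i
      cases h : σ i with
      | none => rw [h] at this; exact this
      | some e => rw [h] at this; exact this.1
    · have := h1 i
      rw [he] at this
      exact this.2
  · rintro (_ | e) he
    · exact ⟨none, rfl, trivial⟩
    · by_cases hZe : Z e ∧ W e
      · obtain ⟨d, hd, hd'⟩ := hZ e hZe.1 hZe.2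
        refine ⟨d, ⟨hd, fun _ _ => hd'⟩, ?_⟩
        cases d with
        | none => trivial
        | some d => exact hd.alive_some
      · obtain ⟨d, hd⟩ := PDS.Alive.exists_succ he b
        refine ⟨d, ⟨hd, fun h h' => absurd ⟨h, h'⟩ hZe⟩, ?_⟩
        cases d with
        | none => trivial
        | some d => exact hd.alive_some

/-- Liveness is essential: a dead configuration has no path at all, so it satisfies no existential
until and, by `AUs.dead`, every universal one. -/
theorem EUs.base {c : Config P Γ} (ha : S.Alive c) (hB : B (some c)) : EUs S b A B c := by
  obtain ⟨σ, hσ, _⟩ := exists_isPath (b := b) ha (fun _ => False) False (fun _ => False) (by simp)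
  exact ⟨σ, hσ, 0, by rwa [hσ.1], by simp⟩

theorem EUs.step {c : Config P Γ} {d} (hA : A (some c)) (hs : S.Succ b c d)
    (hd : Ext (EUs S b A B) (B none) d) : EUs S b A B c := by
  cases d with
  | none =>
    refine ⟨_, isPath_none hs, 1, hd, fun j hj => ?_⟩
    obtain rfl : j = 0 := by omega
    exact hA
  | some d =>
    obtain ⟨σ, hσ, i, hi, hj⟩ := hd
    refine ⟨_, hσ.cons hs, i + 1, hi, fun j hj' => ?_⟩
    cases j with
    | zero => exact hA
    | succ j => exact hj j (by omega)

theorem EUs.ind {X : Config P Γ → Prop} (h0 : ∀ c, S.Alive c → B (some c) → X c)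
    (h1 : ∀ c d, A (some c) → S.Succ b c d → Ext (fun c => EUs S b A B c ∧ X c) (B none) d → X c)
    {c : Config P Γ} (h : EUs S b A B c) : X c := by
  obtain ⟨σ, hσ, i, hi, hj⟩ := h
  induction i generalizing c σ with
  | zero => rw [hσ.1] at hi; exact h0 c hσ.succ.alive hi
  | succ i ih =>
    have hA := hj 0 (by omega)
    rw [hσ.1] at hA
    refine h1 c (σ 1) hA hσ.succ ?_
    cases hd : σ 1 with
    | none => have := hσ.none hd i; rw [add_comm 1 i] at this; rwa [this] at hi
    | some d =>
      have h' : ∀ j < i, A (σ (j + 1)) := fun j hj' => hj _ (by omega)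
      exact ⟨⟨_, hσ.tail hd, i, hi, h'⟩, ih _ (hσ.tail hd) hi h'⟩

theorem AUs.dead {c : Config P Γ} (ha : ¬ S.Alive c) : AUs S b A B c :=
  fun _ hσ => absurd hσ.succ.alive ha

theorem AUs.base {c : Config P Γ} (hB : B (some c)) : AUs S b A B c :=
  fun _ hσ => ⟨0, by rwa [hσ.1], by simp⟩

theorem AUs.step {c : Config P Γ} (hA : A (some c))
    (h : ∀ d, S.Succ b c d → Ext (AUs S b A B) (B none) d) : AUs S b A B c := by
  intro σ hσ
  have := h _ hσ.succ
  cases hd : σ 1 with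
  | none =>
    rw [hd] at this
    refine ⟨1, by rwa [hd], fun j hj => ?_⟩
    obtain rfl : j = 0 := by omega
    rwa [hσ.1]
  | some d =>
    rw [hd] at this
    obtain ⟨i, hi, hj⟩ := this _ (hσ.tail hd)
    refine ⟨i + 1, hi, fun j hj' => ?_⟩
    cases j with
    | zero => rwa [hσ.1]
    | succ j => exact hj j (by omega)

/-- If `X` failed at `c`, every configuration outside `AUs ∧ X` that satisfies `A` would have a
successor again outside (or `⊥` with `B none` false). Dependent choice yields a path that never
fulfils the until, so no finiteness of branching is needed. -/
theorem AUs.ind {X : Config P Γ → Prop}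
    (h0 : ∀ c, ¬ S.Alive c → X c) (h1 : ∀ c, B (some c) → X c)
    (h2 : ∀ c, A (some c) →
      (∀ d, S.Succ b c d → Ext (fun c => AUs S b A B c ∧ X c) (B none) d) → X c)
    {c : Config P Γ} (h : AUs S b A B c) : X c := by
  by_contra hX
  -- The complement of the conjunction is used because the step case `h2` is given both `AUs` and
  -- `X` at the successors.
  set Z : Config P Γ → Prop := fun c => ¬ (AUs S b A B c ∧ X c) with hZdef
  have key : ∀ c, Z c → S.Alive c ∧ ¬ B (some c) ∧
      (A (some c) → ∃ d, S.Succ b c d ∧ Ext Z (¬ B none) d) := by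
    intro c hc
    have hext : ∀ {Y : Config P Γ → Prop} {d}, (∀ c, Y c → AUs S b A B c ∧ X c) →
        ¬ Ext (fun c => AUs S b A B c ∧ X c) (B none) d → Ext Z (¬ B none) d := by
      intro Y d _ h
      cases d <;> exact h
    by_cases hY : AUs S b A B c
    · have hX : ¬ X c := fun h => hc ⟨hY, h⟩
      refine ⟨by_contra fun h => hX (h0 c h), fun h => hX (h1 c h), fun hA => ?_⟩
      by_contra hno
      push Not at hno
      refine hX (h2 c hA fun d hd => ?_)
      by_contra hne
      exact hno d hd (hext (Y := fun _ => False) (by simp) hne)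
    · refine ⟨by_contra fun h => hY (AUs.dead h), fun h => hY (AUs.base h), fun hA => ?_⟩
      by_contra hno
      push Not at hno
      refine hY (AUs.step hA fun d hd => ?_)
      by_contra hne
      refine hno d hd ?_
      cases d with
      | none => exact hne
      | some d => exact fun h => hne h.1
  have hZc : Z c := fun h => hX h.2
  obtain ⟨σ, hσ, hstay⟩ := exists_isPath (b := b) (key c hZc).1 Z (¬ B none)
    (fun c => A (some c)) (fun c hc hA => (key c hc).2.2 hA)
  obtain ⟨i, hi, hj⟩ := h σ hσ
  have hinv : ∀ k ≤ i, Ext Z (¬ B none) (σ k) := by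
    intro k
    induction k with
    | zero => intro _; rw [hσ.1]; exact hZc
    | succ k ih =>
      intro hk
      have h1 := ih (by omega)
      have hA := hj k (by omega)
      cases hd : σ k with
      | none =>
        rw [hd] at h1
        have := hσ.none hd 1
        rw [this]; exact h1
      | some e =>
        rw [hd] at h1 hA
        exact hstay k e hd h1 hA
  have := hinv i le_rfl
  cases hd : σ i with
  | none => rw [hd] at this hi; exact this hi
  | some e => rw [hd] at this hi; exact (key e this).2.1 hi

end Until

/-! ### Saturation of a table -/

/-- Set the bits `sb + p` of `x`, for all `p` in the list with `f p`. -/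
def orB (sb : ℕ) (f : ℕ → Bool) (x : ℕ) (l : List ℕ) : ℕ :=
  l.foldr (fun p a => if f p then a ||| 2 ^ (sb + p) else a) x

theorem testBit_orB (sb : ℕ) (f : ℕ → Bool) (x : ℕ) (l : List ℕ) (i : ℕ) :
    (orB sb f x l).testBit i = true ↔ x.testBit i = true ∨ ∃ p ∈ l, i = sb + p ∧ f p = true := by
  induction l with
  | nil => simp [orB]
  | cons p l ih =>
    simp only [orB, List.foldr_cons, List.mem_cons, exists_eq_or_imp] at ih ⊢
    split_ifs with h
    · rw [Nat.testBit_or, Bool.or_eq_true, ih, Nat.testBit_two_pow]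
      simp only [decide_eq_true_eq, h, and_true, eq_comm (a := i)]
      rw [or_assoc, or_comm (a := ∃ p ∈ l, _)]
    · rw [ih]
      simp [h]

theorem orB_lt {sb : ℕ} {f : ℕ → Bool} {x K m : ℕ} (hx : x < 2 ^ K) (hK : sb + m ≤ K) {l : List ℕ}
    (hl : ∀ p ∈ l, p < m) : orB sb f x l < 2 ^ K := by
  induction l with
  | nil => exact hx
  | cons p l ih =>
    simp only [orB, List.foldr_cons] at ih ⊢
    have h1 := ih fun q hq => hl q (List.mem_cons_of_mem _ hq)
    have h2 := hl p List.mem_cons_self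
    split_ifs with h
    · exact Nat.or_lt_two_pow h1 (Nat.pow_lt_pow_right (by norm_num) (by omega))
    · exact h1

/-- Stack symbol, then type of the stack below it; the value is the type of the longer stack. Types
are bit vectors written as natural numbers. -/
abbrev Table := ℕ → ℕ → ℕ

/-- One simultaneous update of the bits `sb, …, sb + m - 1` of a table. -/
def upd (m nG TC sb : ℕ) (nb : Table → ℕ → ℕ → ℕ → Bool) (F : Table) : Table := fun g T =>
  if g ≤ nG ∧ T < TC then orB sb (fun p => nb F p g T) (F g T) (List.range m) else F g T

section upd
variable {m nG TC sb K : ℕ} {nb : Table → ℕ → ℕ → ℕ → Bool} {F F0 : Table}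

theorem testBit_upd (g T i : ℕ) : (upd m nG TC sb nb F g T).testBit i = true ↔
    (F g T).testBit i = true ∨
      g ≤ nG ∧ T < TC ∧ ∃ p < m, i = sb + p ∧ nb F p g T = true := by
  unfold upd
  split_ifs with h
  · rw [testBit_orB]; simp [h.1, h.2]
  · simp only [not_and] at h
    constructor
    · exact .inl
    · rintro (h' | ⟨h1, h2, _⟩)
      · exact h'
      · exact absurd h2 (h h1)

/-- The tables agree on all bits except `sb, …, sb + m - 1`. -/
def AgreeOff (m sb : ℕ) (F0 F : Table) : Prop :=
  ∀ g T i, (i < sb ∨ sb + m ≤ i) → (F g T).testBit i = (F0 g T).testBit i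

def Rng (nG TC : ℕ) (F : Table) : Prop := ∀ g T, g ≤ nG → T < TC → F g T < TC

theorem agreeOff_iterate (k : ℕ) : AgreeOff m sb F0 ((upd m nG TC sb nb)^[k] F0) := by
  induction k with
  | zero => intro _ _ _ _; rfl
  | succ k ih =>
    intro g T i hi
    rw [Function.iterate_succ_apply', ← ih g T i hi, Bool.eq_iff_iff, testBit_upd]
    constructor
    · rintro (h | ⟨_, _, p, hp, rfl, _⟩)
      · exact h
      · omega
    · exact .inl

theorem upd_lt (hT : F g T < 2 ^ K) (hK : sb + m ≤ K) : upd m nG TC sb nb F g T < 2 ^ K := by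
  unfold upd
  split_ifs with h
  · exact orB_lt hT hK (by simp)
  · exact hT

theorem iterate_lt (hT : F0 g T < 2 ^ K) (hK : sb + m ≤ K) (k : ℕ) :
    (upd m nG TC sb nb)^[k] F0 g T < 2 ^ K := by
  induction k with
  | zero => exact hT
  | succ k ih => rw [Function.iterate_succ_apply']; exact upd_lt ih hK

theorem rng_iterate (hF : Rng nG (2 ^ K) F0) (hK : sb + m ≤ K) (k : ℕ) :
    Rng nG (2 ^ K) ((upd m nG TC sb nb)^[k] F0) := fun g T hg hT =>
  iterate_lt (hF g T hg hT) hK k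

/-- An iterate that is not fixed comes after iterates that are not fixed either, and each of them
has raised the measure; `M + 1` rises exceed the bound. -/
theorem iterate_stable {α : Type*} (f : α → α) (μ : α → ℕ) (M : ℕ) (hM : ∀ x, μ x ≤ M)
    (hμ : ∀ x, f x ≠ x → μ x < μ (f x)) (x : α) : f (f^[M] x) = f^[M] x := by
  have key : ∀ k, f (f^[k] x) ≠ f^[k] x → k < μ (f^[k + 1] x) := by
    intro k
    induction k with
    | zero => intro h; exact Nat.zero_lt_of_lt (hμ _ h)
    | succ k ih =>
      intro h
      rw [Function.iterate_succ_apply' f (k + 1)]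
      refine lt_of_le_of_lt ?_ (hμ _ h)
      apply ih
      intro h'
      apply h
      rw [Function.iterate_succ_apply' f k, h', h']
  by_contra h
  exact absurd (hM (f^[M + 1] x)) (not_le.2 (key M h))

/-- Bits are only switched on, so the number of set bits in the updated block is a measure, bounded
by the number of these bits. Monotonicity of `nb` plays no role. -/
theorem upd_stable (F0 : Table) :
    upd m nG TC sb nb ((upd m nG TC sb nb)^[m * ((nG + 1) * TC)] F0) =
      (upd m nG TC sb nb)^[m * ((nG + 1) * TC)] F0 := by
  set D := Finset.range m ×ˢ (Finset.range (nG + 1) ×ˢ Finset.range TC) with hD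
  apply iterate_stable _ (fun F => (D.filter fun x => (F x.2.1 x.2.2).testBit (sb + x.1)).card)
  · intro F
    refine (Finset.card_filter_le _ _).trans ?_
    simp [hD]
  · intro F hF
    have : ∃ g T, upd m nG TC sb nb F g T ≠ F g T := by
      by_contra h
      push Not at h
      exact hF (funext fun g => funext fun T => h g T)
    obtain ⟨g, T, h⟩ := this
    obtain ⟨i, hi⟩ := Nat.exists_testBit_ne_of_ne h
    have hi' : (upd m nG TC sb nb F g T).testBit i = true ∧ (F g T).testBit i = false := by
      cases h1 : (F g T).testBit i with
      | true => exact absurd ((testBit_upd (nb := nb) g T i).2 (.inl h1)) (by rw [h1] at hi; exact hi)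
      | false => rw [h1] at hi; exact ⟨by simpa using hi, rfl⟩
    rcases (testBit_upd _ _ _).1 hi'.1 with h1 | ⟨hg, hT, p, hp, rfl, -⟩
    · rw [hi'.2] at h1; cases h1
    · apply Finset.card_lt_card
      rw [Finset.ssubset_iff_of_subset]
      · refine ⟨(p, g, T), ?_, ?_⟩
        · simp only [hD, Finset.mem_filter, Finset.mem_product, Finset.mem_range]
          exact ⟨⟨hp, by omega, hT⟩, hi'.1⟩
        · simp [hi'.2]
      · intro x hx
        simp only [Finset.mem_filter] at hx ⊢
        exact ⟨hx.1, (testBit_upd _ _ _).2 (.inl hx.2)⟩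

/-- The bits of a saturated table whose derivation does not depend on the table. -/
theorem testBit_iterate_const {C : Prop} {g T p : ℕ} (hg : g ≤ nG) (hT : T < TC) (hp : p < m)
    (h0 : (F0 g T).testBit (sb + p) = false)
    (hC : ∀ F, AgreeOff m sb F0 F → ((F g T).testBit (sb + p) = true → C) →
      (nb F p g T = true ↔ C)) :
    ((upd m nG TC sb nb)^[m * ((nG + 1) * TC)] F0 g T).testBit (sb + p) = true ↔ C := by
  have hs : ∀ k, ((upd m nG TC sb nb)^[k] F0 g T).testBit (sb + p) = true → C := by
    intro k
    induction k with
    | zero => intro h; rw [Function.iterate_zero, id, h0] at h; cases h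
    | succ k ih =>
      rw [Function.iterate_succ_apply', testBit_upd]
      rintro (h | ⟨_, _, q, _, hq, h⟩)
      · exact ih h
      · obtain rfl : p = q := by omega
        exact (hC _ (agreeOff_iterate k) ih).1 h
  refine ⟨hs _, fun h => ?_⟩
  rw [← upd_stable, testBit_upd]
  exact .inr ⟨hg, hT, p, hp, rfl, (hC _ (agreeOff_iterate _) (hs _)).2 h⟩

end upd

/-! ### Tables that represent least fixed points on configurations -/

/-- The induction principle has `Y` next to `X` in its hypothesis, the form in which `EUs.ind` and
`AUs.ind` deliver it. -/
structure IsLfp {C : Type*} (Op : (C → Prop) → C → Prop) (Y : C → Prop) : Prop where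
  mono : ∀ Z Z', (∀ c, Z c → Z' c) → ∀ c, Op Z c → Op Z' c
  closed : ∀ c, Op Y c → Y c
  ind : ∀ X : C → Prop, (∀ c, Op (fun c => Y c ∧ X c) c → X c) → ∀ c, Y c → X c

theorem IsLfp.iff {C : Type*} {Op : (C → Prop) → C → Prop} {Y : C → Prop} (h : IsLfp Op Y) (c) :
    Y c ↔ Op Y c :=
  ⟨h.ind _ (fun c hc => h.mono _ _ (fun _ h => h.1) c hc) c, h.closed c⟩

section table
variable {m n : ℕ}

/-- The type of `w ++ v` when `T` is the type of `v`. -/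
def evalW (F : Table) (w : List (Fin n)) (T : ℕ) : ℕ := w.foldr (fun g x => F g x) T

@[simp] theorem evalW_nil (F : Table) (T : ℕ) : evalW F ([] : List (Fin n)) T = T := rfl

@[simp] theorem evalW_cons (F : Table) (g : Fin n) (w : List (Fin n)) (T : ℕ) :
    evalW F (g :: w) T = F g (evalW F w T) := rfl

theorem evalW_append (F : Table) (w w' : List (Fin n)) (T : ℕ) :
    evalW F (w ++ w') T = evalW F w (evalW F w' T) := by simp [evalW]

theorem evalW_lt {F : Table} {nG TC T : ℕ} (hn : n ≤ nG) (hF : Rng nG TC F) (hT : T < TC)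
    (w : List (Fin n)) : evalW F w T < TC := by
  induction w with
  | nil => exact hT
  | cons g w ih => exact hF _ _ (by omega) ih

/-- The set of configurations `⟨q, u v⟩` with a bit set at `u` over the type `T` of `v`. -/
def Bz (F : Table) (b T : ℕ) (v : List (Fin n)) (c : Config (Fin m) (Fin n)) : Prop :=
  ∃ u, c.2 = u ++ v ∧ (evalW F u T).testBit (b + c.1) = true

theorem bz_iff {F : Table} {b T : ℕ} {v u : List (Fin n)} {q : Fin m} :
    Bz F b T v (q, u ++ v) ↔ (evalW F u T).testBit (b + q) = true := by
  constructor
  · rintro ⟨u', h, h'⟩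
    rwa [List.append_cancel_right h]
  · exact fun h => ⟨u, rfl, h⟩

/-- `Base T v` is what the other bits of `T` must say about `v`; as the update leaves them alone, it
survives in every intermediate table. Soundness is by induction on the rounds: a new bit is
justified by `Op` applied to the set that the old bits represent, and that set lies in `Y`.
Completeness is by induction on `Y`: if `Op` derives a configuration from others whose bits are set,
the next round would set its bit, and the table is stable. -/
theorem table_correct {nG K sb : ℕ} {nb : Table → ℕ → ℕ → ℕ → Bool} {F0 : Table}
    (hn : n ≤ nG) (hK : sb + m ≤ K) (hF0 : Rng nG (2 ^ K) F0)
    (hbits : ∀ g T p, p < m → (F0 g T).testBit (sb + p) = false)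
    {Base : ℕ → List (Fin n) → Prop}
    (hB : ∀ F, AgreeOff m sb F0 F → Rng nG (2 ^ K) F → ∀ (g : Fin n) T v, T < 2 ^ K → Base T v →
      Base (F g T) (g :: v))
    {Y : Config (Fin m) (Fin n) → Prop} {Op} (hY : IsLfp Op Y)
    (hnb : ∀ F, AgreeOff m sb F0 F → Rng nG (2 ^ K) F → ∀ (g : Fin n) T v (p : Fin m), T < 2 ^ K →
      Base T v → ∀ Z : Config (Fin m) (Fin n) → Prop,
      (∀ q u, (evalW F u T).testBit (sb + (q : Fin m)) = true ↔ Z (q, u ++ v)) →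
      (nb F p g T = true ↔ Op Z (p, g :: v)))
    {T : ℕ} {v : List (Fin n)} (hT : T < 2 ^ K) (hTB : Base T v)
    (hTY : ∀ q : Fin m, T.testBit (sb + q) = true ↔ Y (q, v)) (g : Fin n) (q : Fin m) :
    ((upd m nG (2 ^ K) sb nb)^[m * ((nG + 1) * 2 ^ K)] F0 g T).testBit (sb + q) = true ↔
      Y (q, g :: v) := by
  have hBw : ∀ F, AgreeOff m sb F0 F → Rng nG (2 ^ K) F → ∀ {T v}, T < 2 ^ K → Base T v →
      ∀ u : List (Fin n), Base (evalW F u T) (u ++ v) := by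
    intro F hF hR T v hT hTB u
    induction u with
    | nil => exact hTB
    | cons g u ih => exact hB F hF hR g _ _ (evalW_lt hn hR hT _) ih
  constructor
  · have hs : ∀ k, ∀ {T : ℕ} {v : List (Fin n)}, T < 2 ^ K → Base T v →
        (∀ q : Fin m, T.testBit (sb + q) = true → Y (q, v)) → ∀ (g : Fin n) (q : Fin m),
        ((upd m nG (2 ^ K) sb nb)^[k] F0 g T).testBit (sb + q) = true → Y (q, g :: v) := by
      intro k
      induction k with
      | zero => intro T v _ _ _ g q h; rw [Function.iterate_zero, id, hbits _ _ _ q.2] at h; cases h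
      | succ k ih =>
        intro T v hT hTB hTY g q
        rw [Function.iterate_succ_apply', testBit_upd]
        set F := (upd m nG (2 ^ K) sb nb)^[k] F0
        have hFa : AgreeOff m sb F0 F := agreeOff_iterate k
        have hFr : Rng nG (2 ^ K) F := rng_iterate hF0 hK k
        rintro (h | ⟨_, _, q', _, hq, h⟩)
        · exact ih hT hTB hTY g q h
        · obtain rfl : (q : ℕ) = q' := by omega
          refine hY.closed _ (hY.mono _ _ ?_ _ 
            ((hnb F hFa hFr g T v q hT hTB _ fun _ _ => bz_iff.symm).1 h))
          rintro ⟨p, w⟩ ⟨u, rfl, hu⟩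
          have : ∀ u : List (Fin n), ∀ p : Fin m, (evalW F u T).testBit (sb + p) = true →
              Y (p, u ++ v) := by
            intro u
            induction u with
            | nil => exact hTY
            | cons g u ihu =>
              exact ih (evalW_lt hn hFr hT _) (hBw F hFa hFr hT hTB u) ihu g
          exact this u p hu
    exact hs _ hT hTB (fun q => (hTY q).1) g q
  · intro h
    set F := (upd m nG (2 ^ K) sb nb)^[m * ((nG + 1) * 2 ^ K)] F0 with hFdef
    have hFa : AgreeOff m sb F0 F := agreeOff_iterate _
    have hFr : Rng nG (2 ^ K) F := rng_iterate hF0 hK _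
    have := hY.ind (fun c => ∀ u, c.2 = u ++ v → (evalW F u T).testBit (sb + c.1) = true) ?_ _ h
      [g] rfl
    · exact this
    · rintro ⟨p, w⟩ hOp u rfl
      cases u with
      | nil =>
        exact (hTY p).2 (hY.closed _ (hY.mono _ _ (fun _ h => h.1) _ hOp))
      | cons g u =>
        have hlt := evalW_lt hn hFr hT u
        change (F g (evalW F u T)).testBit (sb + p) = true
        have hst : upd m nG (2 ^ K) sb nb F = F := upd_stable F0
        rw [← congrFun (congrFun hst g) (evalW F u T), testBit_upd]
        refine .inr ⟨by omega, hlt, p, p.2, rfl, ?_⟩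
        -- `hnb` wants a set that agrees with the bits above `u ++ v`, while the induction
        -- hypothesis speaks of stacks above `v`. In the union of both sets the alternatives
        -- coincide above `u ++ v` by `evalW_append`, and monotonicity of `Op` covers the rest.
        refine (hnb F hFa hFr g _ (u ++ v) p hlt (hBw F hFa hFr hT hTB u)
          (fun c => (∃ w, c.2 = w ++ (u ++ v) ∧ (evalW F w (evalW F u T)).testBit (sb + c.1) = true) ∨
            (Y c ∧ ∀ u, c.2 = u ++ v → (evalW F u T).testBit (sb + c.1) = true)) ?_).2
          (hY.mono _ _ (fun _ => .inr) _ hOp)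
        intro q w
        constructor
        · exact fun h => .inl ⟨w, rfl, h⟩
        · rintro (⟨w', hw, h⟩ | ⟨_, h⟩)
          · rwa [List.append_cancel_right hw]
          · rw [← evalW_append]
            exact h (w ++ u) (by simp)

end table

/-! ### Evaluating one node of the formula -/

/-- The parameters of a node: its group (`0` disjunction, `1` existential, `2` universal, `3` label),
its mode (`0` global, `1` abstract, `2` reachability of the bottom), flags, and bit positions. -/
structure Prm where
  grp : ℕ
  md : ℕ
  fl : Bool
  nv : Bool
  ap : Bool
  bp : Bool
  zb : ℕ
  sb : ℕ
  db : ℕ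
  ab : ℕ
  bb : ℕ
  lab : ℕ → Bool

/-- A target counts only if a run goes on from it, so its dead bit, stored from `db` on, has to be
off. -/
def Prm.hit (k : Prm) (x q : ℕ) (v : Bool) : Bool := !x.testBit (k.db + q) && v

def Prm.zv (k : Prm) (x q : ℕ) (f : Bool) : Bool := (x.testBit (k.zb + q)) ^^ f

section
variable {m n : ℕ}

def isRet (p g q : ℕ) : Rule (Fin m) (Fin n) → Bool
  | .ret a b c => a.val == p && b.val == g && c.val == q
  | _ => false

/-- There is a return rule `⟨p, g⟩ → ⟨q, ε⟩`. -/
def dret (rs : List (Rule (Fin m) (Fin n))) (p g q : ℕ) : Bool := rs.any (isRet p g q)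

variable (rs : List (Rule (Fin m) (Fin n)))

/-- The case where the successor is the next configuration itself. In mode `2` the bit is evaluated
as in `acc`. Whether an arrival is by a return is decided by `dret` and not by the kind of `r`: an
internal rule with empty word may cause the same step as a return rule, and `StepOf .ret` holds for
the step if any return rule causes it. -/
def normGood (k : Prm) (F : Table) (T : ℕ) (r : Rule (Fin m) (Fin n)) : Bool :=
  let x := evalW F r.word T
  k.hit x r.tgt (k.zv x r.tgt
    (if k.md = 2 ∧ dret rs r.src r.top r.tgt = true then x.testBit (m + r.tgt) else k.fl))

/-- The two columns of the pop table single out the arrivals at `q'` by a return, which give a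
return-point, and those not by a return, which give `⊥` with its value `nv`. -/
def callGood (k : Prm) (F1 : Table) (x g q q' : ℕ) : Bool :=
  ((F1 g (2 ^ (m + q'))).testBit q && k.hit x q' (k.zv x q' k.fl)) ||
    ((F1 g (2 ^ (m + q') + 2 ^ q')).testBit q && k.hit x q' k.nv)

/-- In abstract mode a return leads to `⊥`, provided a run goes on. A call also leads to `⊥` if `g₁`
is never popped: `Td` declares every location below dead, so being alive in the cell `F g₁ Td` means
diverging above `g₁`. -/
def good (F1 : Table) (Td : ℕ) (k : Prm) (F : Table) (T : ℕ) (r : Rule (Fin m) (Fin n)) : Bool :=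
  if k.md = 1 then
    match r with
    | .ret _ _ q => k.hit T q k.nv
    | .call _ _ q g₁ g₂ =>
      ((List.range m).any fun q' => callGood (m := m) k F1 (F g₂ T) g₁ q q') ||
        k.hit (F g₁ Td) q k.nv
    | .int _ _ _ _ => normGood rs k F T r
  else normGood rs k F T r

def ebit (F1 : Table) (Td : ℕ) (k : Prm) (F : Table) (p g T : ℕ) : Bool :=
  rs.any fun r => (r.src.val == p && r.top.val == g) && good rs F1 Td k F T r

/-- The Boolean counterpart of `opF`. For a universal node, `e` reports a successor that violates
the requirement and enters negated. -/
def comb (k : Prm) (y p : ℕ) (e : Bool) : Bool :=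
  let d := y.testBit (k.db + p)
  let a := (y.testBit (k.ab + p)) ^^ k.ap
  let b := (y.testBit (k.bb + p)) ^^ k.bp
  match k.grp with
  | 0 => a || b
  | 1 => (!d && b) || (a && e)
  | 2 => d || b || (a && !e)
  | _ => k.lab p

def newb (F1 : Table) (Td : ℕ) (k : Prm) (F : Table) (p g T : ℕ) : Bool :=
  comb k (F g T) p (ebit rs F1 Td k F p g T)

variable {rs} {S : PDS (Fin m) (Fin n)}

theorem ebit_true_iff {F1 F : Table} {Td T : ℕ} {k : Prm} {p : Fin m} {g : Fin n} :
    ebit rs F1 Td k F p g T = true ↔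
      ∃ r ∈ rs, r.src = p ∧ r.top = g ∧ good rs F1 Td k F T r = true := by
  simp [ebit, Fin.val_inj, and_assoc]

theorem stepOf_cons_iff (hrs : ∀ r, r ∈ rs ↔ r ∈ S.Δ) {t} {p : Fin m} {g : Fin n} {v} {e} :
    S.StepOf t (p, g :: v) e ↔
      ∃ r ∈ rs, r.src = p ∧ r.top = g ∧ r.kind = t ∧ e = (r.tgt, r.word ++ v) := by
  constructor
  · rintro ⟨r, hr, hk, ω', hc, rfl⟩
    simp only [Prod.mk.injEq, List.cons.injEq] at hc
    obtain ⟨rfl, rfl, rfl⟩ := hc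
    exact ⟨r, (hrs r).2 hr, rfl, rfl, hk, rfl⟩
  · rintro ⟨r, hr, rfl, rfl, hk, rfl⟩
    exact ⟨r, (hrs r).1 hr, hk, v, rfl, rfl⟩

theorem step_cons_iff (hrs : ∀ r, r ∈ rs ↔ r ∈ S.Δ) {p : Fin m} {g : Fin n} {v} {e} :
    S.Step (p, g :: v) e ↔ ∃ r ∈ rs, r.src = p ∧ r.top = g ∧ e = (r.tgt, r.word ++ v) := by
  simp only [PDS.Step, stepOf_cons_iff hrs]
  constructor
  · rintro ⟨t, r, hr, h1, h2, _, h3⟩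
    exact ⟨r, hr, h1, h2, h3⟩
  · rintro ⟨r, hr, h1, h2, h3⟩
    exact ⟨_, r, hr, h1, h2, rfl, h3⟩

theorem dret_iff (hrs : ∀ r, r ∈ rs ↔ r ∈ S.Δ) {p q : Fin m} {g : Fin n} :
    dret rs p g q = true ↔ Rule.ret p g q ∈ S.Δ := by
  rw [dret, List.any_eq_true]
  constructor
  · rintro ⟨r, hr, h⟩
    cases r with
    | ret a b c =>
      simp only [isRet, Bool.and_eq_true, beq_iff_eq, Fin.val_inj] at h
      obtain ⟨⟨rfl, rfl⟩, rfl⟩ := h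
      exact (hrs _).1 hr
    | call => simp [isRet] at h
    | int => simp [isRet] at h
  · exact fun h => ⟨_, (hrs _).2 h, by simp [isRet]⟩

/-- The mode number of a mode. -/
def Mode.num : Mode → ℕ
  | .g => 0
  | .a => 1

/-- Rule by rule this is `succ_g_iff` and `succ_a_iff`, once dead bits, pop table and the column
`Td` are known to decide `Alive`, `Pops` and `Div`. The flag `k.fl` chooses between looking for a
successor inside or outside of `Z`. -/
theorem ebit_iff_succ (hrs : ∀ r, r ∈ rs ↔ r ∈ S.Δ) {F1 F : Table} {Td T : ℕ} {k : Prm} {b : Mode}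
    (hb : k.md = b.num) {v : List (Fin n)} {Z : Config (Fin m) (Fin n) → Prop}
    (hal : ∀ (q : Fin m) u, (evalW F u T).testBit (k.db + q) = false ↔ S.Alive (q, u ++ v))
    (hZ : ∀ (q : Fin m) u, (evalW F u T).testBit (k.zb + q) = true ↔ Z (q, u ++ v))
    (hR1 : ∀ (q q' : Fin m) (g : Fin n) v,
      (F1 g (2 ^ (m + q'))).testBit q = true ↔ S.Pops v (q, g :: v) q' true)
    (hR0 : ∀ (q q' : Fin m) (g : Fin n) v,
      (F1 g (2 ^ (m + q') + 2 ^ (q' : ℕ))).testBit q = true ↔ S.Pops v (q, g :: v) q' false)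
    (hdiv : ∀ (q : Fin m) (g : Fin n) v,
      (F g Td).testBit (k.db + q) = false ↔ S.Div v (q, g :: v)) {p : Fin m} {g : Fin n} :
    ebit rs F1 Td k F p g T = true ↔
      ∃ d, S.Succ b (p, g :: v) d ∧ Ext (fun e => (Z e ↔ k.fl = false)) (k.nv = true) d := by
  rw [ebit_true_iff]
  have hx : ∀ (q : Fin m) u, k.zv (evalW F u T) q k.fl = true ↔ (Z (q, u ++ v) ↔ k.fl = false) := by
    intro q u
    rw [← hZ, Prm.zv]
    cases (evalW F u T).testBit (k.zb + q) <;> cases k.fl <;> simp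
  have hmd : k.md ≠ 2 := by rw [hb]; cases b <;> simp [Mode.num]
  have hnorm : ∀ r : Rule (Fin m) (Fin n), normGood rs k F T r = true ↔
      S.Alive (r.tgt, r.word ++ v) ∧ (Z (r.tgt, r.word ++ v) ↔ k.fl = false) := by
    intro r
    simp only [normGood, hmd, false_and, if_false, Prm.hit, Bool.and_eq_true, Bool.not_eq_true', hal,
      hx]
  cases b with
  | g =>
    have : k.md ≠ 1 := by rw [hb]; simp [Mode.num]
    simp only [good, this, if_false, hnorm, PDS.succ_g_iff]
    constructor
    · rintro ⟨r, hr, h1, h2, h3, h4⟩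
      exact ⟨_, ⟨_, rfl, (step_cons_iff hrs).2 ⟨r, hr, h1, h2, rfl⟩, h3⟩, h4⟩
    · rintro ⟨d, ⟨e, rfl, hs, ha⟩, he⟩
      obtain ⟨r, hr, h1, h2, rfl⟩ := (step_cons_iff hrs).1 hs
      exact ⟨r, hr, h1, h2, ha, he⟩
  | a =>
    have hmd1 : k.md = 1 := hb
    simp only [good, hmd1, if_true]
    constructor
    · rintro ⟨r, hr, h1, h2, h3⟩
      cases r with
      | int p' g' q w =>
        rw [hnorm] at h3
        exact ⟨_, PDS.succ_a_iff.2 (.inl ⟨_, (stepOf_cons_iff hrs).2 ⟨_, hr, h1, h2, rfl, rfl⟩,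
          h3.1, rfl⟩), h3.2⟩
      | ret p' g' q =>
        simp only [Prm.hit, Bool.and_eq_true, Bool.not_eq_true'] at h3
        rw [show T = evalW F ([] : List (Fin n)) T from rfl, hal] at h3
        exact ⟨_, PDS.succ_a_iff.2 (.inr (.inl ⟨_, (stepOf_cons_iff hrs).2 ⟨_, hr, h1, h2, rfl, rfl⟩,
          h3.1, rfl⟩)), h3.2⟩
      | call p' g' q g₁ g₂ =>
        have hs := (stepOf_cons_iff hrs (v := v)).2 ⟨_, hr, h1, h2, rfl, rfl⟩
        simp only [Bool.or_eq_true, List.any_eq_true, List.mem_range, callGood, Prm.hit,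
          Bool.and_eq_true, Bool.not_eq_true'] at h3
        rw [show F g₂ T = evalW F [g₂] T from rfl] at h3
        rcases h3 with ⟨q', hq', ⟨h4, h5, h6⟩ | ⟨h4, h5, h6⟩⟩ | ⟨h4, h5⟩
        · have h4 := (hR1 q ⟨q', hq'⟩ g₁ (g₂ :: v)).1 h4
          have h5 := (hal ⟨q', hq'⟩ _).1 h5
          have h6 := (hx ⟨q', hq'⟩ _).1 h6
          exact ⟨_, PDS.succ_a_iff.2 (.inr (.inr ⟨_, hs, .inl ⟨_, h4, h5, rfl⟩⟩)), h6⟩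
        · have h4 := (hR0 q ⟨q', hq'⟩ g₁ (g₂ :: v)).1 h4
          have h5 := (hal ⟨q', hq'⟩ _).1 h5
          exact ⟨_, PDS.succ_a_iff.2 (.inr (.inr ⟨_, hs, .inr ⟨rfl, .inr ⟨_, h4, h5⟩⟩⟩)), h6⟩
        · have h4 := (hdiv q g₁ (g₂ :: v)).1 h4
          exact ⟨_, PDS.succ_a_iff.2 (.inr (.inr ⟨_, hs, .inr ⟨rfl, .inl h4⟩⟩)), h5⟩
    · rintro ⟨d, hd, he⟩
      rcases PDS.succ_a_iff.1 hd with ⟨e, hs, ha, rfl⟩ | ⟨e, hs, ha, rfl⟩ | ⟨e, hs, h⟩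
      · obtain ⟨r, hr, h1, h2, h3, rfl⟩ := (stepOf_cons_iff hrs).1 hs
        refine ⟨r, hr, h1, h2, ?_⟩
        cases r with
        | int => exact (hnorm _).2 ⟨ha, he⟩
        | call => simp [Rule.kind] at h3
        | ret => simp [Rule.kind] at h3
      · obtain ⟨r, hr, h1, h2, h3, rfl⟩ := (stepOf_cons_iff hrs).1 hs
        refine ⟨r, hr, h1, h2, ?_⟩
        cases r with
        | ret p' g' q =>
          simp only [Prm.hit, Bool.and_eq_true, Bool.not_eq_true']
          exact ⟨(hal q []).2 ha, he⟩
        | call => simp [Rule.kind] at h3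
        | int => simp [Rule.kind] at h3
      · obtain ⟨r, hr, h1, h2, h3, rfl⟩ := (stepOf_cons_iff hrs).1 hs
        refine ⟨r, hr, h1, h2, ?_⟩
        cases r with
        | ret => simp [Rule.kind] at h3
        | int => simp [Rule.kind] at h3
        | call p' g' q g₁ g₂ =>
          simp only [Bool.or_eq_true, List.any_eq_true, List.mem_range, callGood, Prm.hit,
            Bool.and_eq_true, Bool.not_eq_true']
          rw [show F g₂ T = evalW F [g₂] T from rfl]
          rcases h with ⟨q', h4, h5, rfl⟩ | ⟨rfl, h4 | ⟨q', h4, h5⟩⟩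
          · exact .inl ⟨q', q'.2, .inl ⟨(hR1 q q' g₁ _).2 h4, (hal q' [g₂]).2 h5, (hx q' [g₂]).2 he⟩⟩
          · exact .inr ⟨(hdiv q g₁ _).2 h4, he⟩
          · exact .inl ⟨q', q'.2, .inr ⟨(hR0 q q' g₁ _).2 h4, (hal q' [g₂]).2 h5, he⟩⟩

/-! ### Reachability of the bottom -/

/-- The type `T` accepts an arrival at `q`; the flag says whether by a return. -/
def acc (m T q : ℕ) (κ : Bool) : Bool := T.testBit q ^^ (κ && T.testBit (m + q))

/-- Position `K` lies beyond every type, so the bits read there are `0`: nothing counts as dead, and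
with `ap` set the combination reduces to the existence of a good rule. -/
def popPrm (K : ℕ) : Prm where
  grp := 1
  md := 2
  fl := false
  nv := false
  ap := true
  bp := false
  zb := 0
  sb := 0
  db := K
  ab := K
  bb := K
  lab := fun _ => false

theorem testBit_ge {x K : ℕ} (hx : x < 2 ^ K) (i : ℕ) : x.testBit (K + i) = false :=
  Nat.testBit_lt_two_pow (hx.trans_le (Nat.pow_le_pow_right (by norm_num) (by omega)))

/-- The table for the reachability of the bottom. -/
def popTable (rs : List (Rule (Fin m) (Fin n))) (nG K TC : ℕ) : Table :=
  (upd m nG TC 0 (newb rs (fun _ _ => 0) 0 (popPrm K)))^[m * ((nG + 1) * TC)] fun _ _ => 0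

-- Only the lower block of `m` bits is ever written, so types of stacks properly above `v0` have an
-- empty upper block. Hence the return flag matters exactly for the arrival at `v0`; `Base` records
-- this.
open Classical in
theorem popTable_correct (hrs : ∀ r, r ∈ rs ↔ r ∈ S.Δ) {K : ℕ} (hK : 2 * m ≤ K) {T0 : ℕ}
    (hT0 : T0 < 2 ^ K) (v0 : List (Fin n)) (q : Fin m) (g : Fin n) :
    (popTable rs n K (2 ^ K) g T0).testBit q = true ↔
      ∃ (q' : Fin m) (κ : Bool), acc m T0 q' κ = true ∧ S.Pops v0 (q, g :: v0) q' κ := by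
  set Base : ℕ → List (Fin n) → Prop := fun T v =>
    ∃ u, v = u ++ v0 ∧ (u = [] → T = T0) ∧ (u ≠ [] → ∀ q < m, T.testBit (m + q) = false) with hBase
  -- At `v0` itself the set is declared to be the lower block of `T0`, so that `T0` represents it
  -- there; arrivals at `v0` are judged by `acc` in `Op` instead.
  set Y : Config (Fin m) (Fin n) → Prop := fun c =>
    (c.2 = v0 ∧ T0.testBit c.1 = true) ∨
    (c.2 ≠ v0 ∧ (∃ u, c.2 = u ++ v0) ∧ ∃ (q' : Fin m) (κ : Bool), acc m T0 q' κ = true ∧ S.Pops v0 c q' κ)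
    with hYdef
  set Op : (Config (Fin m) (Fin n) → Prop) → Config (Fin m) (Fin n) → Prop := fun Z c =>
    (c.2 = v0 ∧ T0.testBit c.1 = true) ∨
    (c.2 ≠ v0 ∧ (∃ u, c.2 = u ++ v0) ∧ ∃ e, S.Step c e ∧
      ((e.2 = v0 ∧ acc m T0 e.1 (decide (S.StepOf .ret c e)) = true) ∨ (e.2 ≠ v0 ∧ Z e))) with hOp
  have hlen : ∀ {c : Config (Fin m) (Fin n)}, c.2 ≠ v0 → (∃ u, c.2 = u ++ v0) →
      v0.length < c.2.length := by
    rintro c h ⟨u, hu⟩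
    cases u with
    | nil => exact absurd hu h
    | cons => rw [hu]; simp only [List.cons_append, List.length_cons, List.length_append]; omega
  have hY : IsLfp Op Y := by
    refine ⟨?_, ?_, ?_⟩
    · rintro Z Z' hZ c (h | ⟨h1, h2, e, h3, h4 | h4⟩)
      · exact .inl h
      · exact .inr ⟨h1, h2, e, h3, .inl h4⟩
      · exact .inr ⟨h1, h2, e, h3, .inr ⟨h4.1, hZ _ h4.2⟩⟩
    · rintro c (h | ⟨h1, h2, e, h3, h4 | ⟨h4, h5⟩⟩)
      · exact .inl h
      · obtain ⟨q', w⟩ := e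
        obtain ⟨rfl, h5⟩ := h4
        exact .inr ⟨h1, h2, q', _, h5, .last (hlen h1 h2) h3 (by simp)⟩
      · rcases h5 with h5 | ⟨_, _, q', κ, h6, h7⟩
        · exact absurd h5.1 h4
        · exact .inr ⟨h1, h2, q', κ, h6, .step (hlen h1 h2) h3 h7⟩
    · intro X hX c hc
      rcases hc with h | ⟨h1, h2, q', κ, h3, h4⟩
      · exact hX c (.inl h)
      · induction h4 with
        | @last c q' κ hl h hκ =>
          refine hX _ (.inr ⟨h1, h2, _, h, .inl ⟨rfl, ?_⟩⟩)
          have : κ = decide (S.StepOf .ret c (q', v0)) := by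
            rw [Bool.eq_iff_iff, hκ]; simp
          rwa [← this]
        | @step c d q' κ hl h hd ih =>
          have hd2 : d.2 ≠ v0 := by
            rintro h0
            cases hd <;> simp_all
          have hd3 : ∃ u, d.2 = u ++ v0 := by
            obtain ⟨u, hu⟩ := h2
            have hu' : u ≠ [] := by rintro rfl; exact h1 hu
            rw [show c = (c.1, u ++ v0) from Prod.ext rfl hu] at h
            obtain ⟨_, u', rfl, _⟩ := h.exists_append hu'
            exact ⟨u', rfl⟩
          exact hX _ (.inr ⟨h1, h2, d, h, .inr ⟨hd2, .inr ⟨hd2, hd3, q', κ, h3, hd⟩,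
            ih hd2 hd3 h3⟩⟩)
  have hneq : ∀ (g : Fin n) (u : List (Fin n)), g :: (u ++ v0) ≠ v0 := by
    intro g u h
    have := congrArg List.length h
    simp only [List.length_cons, List.length_append] at this
    omega
  have hK' : (0 : ℕ) + m ≤ K := by omega
  have hF0 : Rng n (2 ^ K) (fun _ _ => 0 : Table) := fun _ _ _ _ => by positivity
  have := table_correct (nG := n) (K := K) (sb := 0) (nb := newb rs (fun _ _ => 0) 0 (popPrm K))
    (F0 := fun _ _ => 0) le_rfl hK' hF0 (by simp)
    (Base := Base) ?_ hY ?_ hT0 ⟨[], rfl, fun _ => rfl, fun h => absurd rfl h⟩ ?_ g q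
  · rw [zero_add] at this
    rw [popTable, this]
    simp only [hYdef]
    constructor
    · rintro (⟨h, _⟩ | ⟨_, _, h⟩)
      · exact absurd h (hneq g [])
      · exact h
    · exact fun h => .inr ⟨hneq g [], ⟨[g], rfl⟩, h⟩
  · rintro F hF _ g T v hT ⟨u, rfl, _⟩
    refine ⟨g :: u, rfl, by simp, fun _ q hq => ?_⟩
    rw [hF g T (m + q) (by omega)]
    simp
  · rintro F hF hR g T v p hT ⟨u, rfl, hu1, hu2⟩ Z hZ
    have hbit : ∀ x, x < 2 ^ K → ∀ i, x.testBit (K + i) = false := fun x hx i => testBit_ge hx i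
    have hFlt : F g T < 2 ^ K := hR g T (by omega) hT
    rw [newb, comb]
    simp only [popPrm, hbit _ hFlt, Bool.false_xor, Bool.and_false, Bool.false_or, Bool.true_and]
    change ebit rs _ 0 (popPrm K) F p g T = true ↔ _
    rw [ebit_true_iff]
    have hstep : ∀ r ∈ rs, r.src = p → r.top = g →
        (good rs (fun _ _ => 0) 0 (popPrm K) F T r = true ↔
          ((r.word ++ (u ++ v0) = v0 ∧
            acc m T0 r.tgt (decide (S.StepOf .ret (p, g :: (u ++ v0)) (r.tgt, r.word ++ (u ++ v0)))) = true) ∨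
          (r.word ++ (u ++ v0) ≠ v0 ∧ Z (r.tgt, r.word ++ (u ++ v0))))) := by
      intro r hr h1 h2
      have hlt := evalW_lt le_rfl hR hT r.word
      have hx : good rs (fun _ _ => 0) 0 (popPrm K) F T r =
          ((evalW F r.word T).testBit r.tgt ^^
            (dret rs p g r.tgt && (evalW F r.word T).testBit (m + r.tgt))) := by
        simp only [good, normGood, popPrm, Prm.hit, Prm.zv, hbit _ hlt, zero_add, h1, h2]
        cases dret rs p g r.tgt <;> simp
      rw [hx]
      by_cases hw : r.word ++ (u ++ v0) = v0
      · have hwu : r.word = [] ∧ u = [] := by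
          have := congrArg List.length hw
          simp only [List.length_append] at this
          exact ⟨List.length_eq_zero_iff.1 (by omega), List.length_eq_zero_iff.1 (by omega)⟩
        obtain rfl := hu1 hwu.2
        have hd : dret rs p g r.tgt =
            decide (S.StepOf .ret (p, g :: (u ++ v0)) (r.tgt, r.word ++ (u ++ v0))) := by
          rw [Bool.eq_iff_iff, dret_iff hrs, decide_eq_true_eq, stepOf_cons_iff hrs]
          constructor
          · intro h
            exact ⟨_, (hrs _).2 h, rfl, rfl, rfl, by rw [hwu.1]; rfl⟩
          · rintro ⟨r', hr', h1', h2', h3', h4'⟩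
            cases r' with
            | ret a b c =>
              have h5' : r.tgt = c := congrArg Prod.fst h4'
              rw [h5', ← show a = p from h1', ← show b = g from h2']
              exact (hrs _).1 hr'
            | call => simp [Rule.kind] at h3'
            | int => simp [Rule.kind] at h3'
        rw [← hd]
        obtain ⟨hw1, rfl⟩ := hwu
        simp [hw1, acc]
      · have hm : (evalW F r.word T).testBit (m + r.tgt) = false := by
          cases hrw : r.word with
          | nil =>
            refine hu2 ?_ _ r.tgt.2
            rintro rfl
            exact hw (by simp [hrw])
          | cons g' w =>
            rw [evalW_cons, hF _ _ _ (by omega)]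
            simp
        rw [hm, ← hZ]
        simp [hw]
    simp only [hOp]
    constructor
    · rintro ⟨r, hr, h1, h2, h3⟩
      exact .inr ⟨hneq g u, ⟨g :: u, rfl⟩, _, (step_cons_iff hrs).2 ⟨r, hr, h1, h2, rfl⟩,
        (hstep r hr h1 h2).1 h3⟩
    · rintro (⟨h, _⟩ | ⟨_, _, e, hs, h⟩)
      · exact absurd h (hneq g u)
      · obtain ⟨r, hr, h1, h2, rfl⟩ := (step_cons_iff hrs).1 hs
        exact ⟨r, hr, h1, h2, (hstep r hr h1 h2).2 h⟩
  · intro q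
    rw [zero_add]
    simp [hYdef]

/-- With only the upper bit of `q` set, the exclusive or is `κ` at `q` and false elsewhere. -/
theorem acc_ret {q q' : ℕ} {κ : Bool} (hq' : q' < m) :
    acc m (2 ^ (m + q)) q' κ = true ↔ q' = q ∧ κ = true := by
  rw [acc, Nat.testBit_two_pow, Nat.testBit_two_pow]
  have h1 : ¬ (m + q = q') := by omega
  cases κ <;> simp [h1, eq_comm]

/-- With both bits of `q` set, the exclusive or cancels for an arrival by a return and survives for
any other. -/
theorem acc_nonret {q q' : ℕ} {κ : Bool} (hq : q < m) (hq' : q' < m) :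
    acc m (2 ^ (m + q) + 2 ^ q) q' κ = true ↔ q' = q ∧ κ = false := by
  have hlt : 2 ^ q < 2 ^ (m + q) := Nat.pow_lt_pow_right (by norm_num) (by omega)
  have h1 : (2 ^ (m + q) + 2 ^ q).testBit q' = decide (q = q') := by
    rw [Nat.testBit_two_pow_add_gt (by omega), Nat.testBit_two_pow]
  have h2 : (2 ^ (m + q) + 2 ^ q).testBit (m + q') = decide (q = q') := by
    have := Nat.two_pow_add_eq_or_of_lt hlt 1
    rw [mul_one] at this
    rw [this, Nat.testBit_or, Nat.testBit_two_pow, Nat.testBit_two_pow]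
    have h1 : ¬ (q = m + q') := by omega
    simp [h1]
  rw [acc, h1, h2]
  by_cases h : q = q' <;> cases κ <;> simp [h, eq_comm]

theorem popTable_ret (hrs : ∀ r, r ∈ rs ↔ r ∈ S.Δ) {K : ℕ} (hK : 2 * m ≤ K) (q q' : Fin m)
    (g : Fin n) (v : List (Fin n)) :
    (popTable rs n K (2 ^ K) g (2 ^ (m + q'))).testBit q = true ↔ S.Pops v (q, g :: v) q' true := by
  rw [popTable_correct hrs hK (Nat.pow_lt_pow_right (by norm_num) (by omega)) v]
  constructor
  · rintro ⟨q'', κ, h, h'⟩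
    obtain ⟨h1, rfl⟩ := (acc_ret q''.2).1 h
    rwa [Fin.ext h1] at h'
  · exact fun h => ⟨q', true, (acc_ret q'.2).2 ⟨rfl, rfl⟩, h⟩

theorem popTable_nonret (hrs : ∀ r, r ∈ rs ↔ r ∈ S.Δ) {K : ℕ} (hK : 2 * m ≤ K) (q q' : Fin m)
    (g : Fin n) (v : List (Fin n)) :
    (popTable rs n K (2 ^ K) g (2 ^ (m + q') + 2 ^ (q' : ℕ))).testBit q = true ↔
      S.Pops v (q, g :: v) q' false := by
  have hlt : 2 ^ (m + q') + 2 ^ (q' : ℕ) < 2 ^ K := by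
    have h1 : 2 ^ (q' : ℕ) < 2 ^ (m + q' : ℕ) := Nat.pow_lt_pow_right (by norm_num) (by omega)
    have h2 : 2 ^ (m + q' + 1 : ℕ) ≤ 2 ^ K := Nat.pow_le_pow_right (by norm_num) (by omega)
    rw [pow_succ] at h2
    omega
  rw [popTable_correct hrs hK hlt v]
  constructor
  · rintro ⟨q'', κ, h, h'⟩
    obtain ⟨h1, rfl⟩ := (acc_nonret q'.2 q''.2).1 h
    rwa [Fin.ext h1] at h'
  · exact fun h => ⟨q', false, (acc_nonret q'.2 q'.2).2 ⟨rfl, rfl⟩, h⟩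

end

/-! ### Polarities -/

/-- Whether the table of a formula stores its negation. -/
def Formula.pol {AP : Type*} : Formula AP → Bool
  | .natom _ | .and _ _ | .AX _ _ | .ER _ _ _ | .AR _ _ _ => true
  | _ => false

section
variable {P Γ AP : Type*} (S : PDS P Γ) (lam : AP → Set (Config P Γ))

/-- The set of configurations stored for a formula: a least fixed point. -/
def Stored (φ : Formula AP) (c : Config P Γ) : Prop := Sat S lam φ c ↔ φ.pol = false

/-- The one-step operator of a node. -/
def opF (grp : ℕ) (A B L : Config P Γ → Prop) (b : Mode) (sel : Option (Config P Γ → Prop))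
    (fl nv : Bool) (Z : Config P Γ → Prop) (c : Config P Γ) : Prop :=
  match grp with
  | 0 => A c ∨ B c
  | 1 => (S.Alive c ∧ B c) ∨
      (A c ∧ ∃ d, S.Succ b c d ∧ Ext (fun e => sel.getD Z e ↔ fl = false) (nv = true) d)
  | 2 => ¬ S.Alive c ∨ B c ∨
      (A c ∧ ¬ ∃ d, S.Succ b c d ∧ Ext (fun e => sel.getD Z e ↔ fl = false) (nv = true) d)
  | _ => L c

variable {S lam}

theorem isLfp_const {C : Type*} {Op : (C → Prop) → C → Prop} {Y : C → Prop}
    (h : ∀ Z c, Op Z c ↔ Y c) : IsLfp Op Y :=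
  ⟨fun Z Z' _ c hc => (h Z' c).2 ((h Z c).1 hc), fun c hc => (h _ c).1 hc,
    fun _ hX c hc => hX c ((h _ c).2 hc)⟩

theorem isLfp_EUs {A B : Option (Config P Γ) → Prop} {L} {b : Mode} {nv : Bool}
    (hnv : B none ↔ nv = true) :
    IsLfp (opF S 1 (fun c => A (some c)) (fun c => B (some c)) L b none false nv) (EUs S b A B) := by
  refine ⟨?_, ?_, ?_⟩
  · rintro Z Z' hZ c (h | ⟨h, d, hd, hd'⟩)
    · exact .inl h
    · refine .inr ⟨h, d, hd, Ext.mono ?_ hd'⟩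
      simpa using hZ
  · rintro c (⟨h, h'⟩ | ⟨h, d, hd, hd'⟩)
    · exact .base h h'
    · refine .step h hd ?_
      cases d with
      | none => exact hnv.2 hd'
      | some d => simpa [Ext] using hd'
  · intro X hX c hc
    refine EUs.ind (fun c h h' => hX c (.inl ⟨h, h'⟩)) (fun c d h hd hd' => ?_) hc
    refine hX c (.inr ⟨h, d, hd, ?_⟩)
    cases d with
    | none => exact hnv.1 hd'
    | some d => simpa [Ext] using hd'

/-- The operator searches for a successor outside of the set, hence `fl = true`, and `⊥` is such a
successor exactly if `B` fails there, hence `nv` is the negation of `B none`. -/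
theorem isLfp_AUs {A B : Option (Config P Γ) → Prop} {L} {b : Mode} {nv : Bool}
    (hnv : B none ↔ nv = false) :
    IsLfp (opF S 2 (fun c => A (some c)) (fun c => B (some c)) L b none true nv) (AUs S b A B) := by
  have key : ∀ {Z : Config P Γ → Prop} {d},
      ¬ Ext (fun e => (none : Option (Config P Γ → Prop)).getD Z e ↔ true = false) (nv = true) d ↔
        Ext Z (B none) d := by
    intro Z d
    cases d <;> simp [Ext, hnv]
  refine ⟨?_, ?_, ?_⟩
  · rintro Z Z' hZ c (h | h | ⟨h, h'⟩)
    · exact .inl h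
    · exact .inr (.inl h)
    · refine .inr (.inr ⟨h, fun ⟨d, hd, hd'⟩ => h' ⟨d, hd, ?_⟩⟩)
      by_contra hno
      exact key.2 (Ext.mono hZ (key.1 hno)) hd'
  · rintro c (h | h | ⟨h, h'⟩)
    · exact .dead h
    · exact .base h
    · exact .step h fun d hd => key.1 fun hno => h' ⟨d, hd, hno⟩
  · intro X hX c hc
    refine AUs.ind (fun c h => hX c (.inl h)) (fun c h => hX c (.inr (.inl h))) (fun c h h' => ?_) hc
    exact hX c (.inr (.inr ⟨h, fun ⟨d, hd, hd'⟩ => key.2 (h' d hd) hd'⟩))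

/-- The value of a subformula of which the parent uses the negation if `x` differs from the
polarity. -/
def Val (S : PDS P Γ) (lam : AP → Set (Config P Γ)) (φ : Formula AP) (x : Bool) (c : Config P Γ) :
    Prop := Stored S lam φ c ↔ x = false

theorem val_pol (φ : Formula AP) (c : Config P Γ) : Val S lam φ φ.pol c ↔ Sat S lam φ c := by
  unfold Val Stored
  cases φ.pol <;> simp

theorem val_not_pol (φ : Formula AP) (c : Config P Γ) : Val S lam φ (!φ.pol) c ↔ ¬ Sat S lam φ c := by
  unfold Val Stored
  cases φ.pol <;> simp

theorem isLfp_EU (b : Mode) (φ ψ : Formula AP) {L} :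
    IsLfp (opF S 1 (Val S lam φ φ.pol) (Val S lam ψ ψ.pol) L b none false false)
      (Stored S lam (.EU b φ ψ)) := by
  rw [
      show Val S lam φ φ.pol = fun c => Holds (Sat S lam φ) (some c) from funext fun c => propext (val_pol _ _),
      show Val S lam ψ ψ.pol = fun c => Holds (Sat S lam ψ) (some c) from funext fun c => propext (val_pol _ _),
      show Stored S lam (.EU b φ ψ) = EUs S b (Holds (Sat S lam φ)) (Holds (Sat S lam ψ)) from
        funext fun c => by simp [Stored, Formula.pol, Sat, EUs]]
  exact isLfp_EUs (A := Holds (Sat S lam φ)) (B := Holds (Sat S lam ψ)) (by simp [Holds])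

/-- The negation of `A[φ R ψ]` is `E[¬φ U ¬ψ]`, where `¬ψ` holds at `⊥`. -/
theorem isLfp_AR (b : Mode) (φ ψ : Formula AP) {L} :
    IsLfp (opF S 1 (Val S lam φ !φ.pol) (Val S lam ψ !ψ.pol) L b none false true)
      (Stored S lam (.AR b φ ψ)) := by
  rw [
      show Val S lam φ (!φ.pol) = fun c => ¬ Holds (Sat S lam φ) (some c) from funext fun c => propext (val_not_pol _ _),
      show Val S lam ψ (!ψ.pol) = fun c => ¬ Holds (Sat S lam ψ) (some c) from funext fun c => propext (val_not_pol _ _),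
      show Stored S lam (.AR b φ ψ) = EUs S b (fun d => ¬ Holds (Sat S lam φ) d) (fun d => ¬ Holds (Sat S lam ψ) d) from
        funext fun c => by simp [Stored, Formula.pol, Sat, EUs]]
  exact isLfp_EUs (A := fun d => ¬ Holds (Sat S lam φ) d) (B := fun d => ¬ Holds (Sat S lam ψ) d) (by simp [Holds])

theorem isLfp_AU (b : Mode) (φ ψ : Formula AP) {L} :
    IsLfp (opF S 2 (Val S lam φ φ.pol) (Val S lam ψ ψ.pol) L b none true true)
      (Stored S lam (.AU b φ ψ)) := by
  rw [
      show Val S lam φ φ.pol = fun c => Holds (Sat S lam φ) (some c) from funext fun c => propext (val_pol _ _),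
      show Val S lam ψ ψ.pol = fun c => Holds (Sat S lam ψ) (some c) from funext fun c => propext (val_pol _ _),
      show Stored S lam (.AU b φ ψ) = AUs S b (Holds (Sat S lam φ)) (Holds (Sat S lam ψ)) from
        funext fun c => by simp [Stored, Formula.pol, Sat, AUs]]
  exact isLfp_AUs (A := Holds (Sat S lam φ)) (B := Holds (Sat S lam ψ)) (by simp [Holds])

/-- The negation of `E[φ R ψ]` is `A[¬φ U ¬ψ]`. Since `¬ψ` holds at `⊥`, a successor `⊥` is no
violation, in contrast to `isLfp_AU`. -/
theorem isLfp_ER (b : Mode) (φ ψ : Formula AP) {L} :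
    IsLfp (opF S 2 (Val S lam φ !φ.pol) (Val S lam ψ !ψ.pol) L b none true false)
      (Stored S lam (.ER b φ ψ)) := by
  rw [
      show Val S lam φ (!φ.pol) = fun c => ¬ Holds (Sat S lam φ) (some c) from funext fun c => propext (val_not_pol _ _),
      show Val S lam ψ (!ψ.pol) = fun c => ¬ Holds (Sat S lam ψ) (some c) from funext fun c => propext (val_not_pol _ _),
      show Stored S lam (.ER b φ ψ) = AUs S b (fun d => ¬ Holds (Sat S lam φ) d) (fun d => ¬ Holds (Sat S lam ψ) d) from
        funext fun c => by simp [Stored, Formula.pol, Sat, AUs]]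
  exact isLfp_AUs (A := fun d => ¬ Holds (Sat S lam φ) d) (B := fun d => ¬ Holds (Sat S lam ψ) d) (by simp [Holds])

/-- The successors are tested for the stored set of the subformula and not for the set under
construction; this is the use of `sel`. The operator is then constant. -/
theorem isLfp_EX (b : Mode) (φ : Formula AP) {L} :
    IsLfp (opF S 1 (fun _ => True) (fun _ => False) L b (some (Stored S lam φ)) φ.pol false)
      (Stored S lam (.EX b φ)) := by
  apply isLfp_const
  intro Z c
  simp only [opF, and_false, false_or, true_and, Option.getD_some, Stored, Formula.pol, iff_true, Sat]
  refine exists_congr fun d => and_congr_right fun _ => ?_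
  cases d with
  | none => simp [Ext, Holds]
  | some d => exact val_pol φ d

theorem isLfp_AX (b : Mode) (φ : Formula AP) {L} :
    IsLfp (opF S 1 (fun _ => True) (fun _ => False) L b (some (Stored S lam φ)) (!φ.pol) true)
      (Stored S lam (.AX b φ)) := by
  apply isLfp_const
  intro Z c
  simp only [opF, and_false, false_or, true_and, Option.getD_some, Stored, Formula.pol, Sat,
    Bool.true_eq_false, iff_false, not_forall, exists_prop]
  refine exists_congr fun d => and_congr_right fun _ => ?_
  cases d with
  | none => simp [Ext, Holds]
  | some d => exact val_not_pol φ d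

end

/-! ### The nodes of a formula in prefix order -/

section
variable {k : ℕ}

def Formula.nodes : Formula (Fin k) → List (Formula (Fin k))
  | .or a b => .or a b :: (a.nodes ++ b.nodes)
  | .and a b => .and a b :: (a.nodes ++ b.nodes)
  | .EX x a => .EX x a :: a.nodes
  | .AX x a => .AX x a :: a.nodes
  | .EU x a b => .EU x a b :: (a.nodes ++ b.nodes)
  | .AU x a b => .AU x a b :: (a.nodes ++ b.nodes)
  | .ER x a b => .ER x a b :: (a.nodes ++ b.nodes)
  | .AR x a b => .AR x a b :: (a.nodes ++ b.nodes)
  | φ => [φ]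

/-- The immediate subformulas. -/
def Formula.kids : Formula (Fin k) → List (Formula (Fin k))
  | .or a b | .and a b | .EU _ a b | .AU _ a b | .ER _ a b | .AR _ a b => [a, b]
  | .EX _ a | .AX _ a => [a]
  | _ => []

theorem Formula.nodes_eq (φ : Formula (Fin k)) : φ.nodes = φ :: φ.kids.flatMap Formula.nodes := by
  cases φ <;> simp [Formula.nodes, Formula.kids]

theorem Formula.length_nodes (φ : Formula (Fin k)) : φ.nodes.length = φ.size := by
  induction φ <;> simp_all [Formula.nodes, Formula.size]

theorem Formula.size_pos (φ : Formula (Fin k)) : 0 < φ.size := by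
  cases φ <;> simp [Formula.size]

/-- In prefix order the nodes of a subformula form an interval starting at its root, which locates
the children of node `j` at `j + 1` and `j + 1 + a.size`. -/
theorem Formula.drop_nodes (φ : Formula (Fin k)) : ∀ {j : ℕ} {ψ}, φ.nodes[j]? = some ψ →
    ∃ rest, φ.nodes.drop j = ψ.nodes ++ rest := by
  have hun : ∀ (χ a : Formula (Fin k)), χ.nodes = χ :: a.nodes →
      (∀ {j : ℕ} {ψ}, a.nodes[j]? = some ψ → ∃ rest, a.nodes.drop j = ψ.nodes ++ rest) →
      ∀ {j : ℕ} {ψ}, χ.nodes[j]? = some ψ → ∃ rest, χ.nodes.drop j = ψ.nodes ++ rest := by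
    intro χ a h ih j ψ hj
    cases j with
    | zero =>
      have : ψ = χ := by rw [h] at hj; simpa using hj.symm
      exact ⟨[], by simp [this]⟩
    | succ j => rw [h] at hj ⊢; exact ih (by simpa using hj)
  have hbin : ∀ (χ a b : Formula (Fin k)), χ.nodes = χ :: (a.nodes ++ b.nodes) →
      (∀ {j : ℕ} {ψ}, a.nodes[j]? = some ψ → ∃ rest, a.nodes.drop j = ψ.nodes ++ rest) →
      (∀ {j : ℕ} {ψ}, b.nodes[j]? = some ψ → ∃ rest, b.nodes.drop j = ψ.nodes ++ rest) →
      ∀ {j : ℕ} {ψ}, χ.nodes[j]? = some ψ → ∃ rest, χ.nodes.drop j = ψ.nodes ++ rest := by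
    intro χ a b h iha ihb j ψ hj
    cases j with
    | zero =>
      have : ψ = χ := by rw [h] at hj; simpa using hj.symm
      exact ⟨[], by simp [this]⟩
    | succ j =>
      rw [h] at hj ⊢
      simp only [List.getElem?_cons_succ, List.drop_succ_cons] at hj ⊢
      by_cases hlt : j < a.nodes.length
      · rw [List.getElem?_append_left hlt] at hj
        obtain ⟨rest, hr⟩ := iha hj
        exact ⟨rest ++ b.nodes, by rw [List.drop_append_of_le_length hlt.le, hr, List.append_assoc]⟩
      · push Not at hlt
        rw [List.getElem?_append_right hlt] at hj
        obtain ⟨rest, hr⟩ := ihb hj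
        refine ⟨rest, ?_⟩
        rw [List.drop_append, List.drop_eq_nil_of_le hlt, List.nil_append, hr]
  have hleaf : ∀ (χ : Formula (Fin k)), χ.nodes = [χ] →
      ∀ {j : ℕ} {ψ}, χ.nodes[j]? = some ψ → ∃ rest, χ.nodes.drop j = ψ.nodes ++ rest := by
    intro χ h j ψ hj
    cases j with
    | zero =>
      have : ψ = χ := by rw [h] at hj; simpa using hj.symm
      exact ⟨[], by simp [this]⟩
    | succ j => rw [h] at hj; simp at hj
  induction φ with
  | tt | ff | atom | natom => exact hleaf _ rfl
  | EX x a ih | AX x a ih => exact hun _ a rfl ih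
  | or a b iha ihb | and a b iha ihb | EU x a b iha ihb | AU x a b iha ihb | ER x a b iha ihb
  | AR x a b iha ihb => exact hbin _ a b rfl iha ihb

theorem Formula.getElem?_nodes_zero (φ : Formula (Fin k)) : φ.nodes[0]? = some φ := by
  rw [φ.nodes_eq]; rfl

theorem Formula.end_le (φ : Formula (Fin k)) {j : ℕ} {ψ} (h : φ.nodes[j]? = some ψ) :
    j + ψ.size ≤ φ.size := by
  obtain ⟨rest, hr⟩ := φ.drop_nodes h
  have := congrArg List.length hr
  rw [List.length_drop, List.length_append, ψ.length_nodes, φ.length_nodes] at this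
  have := ψ.size_pos
  omega

theorem Formula.getElem?_kid1 (φ : Formula (Fin k)) {j : ℕ} {ψ a l} (h : φ.nodes[j]? = some ψ)
    (hk : ψ.kids = a :: l) : φ.nodes[j + 1]? = some a := by
  obtain ⟨rest, hr⟩ := φ.drop_nodes h
  have h1 : φ.nodes[j + 1]? = (φ.nodes.drop j)[1]? := by rw [List.getElem?_drop]
  rw [h1, hr, ψ.nodes_eq, hk, List.flatMap_cons, a.nodes_eq]
  rfl

theorem Formula.getElem?_kid2 (φ : Formula (Fin k)) {j : ℕ} {ψ a b l} (h : φ.nodes[j]? = some ψ)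
    (hk : ψ.kids = a :: b :: l) : φ.nodes[j + 1 + a.size]? = some b := by
  obtain ⟨rest, hr⟩ := φ.drop_nodes h
  have h1 : φ.nodes[j + 1 + a.size]? = (φ.nodes.drop j)[1 + a.size]? := by
    rw [List.getElem?_drop, add_assoc]
  rw [h1, hr, ψ.nodes_eq, hk, List.flatMap_cons, List.flatMap_cons, add_comm 1, List.cons_append,
    List.getElem?_cons_succ, List.append_assoc, List.getElem?_append_right (by rw [a.length_nodes]),
    a.length_nodes, Nat.sub_self, b.nodes_eq]
  rfl

end

/-! ### Types of stacks and the table for all nodes -/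

section
variable {m n k : ℕ}

/-- Reading operands at position `K`, beyond all types, gives the constant false, or true when `ap`
or `bp` negates it. -/
def basePrm (K db sb : ℕ) : Prm where
  grp := 0
  md := 0
  fl := false
  nv := false
  ap := false
  bp := false
  zb := sb
  sb := sb
  db := db
  ab := K
  bb := K
  lab := fun _ => false

/-- The parameters for the set of configurations without a run, which is `A[true U false]`. -/
def deadPrm (K db : ℕ) : Prm := { basePrm K db db with grp := 2, fl := true, ap := true }

open Classical in
def labB (f : Fin k → Finset (Fin m)) (e : Fin k) (p : ℕ) : Bool :=
  decide (∃ h : p < m, (⟨p, h⟩ : Fin m) ∈ f e)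

/-- The parameters of the node `j` of a formula with `N` nodes. -/
def nodePrm (N j : ℕ) (f : Fin k → Finset (Fin m)) (ψ : Formula (Fin k)) : Prm :=
  let B := basePrm ((N + 1) * m) (N * m) (j * m)
  match ψ with
  | .tt => { B with ap := true }
  | .ff => B
  | .atom e => { B with grp := 3, lab := labB f e }
  | .natom e => { B with grp := 3, lab := labB f e }
  | .or a b => { B with ap := a.pol, bp := b.pol, ab := (j + 1) * m, bb := (j + 1 + a.size) * m }
  | .and a b => { B with ap := !a.pol, bp := !b.pol, ab := (j + 1) * m, bb := (j + 1 + a.size) * m }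
  | .EX b a => { B with grp := 1, md := b.num, ap := true, zb := (j + 1) * m, fl := a.pol }
  | .AX b a => { B with grp := 1, md := b.num, ap := true, zb := (j + 1) * m, fl := !a.pol, nv := true }
  | .EU x a b => { B with grp := 1, md := x.num, ap := a.pol, bp := b.pol, ab := (j + 1) * m, bb := (j + 1 + a.size) * m }
  | .AU x a b => { B with grp := 2, md := x.num, fl := true, nv := true, ap := a.pol, bp := b.pol, ab := (j + 1) * m, bb := (j + 1 + a.size) * m }
  | .ER x a b => { B with grp := 2, md := x.num, fl := true, ap := !a.pol, bp := !b.pol, ab := (j + 1) * m, bb := (j + 1 + a.size) * m }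
  | .AR x a b => { B with grp := 1, md := x.num, nv := true, ap := !a.pol, bp := !b.pol, ab := (j + 1) * m, bb := (j + 1 + a.size) * m }

theorem nodePrm_sb (N j : ℕ) (f : Fin k → Finset (Fin m)) (ψ : Formula (Fin k)) :
    (nodePrm N j f ψ).sb = j * m := by cases ψ <;> rfl

theorem nodePrm_db (N j : ℕ) (f : Fin k → Finset (Fin m)) (ψ : Formula (Fin k)) :
    (nodePrm N j f ψ).db = N * m := by cases ψ <;> rfl

variable (S : PDS (Fin m) (Fin n)) (f : Fin k → Finset (Fin m)) (φ : Formula (Fin k))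

/-- The type `y` describes the stack `v` for the nodes from `j` on. -/
structure Match (j y : ℕ) (v : List (Fin n)) : Prop where
  lt : y < 2 ^ ((φ.size + 1) * m)
  dead : ∀ q : Fin m, y.testBit (φ.size * m + q) = true ↔ ¬ S.Alive (q, v)
  node : ∀ i ψ, j ≤ i → φ.nodes[i]? = some ψ → ∀ q : Fin m,
    y.testBit (i * m + q) = true ↔ Stored S (stdVal (Fin n) f) ψ (q, v)

variable {S f φ}

theorem comb_iff {p : Prm} {y : ℕ} {q : Fin m} {v : List (Fin n)} {e : Bool}
    {A B L : Config (Fin m) (Fin n) → Prop} {b sel Z}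
    (hd : y.testBit (p.db + q) = true ↔ ¬ S.Alive (q, v))
    (hA : (y.testBit (p.ab + q) ^^ p.ap) = true ↔ A (q, v))
    (hB : (y.testBit (p.bb + q) ^^ p.bp) = true ↔ B (q, v))
    (hL : p.lab q = true ↔ L (q, v))
    (he : e = true ↔ ∃ d, S.Succ b (q, v) d ∧
      Ext (fun e => sel.getD Z e ↔ p.fl = false) (p.nv = true) d) :
    comb p y q e = true ↔ opF S p.grp A B L b sel p.fl p.nv Z (q, v) := by
  unfold comb opF
  rcases p.grp with _ | _ | _ | _
  · change (_ || _) = true ↔ _ ∨ _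
    rw [Bool.or_eq_true, hA, hB]
  · change (_ && _ || _ && _) = true ↔ (_ ∧ _) ∨ (_ ∧ _)
    rw [Bool.or_eq_true, Bool.and_eq_true, Bool.and_eq_true, hA, hB, he, Bool.not_eq_true',
      ← Bool.not_eq_true, hd, not_not]
  · change (_ || _ || _ && !_) = true ↔ _ ∨ _ ∨ (_ ∧ ¬ _)
    rw [Bool.or_eq_true, Bool.or_eq_true, Bool.and_eq_true, hA, hB, hd, Bool.not_eq_true',
      ← Bool.not_eq_true, he, or_assoc]
  · exact hL

theorem Match.val {j i y : ℕ} {v : List (Fin n)} (h : Match S f φ j y v) (hj : j ≤ i) {a}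
    (ha : φ.nodes[i]? = some a) (x : Bool) (q : Fin m) :
    (y.testBit (i * m + q) ^^ x) = true ↔ Val S (stdVal (Fin n) f) a x (q, v) := by
  rw [Val, ← h.node i a hj ha q]
  cases y.testBit (i * m + q) <;> cases x <;> simp

theorem Match.out {j y : ℕ} {v : List (Fin n)} (h : Match S f φ j y v) (q : ℕ) :
    y.testBit ((φ.size + 1) * m + q) = false := testBit_ge h.lt q

theorem labB_iff {e : Fin k} {q : Fin m} {v : List (Fin n)} :
    labB f e q = true ↔ ((q, v) : Config (Fin m) (Fin n)) ∈ stdVal (Fin n) f e := by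
  simp [labB, stdVal]

-- All kinds of nodes are brought into one form: sets `A`, `B`, `L` that the bits of the later nodes
-- represent, and an operator `opF` with the stored set as least fixed point. The match from `j + 1`
-- on suffices because children follow their parent in prefix order.
variable (S f) in
theorem exists_nodeSem {j : ℕ} {ψ} (hj : φ.nodes[j]? = some ψ) :
    ∃ (A B L : Config (Fin m) (Fin n) → Prop) (b : Mode) (sel : Option _),
      (nodePrm φ.size j f ψ).md = b.num ∧
      IsLfp (opF S (nodePrm φ.size j f ψ).grp A B L b sel (nodePrm φ.size j f ψ).fl
        (nodePrm φ.size j f ψ).nv) (Stored S (stdVal (Fin n) f) ψ) ∧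
      (sel = none → (nodePrm φ.size j f ψ).zb = (nodePrm φ.size j f ψ).sb) ∧
      ∀ y v, Match S f φ (j + 1) y v → ∀ q : Fin m,
        ((y.testBit ((nodePrm φ.size j f ψ).ab + q) ^^ (nodePrm φ.size j f ψ).ap) = true ↔ A (q, v)) ∧
        ((y.testBit ((nodePrm φ.size j f ψ).bb + q) ^^ (nodePrm φ.size j f ψ).bp) = true ↔ B (q, v)) ∧
        ((nodePrm φ.size j f ψ).lab q = true ↔ L (q, v)) ∧
        ∀ C, sel = some C → (y.testBit ((nodePrm φ.size j f ψ).zb + q) = true ↔ C (q, v)) := by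
  have hk1 := fun {a l} => φ.getElem?_kid1 hj (a := a) (l := l)
  have hk2 := fun {a b l} => φ.getElem?_kid2 hj (a := a) (b := b) (l := l)
  cases ψ with
  | tt =>
    refine ⟨fun _ => True, fun _ => False, fun _ => False, .g, none, rfl,
      isLfp_const fun Z c => ?_, fun _ => rfl, fun y v h q => ⟨?_, ?_, ?_, by simp⟩⟩
    · simp [nodePrm, basePrm, opF, Stored, Sat, Formula.pol]
    · simp [nodePrm, basePrm, h.out]
    · simp [nodePrm, basePrm, h.out]
    · simp [nodePrm, basePrm]
  | ff =>
    refine ⟨fun _ => False, fun _ => False, fun _ => False, .g, none, rfl,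
      isLfp_const fun Z c => ?_, fun _ => rfl, fun y v h q => ⟨?_, ?_, ?_, by simp⟩⟩
    · simp [nodePrm, basePrm, opF, Stored, Sat, Formula.pol]
    · simp [nodePrm, basePrm, h.out]
    · simp [nodePrm, basePrm, h.out]
    · simp [nodePrm, basePrm]
  | atom e =>
    refine ⟨fun _ => False, fun _ => False, fun c => c ∈ stdVal (Fin n) f e, .g, none, rfl,
      isLfp_const fun Z c => ?_, fun _ => rfl, fun y v h q => ⟨?_, ?_, ?_, by simp⟩⟩
    · simp [nodePrm, basePrm, opF, Stored, Sat, Formula.pol]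
    · simp [nodePrm, basePrm, h.out]
    · simp [nodePrm, basePrm, h.out]
    · exact labB_iff
  | natom e =>
    refine ⟨fun _ => False, fun _ => False, fun c => c ∈ stdVal (Fin n) f e, .g, none, rfl,
      isLfp_const fun Z c => ?_, fun _ => rfl, fun y v h q => ⟨?_, ?_, ?_, by simp⟩⟩
    · simp [nodePrm, basePrm, opF, Stored, Sat, Formula.pol]
    · simp [nodePrm, basePrm, h.out]
    · simp [nodePrm, basePrm, h.out]
    · exact labB_iff
  | or a b =>
    refine ⟨Val S _ a a.pol, Val S _ b b.pol, fun _ => False, .g, none, rfl,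
      isLfp_const fun Z c => ?_, fun _ => rfl,
      fun y v h q => ⟨h.val le_rfl (hk1 rfl) _ q, h.val (by omega) (hk2 rfl) _ q, ?_, by simp⟩⟩
    · change Val S _ a a.pol c ∨ Val S _ b b.pol c ↔ _
      rw [val_pol, val_pol]
      simp [Stored, Sat, Formula.pol]
    · simp [nodePrm, basePrm]
  | and a b =>
    refine ⟨Val S _ a !a.pol, Val S _ b !b.pol, fun _ => False, .g, none, rfl,
      isLfp_const fun Z c => ?_, fun _ => rfl,
      fun y v h q => ⟨h.val le_rfl (hk1 rfl) _ q, h.val (by omega) (hk2 rfl) _ q, ?_, by simp⟩⟩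
    · change Val S _ a (!a.pol) c ∨ Val S _ b (!b.pol) c ↔ _
      rw [val_not_pol, val_not_pol]
      simp [Stored, Sat, Formula.pol, imp_iff_not_or]
    · simp [nodePrm, basePrm]
  | EX x a =>
    refine ⟨_, _, fun _ => False, x, _, rfl, isLfp_EX x a, by simp,
      fun y v h q => ⟨?_, ?_, ?_, ?_⟩⟩
    · simp [nodePrm, basePrm, h.out]
    · simp [nodePrm, basePrm, h.out]
    · simp [nodePrm, basePrm]
    · rintro _ ⟨⟩
      exact h.node _ _ le_rfl (hk1 rfl) q
  | AX x a =>
    refine ⟨_, _, fun _ => False, x, _, rfl, isLfp_AX x a, by simp,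
      fun y v h q => ⟨?_, ?_, ?_, ?_⟩⟩
    · simp [nodePrm, basePrm, h.out]
    · simp [nodePrm, basePrm, h.out]
    · simp [nodePrm, basePrm]
    · rintro _ ⟨⟩
      exact h.node _ _ le_rfl (hk1 rfl) q
  | EU x a b =>
    exact ⟨_, _, fun _ => False, x, _, rfl, isLfp_EU x a b, fun _ => rfl, fun y v h q =>
      ⟨h.val le_rfl (hk1 rfl) _ q, h.val (by omega) (hk2 rfl) _ q, by simp [nodePrm, basePrm], by simp⟩⟩
  | AU x a b =>
    exact ⟨_, _, fun _ => False, x, _, rfl, isLfp_AU x a b, fun _ => rfl, fun y v h q =>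
      ⟨h.val le_rfl (hk1 rfl) _ q, h.val (by omega) (hk2 rfl) _ q, by simp [nodePrm, basePrm], by simp⟩⟩
  | ER x a b =>
    exact ⟨_, _, fun _ => False, x, _, rfl, isLfp_ER x a b, fun _ => rfl, fun y v h q =>
      ⟨h.val le_rfl (hk1 rfl) _ q, h.val (by omega) (hk2 rfl) _ q, by simp [nodePrm, basePrm], by simp⟩⟩
  | AR x a b =>
    exact ⟨_, _, fun _ => False, x, _, rfl, isLfp_AR x a b, fun _ => rfl, fun y v h q =>
      ⟨h.val le_rfl (hk1 rfl) _ q, h.val (by omega) (hk2 rfl) _ q, by simp [nodePrm, basePrm], by simp⟩⟩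

variable (S f φ) in
/-- The table is correct for the nodes from `j` on and empty for the others. -/
structure Inv (j : ℕ) (F : Table) : Prop where
  rng : Rng n (2 ^ ((φ.size + 1) * m)) F
  zero : ∀ i < j, ∀ g T p, p < m → (F g T).testBit (i * m + p) = false
  dead : ∀ T v, T < 2 ^ ((φ.size + 1) * m) →
    (∀ q : Fin m, T.testBit (φ.size * m + q) = true ↔ ¬ S.Alive (q, v)) →
    ∀ (g : Fin n) (q : Fin m), (F g T).testBit (φ.size * m + q) = true ↔ ¬ S.Alive (q, g :: v)
  node : ∀ i ψ, j ≤ i → φ.nodes[i]? = some ψ → ∀ T v, Match S f φ i T v → ∀ (g : Fin n) (q : Fin m),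
    (F g T).testBit (i * m + q) = true ↔ Stored S (stdVal (Fin n) f) ψ (q, g :: v)

theorem Match.mono {i j y : ℕ} {v : List (Fin n)} (h : Match S f φ j y v) (hij : j ≤ i) :
    Match S f φ i y v :=
  ⟨h.lt, h.dead, fun i' ψ h' => h.node i' ψ (hij.trans h')⟩

theorem Inv.match {j T : ℕ} {F : Table} {v : List (Fin n)} (h : Inv S f φ j F)
    (hT : Match S f φ j T v) (g : Fin n) : Match S f φ j (F g T) (g :: v) :=
  ⟨h.rng _ _ (by omega) hT.lt, h.dead T v hT.lt hT.dead g,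
    fun i ψ hi hψ => h.node i ψ hi hψ T v (hT.mono hi) g⟩

theorem Inv.match_evalW {j T : ℕ} {F : Table} {v : List (Fin n)} (h : Inv S f φ j F)
    (hT : Match S f φ j T v) (w : List (Fin n)) : Match S f φ j (evalW F w T) (w ++ v) := by
  induction w with
  | nil => exact hT
  | cons g w ih => exact h.match ih g

theorem block_off {i j : ℕ} (hij : i ≠ j) {p : ℕ} (hp : p < m) :
    i * m + p < j * m ∨ j * m + m ≤ i * m + p := by
  rcases lt_or_gt_of_ne hij with h | h
  · left
    have := Nat.mul_le_mul_right m h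
    rw [Nat.succ_mul] at this
    omega
  · right
    have := Nat.mul_le_mul_right m h
    rw [Nat.succ_mul] at this
    omega

theorem lt_of_testBit_eq {x y K : ℕ} (hy : y < 2 ^ K) (h : ∀ i, K ≤ i → x.testBit i = y.testBit i) :
    x < 2 ^ K := by
  apply Nat.lt_pow_two_of_testBit
  intro i hi
  rw [h i hi]
  exact Nat.testBit_lt_two_pow (hy.trans_le (Nat.pow_le_pow_right (by norm_num) hi))

/-- Changing only the bits of node `j` does not affect the nodes after it. -/
theorem Match.agreeOff {j : ℕ} (hj : j < φ.size) {x y : ℕ} {v : List (Fin n)}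
    (h : Match S f φ (j + 1) y v)
    (hxy : ∀ i, (i < j * m ∨ j * m + m ≤ i) → x.testBit i = y.testBit i) :
    Match S f φ (j + 1) x v := by
  have hle : j * m + m ≤ (φ.size + 1) * m := by
    rw [← Nat.succ_mul]; exact Nat.mul_le_mul_right m (by omega)
  refine ⟨lt_of_testBit_eq h.lt fun i hi => hxy i (.inr (hle.trans hi)), fun q => ?_,
    fun i ψ hi hψ q => ?_⟩
  · rw [hxy _ (block_off (by omega) q.2)]; exact h.dead q
  · rw [hxy _ (block_off (by omega) q.2)]; exact h.node i ψ hi hψ q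

variable {rs : List (Rule (Fin m) (Fin n))}

/-- The type without any run. -/
def deadType (N m : ℕ) : ℕ := 2 ^ ((N + 1) * m) - 2 ^ (N * m)

theorem testBit_deadType (N : ℕ) {q : ℕ} (hq : q < m) :
    (deadType N m).testBit (N * m + q) = true := by
  have : deadType N m = 2 ^ (N * m) * (2 ^ m - 1) := by
    rw [deadType, Nat.succ_mul, pow_add, Nat.mul_sub, mul_one]
  rw [this, Nat.testBit_two_pow_mul]
  simp [hq]

theorem deadType_lt (N m : ℕ) : deadType N m < 2 ^ ((N + 1) * m) :=
  Nat.sub_lt (by positivity) (by positivity)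

variable (f φ rs) in
def nodeStep (nG TC j : ℕ) (ψ : Formula (Fin k)) (F : Table) : Table :=
  (upd m nG TC (j * m) (newb rs (popTable rs nG ((φ.size + 1) * m) TC) (deadType φ.size m)
    (nodePrm φ.size j f ψ)))^[m * ((nG + 1) * TC)] F

/-- An application of `table_correct` with `Base` the match of the nodes after `j`: these blocks and
the dead bits are already final, and the update keeps off them. -/
theorem Inv.nodeStep (hrs : ∀ r, r ∈ rs ↔ r ∈ S.Δ) {j : ℕ} {F : Table} {ψ}
    (h : Inv S f φ (j + 1) F) (hψ : φ.nodes[j]? = some ψ) :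
    Inv S f φ j (nodeStep f φ rs n (2 ^ ((φ.size + 1) * m)) j ψ F) := by
  have hjlt : j < φ.size := by have := φ.end_le hψ; have := ψ.size_pos; omega
  have hpos := φ.size_pos
  set K := (φ.size + 1) * m with hK
  have hK2 : 2 * m ≤ K := Nat.mul_le_mul_right m (by omega)
  have hKsb : j * m + m ≤ K := by
    rw [← Nat.succ_mul]; exact Nat.mul_le_mul_right m (by omega)
  set k := nodePrm φ.size j f ψ with hk
  have hagree : AgreeOff m (j * m) F (BCARET.nodeStep f φ rs n (2 ^ K) j ψ F) := agreeOff_iterate _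
  refine ⟨rng_iterate h.rng hKsb _, ?_, ?_, ?_⟩
  · intro i hi g T p hp
    rw [hagree _ _ _ (block_off hi.ne hp)]
    exact h.zero i (by omega) g T p hp
  · intro T v hT hv g q
    rw [hagree _ _ _ (block_off (by omega) q.2)]
    exact h.dead T v hT hv g q
  · intro i ψ' hi hψ' T v hm g q
    rcases Nat.lt_or_eq_of_le hi with hlt | rfl
    · rw [hagree _ _ _ (block_off (by omega) q.2)]
      exact h.node i ψ' hlt hψ' T v hm g q
    · obtain rfl : ψ' = ψ := by rw [hψ] at hψ'; exact (Option.some.inj hψ').symm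
      obtain ⟨A, B, L, b, sel, hmd, hlfp, hz, hsem⟩ := exists_nodeSem S f hψ
      have hBase : ∀ F', AgreeOff m (j * m) F F' → ∀ (g : Fin n) T v,
          Match S f φ (j + 1) T v → Match S f φ (j + 1) (F' g T) (g :: v) := fun F' hF' g T v hm =>
        (h.match hm g).agreeOff hjlt (hF' g T)
      refine table_correct (m := m) le_rfl hKsb h.rng (h.zero j (by omega))
        (Base := Match S f φ (j + 1))
        (fun F' hF' _ g T v _ hm => hBase F' hF' g T v hm) hlfp ?_ hm.lt (hm.mono (by omega))
        (hm.node j ψ' le_rfl hψ) g q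
      intro F' hF' hR' g T v p hT hm Z hZ
      have hm' := hBase F' hF' g T v hm
      have hmw : ∀ w, Match S f φ (j + 1) (evalW F' w T) (w ++ v) := by
        intro w
        induction w with
        | nil => exact hm
        | cons g w ih => exact hBase F' hF' g _ _ ih
      obtain ⟨hA, hB, hL, -⟩ := hsem _ _ hm' p
      refine comb_iff (by rw [nodePrm_db]; exact hm'.dead p) hA hB hL ?_
      refine ebit_iff_succ hrs hmd ?_ ?_ (popTable_ret hrs hK2) (popTable_nonret hrs hK2) ?_
      · intro q u
        rw [nodePrm_db, ← Bool.not_eq_true, (hmw u).dead q, not_not]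
      · intro q u
        cases hsel : sel with
        | none => rw [hz hsel, nodePrm_sb]; exact hZ q u
        | some C => exact (hsem _ _ (hmw u) q).2.2.2 C hsel
      · intro q g v
        -- The type `Td` has the dead bits of the empty stack but arbitrary node bits. Hence
        -- `Inv.dead` asks for correct dead bits only and not for a full match.
        rw [nodePrm_db, hF' _ _ _ (block_off (by omega) q.2), ← Bool.not_eq_true,
          h.dead _ [] (deadType_lt _ _) (fun q => by simp [testBit_deadType, PDS.not_alive_nil]) g q,
          not_not]
        exact (PDS.div_iff (v := v) (u := [g]) (by simp)).symm

variable (φ rs) in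
def deadTable (nG TC : ℕ) : Table :=
  (upd m nG TC (φ.size * m) (newb rs (popTable rs nG ((φ.size + 1) * m) TC) (deadType φ.size m)
    (deadPrm ((φ.size + 1) * m) (φ.size * m))))^[m * ((nG + 1) * TC)] fun _ _ => 0

/-- Being dead is the least set that contains every configuration all of whose successors it
contains; its complement is `Alive` by coinduction. -/
theorem inv_deadTable (hrs : ∀ r, r ∈ rs ↔ r ∈ S.Δ) :
    Inv S f φ φ.size (deadTable φ rs n (2 ^ ((φ.size + 1) * m))) := by
  set K := (φ.size + 1) * m with hK
  have hKsb : φ.size * m + m ≤ K := by rw [hK, Nat.succ_mul]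
  have hF0 : Rng n (2 ^ K) (fun _ _ => 0 : Table) := fun _ _ _ _ => by positivity
  have hagree : AgreeOff m (φ.size * m) (fun _ _ => 0) (deadTable φ rs n (2 ^ K)) :=
    agreeOff_iterate _
  refine ⟨rng_iterate hF0 hKsb _, ?_, ?_, ?_⟩
  · intro i hi g T p hp
    rw [hagree _ _ _ (block_off hi.ne hp)]
    simp
  · intro T v hT hv g q
    -- The disjunct `Z c` appears because in this stage the dead block is the block under
    -- construction, so `comb` also reads the bit that it computes.
    set Op : (Config (Fin m) (Fin n) → Prop) → Config (Fin m) (Fin n) → Prop := fun Z c =>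
      Z c ∨ ¬ ∃ e, S.Step c e ∧ ¬ Z e with hOp
    have hlfp : IsLfp Op fun c => ¬ S.Alive c := by
      refine ⟨?_, ?_, ?_⟩
      · rintro Z Z' hZ c (h | h)
        · exact .inl (hZ c h)
        · exact .inr fun ⟨e, he, he'⟩ => h ⟨e, he, fun h' => he' (hZ e h')⟩
      · rintro c (h | h)
        · exact h
        · intro ha
          obtain ⟨e, he, he'⟩ := ha.exists_step
          exact h ⟨e, he, not_not.2 he'⟩
      · intro X hX c hc
        by_contra hXc
        -- From outside of `X` some step leads to a configuration outside of `X` or to a live one,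
        -- so a run exists.
        refine hc (PDS.alive_coind (Z := fun c => ¬ X c ∨ S.Alive c) ?_ (.inl hXc))
        rintro c (hc | hc)
        · by_contra hno
          push Not at hno
          refine hc (hX c (.inr ?_))
          rintro ⟨e, he, he'⟩
          have := hno e he
          exact he' ⟨this.2, this.1⟩
        · obtain ⟨e, he, he'⟩ := hc.exists_step
          exact ⟨e, he, .inr he'⟩
    refine table_correct (m := m) le_rfl hKsb hF0 (by simp) (Base := fun _ _ => True)
      (fun _ _ _ _ _ _ _ _ => trivial) hlfp ?_ hT trivial hv g q
    intro F' hF' hR' g T v p hT _ Z hZ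
    have hlt := hR' g T (by omega) hT
    have hout : (F' g T).testBit ((φ.size + 1) * m + p) = false := testBit_ge hlt p
    have h0 := hZ p [g]
    change (F' g T).testBit (φ.size * m + p) = true ↔ Z (p, g :: v) at h0
    simp only [newb, comb, deadPrm, basePrm, hout, Bool.false_xor, Bool.or_false,
      Bool.true_and, Bool.or_eq_true, h0]
    change Z (p, g :: v) ∨ (!ebit rs _ _ (deadPrm K (φ.size * m)) F' p g T) = true ↔ _
    rw [Bool.not_eq_true', ← Bool.not_eq_true, ebit_true_iff]
    refine or_congr_right (not_congr ?_)
    have hgood : ∀ F1 Td r, good rs F1 Td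
        (deadPrm K (φ.size * m)) F' T r = true ↔ ¬ Z (r.tgt, r.word ++ v) := by
      intro F1 Td r
      rw [← hZ]
      simp [good, normGood, deadPrm, basePrm, Prm.hit, Prm.zv]
    simp only [hgood]
    constructor
    · rintro ⟨r, hr, h1, h2, h3⟩
      exact ⟨_, (step_cons_iff hrs).2 ⟨r, hr, h1, h2, rfl⟩, h3⟩
    · rintro ⟨e, he, he'⟩
      obtain ⟨r, hr, h1, h2, rfl⟩ := (step_cons_iff hrs).1 he
      exact ⟨r, hr, h1, h2, he'⟩
  · intro i ψ hi hψ
    have := φ.end_le hψ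
    have := ψ.size_pos
    omega

/-! ### The row of the bottom of the stack -/

theorem ebit_bot {nG : ℕ} (hG : ∀ r ∈ rs, (r.top : ℕ) ≠ nG) {F1 F : Table} {Td T p : ℕ} {x : Prm} :
    ebit rs F1 Td x F p nG T = false := by
  rw [ebit, List.any_eq_false]
  intro r hr
  simp [hG r hr]

-- The cell in row `nG` and column `0` holds the type of a stack without successors: the empty stack
-- if there are rules, and the whole input stack if there are none. No rule reads the symbol `nG`,
-- so the general update fills this cell as well.
variable (S f φ) in
structure Bot (nG j : ℕ) (F : Table) (v : List (Fin n)) : Prop where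
  mat : Match S f φ j (F nG 0) v
  zero : ∀ i < j, ∀ p < m, (F nG 0).testBit (i * m + p) = false

theorem Bot.nodeStep {nG TC j : ℕ} (hTC : 0 < TC) (hG : ∀ r ∈ rs, (r.top : ℕ) ≠ nG)
    {v : List (Fin n)} (hv : ∀ q e, ¬ S.Step (q, v) e) {F : Table} {ψ}
    (h : Bot S f φ nG (j + 1) F v) (hψ : φ.nodes[j]? = some ψ) :
    Bot S f φ nG j (nodeStep f φ rs nG TC j ψ F) v := by
  have hjlt : j < φ.size := by have := φ.end_le hψ; have := ψ.size_pos; omega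
  have hagree : AgreeOff m (j * m) F (BCARET.nodeStep f φ rs nG TC j ψ F) := agreeOff_iterate _
  have hm := h.mat.agreeOff hjlt (hagree nG 0)
  refine ⟨⟨hm.lt, hm.dead, fun i ψ' hi hψ' q => ?_⟩, fun i hi p hp => ?_⟩
  · rcases Nat.lt_or_eq_of_le hi with hlt | rfl
    · exact hm.node i ψ' hlt hψ' q
    · obtain rfl : ψ' = ψ := by rw [hψ] at hψ'; exact (Option.some.inj hψ').symm
      refine testBit_iterate_const le_rfl hTC q.2 (h.zero _ (by omega) q q.2) fun F' hF' _ => ?_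
      have hm' := h.mat.agreeOff hjlt (hF' nG 0)
      obtain ⟨A, B, L, b, sel, -, hlfp, -, hsem⟩ := exists_nodeSem S f hψ
      obtain ⟨hA, hB, hL, -⟩ := hsem _ _ hm' q
      -- One unfolding of the fixed point is enough, since without successors the operator does not
      -- depend on its argument.
      rw [hlfp.iff]
      refine comb_iff (by rw [nodePrm_db]; exact hm'.dead q) hA hB hL ?_
      rw [ebit_bot hG]
      simp only [Bool.false_eq_true, false_iff]
      rintro ⟨d, hd, -⟩
      obtain ⟨e, he, -⟩ := hd.alive.exists_step
      exact hv _ _ he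
  · rw [hagree _ _ _ (block_off hi.ne hp)]
    exact h.zero i (by omega) p hp

theorem bot_deadTable {nG TC : ℕ} (hTC : 0 < TC) (hG : ∀ r ∈ rs, (r.top : ℕ) ≠ nG)
    {v : List (Fin n)} (hv : ∀ q e, ¬ S.Step (q, v) e) :
    Bot S f φ nG φ.size (deadTable φ rs nG TC) v := by
  have hKsb : φ.size * m + m ≤ (φ.size + 1) * m := by rw [Nat.succ_mul]
  have hagree : AgreeOff m (φ.size * m) (fun _ _ => 0) (deadTable φ rs nG TC) :=
    agreeOff_iterate _
  have hlt : ∀ F', AgreeOff m (φ.size * m) (fun _ _ => 0) F' → F' nG 0 < 2 ^ ((φ.size + 1) * m) :=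
    fun F' hF' => lt_of_testBit_eq (y := 0) (by positivity)
      fun i hi => hF' nG 0 i (.inr (hKsb.trans hi))
  refine ⟨⟨hlt _ hagree, fun q => ?_, fun i ψ hi hψ => ?_⟩, fun i hi p hp => ?_⟩
  · refine testBit_iterate_const le_rfl hTC q.2 (by simp) fun F' hF' _ => ?_
    simp only [newb, ebit_bot hG, comb, deadPrm, basePrm, testBit_ge (hlt F' hF')]
    have : ¬ S.Alive (q, v) := fun h =>
      let ⟨_, he, _⟩ := h.exists_step
      hv _ _ he
    simp [this]
  · have := φ.end_le hψ
    have := ψ.size_pos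
    omega
  · rw [hagree _ _ _ (block_off hi.ne hp)]
    simp

end
-- The program on the random access machine and its correctness
namespace RAM

/-! ### Reasoning about programs -/

infixr:50 ";;" => Cmd.seq

notation "rgM" => 0
notation "rgG" => 1
notation "rgLW" => 4
notation "rgNR" => 5
notation "rgOne" => 6

/-- Whether a program may write a register. -/
def Cmd.wr : Cmd → ℕ → Bool
  | .const r _, x => Nat.beq r x
  | .copy r _, x => Nat.beq r x
  | .add r _ _, x => Nat.beq r x
  | .sub r _ _, x => Nat.beq r x
  | .load r _ _, x => Nat.beq r x
  | .store _ _ _, _ => false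
  | .seq c d, x => c.wr x || d.wr x
  | .ite _ c d, x => c.wr x || d.wr x
  | .loop _ c, x => c.wr x

/-- Whether a program may write to an array. -/
def Cmd.wa : Cmd → ℕ → Bool
  | .store a _ _, x => Nat.beq a x
  | .seq c d, x => c.wa x || d.wa x
  | .ite _ c d, x => c.wa x || d.wa x
  | .loop _ c, x => c.wa x
  | _, _ => false

@[simp] theorem State.reg_setReg (s : State) (r v x : ℕ) :
    (s.setReg r v).reg x = if x = r then v else s.reg x := by
  simp [State.setReg, Function.update_apply]

@[simp] theorem State.arr_setReg (s : State) (r v : ℕ) : (s.setReg r v).arr = s.arr := rfl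

@[simp] theorem State.reg_setArr (s : State) (a i v : ℕ) : (s.setArr a i v).reg = s.reg := rfl

theorem State.arr_setArr (s : State) (a i v b j : ℕ) :
    (s.setArr a i v).arr b j = if b = a ∧ j = i then v else s.arr b j := by
  by_cases h : b = a
  · subst h; simp [State.setArr, Function.update_apply]
  · simp [State.setArr, h]

@[simp] theorem State.reg_ite (c : Prop) [Decidable c] (s s' : State) (x : ℕ) :
    (if c then s else s').reg x = if c then s.reg x else s'.reg x := by split_ifs <;> rfl

@[simp] theorem State.arr_ite (c : Prop) [Decidable c] (s s' : State) (a : ℕ) :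
    (if c then s else s').arr a = if c then s.arr a else s'.arr a := by split_ifs <;> rfl

/-- What a program leaves unchanged. -/
structure Frame (c : Cmd) (s s' : State) : Prop where
  reg : ∀ r, c.wr r = false → s'.reg r = s.reg r
  arr : ∀ a, c.wa a = false → s'.arr a = s.arr a

theorem Frame.refl (c : Cmd) (s : State) : Frame c s s := ⟨fun _ _ => rfl, fun _ _ => rfl⟩

theorem Frame.trans {c : Cmd} {s s' s'' : State} (h : Frame c s s') (h' : Frame c s' s'') :
    Frame c s s'' :=
  ⟨fun r hr => (h'.reg r hr).trans (h.reg r hr), fun a ha => (h'.arr a ha).trans (h.arr a ha)⟩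

theorem Frame.weaken {c d : Cmd} {s s' : State} (h : Frame c s s')
    (hr : ∀ r, d.wr r = false → c.wr r = false) (ha : ∀ a, d.wa a = false → c.wa a = false) :
    Frame d s s' := ⟨fun r h' => h.reg r (hr r h'), fun a h' => h.arr a (ha a h')⟩

theorem Frame.setReg (c : Cmd) (s : State) (r v : ℕ) (hr : c.wr r = true) :
    Frame c s (s.setReg r v) := by
  refine ⟨fun x hx => ?_, fun a _ => rfl⟩
  have : x ≠ r := by rintro rfl; rw [hr] at hx; cases hx
  simp [this]

theorem Exec.frame {c : Cmd} {s s' : State} {t : ℕ} (h : Exec c s s' t) : Frame c s s' := by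
  induction h with
  | const | copy | add | sub | load =>
    exact Frame.setReg _ _ _ _ (by simp [Cmd.wr])
  | store s a u v =>
    refine ⟨fun x hx => rfl, fun b hb => ?_⟩
    have : b ≠ a := by rintro rfl; simp [Cmd.wa] at hb
    simp [State.setArr, this]
  | seq h₁ h₂ ih₁ ih₂ =>
    exact (ih₁.weaken (by simp +contextual [Cmd.wr]) (by simp +contextual [Cmd.wa])).trans
      (ih₂.weaken (by simp +contextual [Cmd.wr]) (by simp +contextual [Cmd.wa]))
  | iteTrue hr h ih => exact ih.weaken (by simp +contextual [Cmd.wr]) (by simp +contextual [Cmd.wa])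
  | iteFalse hr h ih => exact ih.weaken (by simp +contextual [Cmd.wr]) (by simp +contextual [Cmd.wa])
  | loopStop hr => exact .refl _ _
  | loopStep hr h₁ h₂ ih₁ ih₂ =>
    exact (ih₁.weaken (d := .loop _ _) (fun _ h => h) (fun _ h => h)).trans ih₂

/-- Started in `s`, the program halts within `t` steps in a state with the property `Q`. -/
def Tri (c : Cmd) (s : State) (t : ℕ) (Q : State → Prop) : Prop :=
  ∃ s' t', Exec c s s' t' ∧ t' ≤ t ∧ Q s'

theorem Tri.le {c s t t' Q} (ht : t ≤ t') (h : Tri c s t Q) : Tri c s t' Q :=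
  let ⟨s', u, h1, h2, h3⟩ := h
  ⟨s', u, h1, h2.trans ht, h3⟩

theorem Tri.imp {c s t} {Q Q' : State → Prop} (h : Tri c s t Q)
    (hQ : ∀ s', Frame c s s' → Q s' → Q' s') : Tri c s t Q' :=
  let ⟨s', u, h1, h2, h3⟩ := h
  ⟨s', u, h1, h2, hQ s' h1.frame h3⟩

theorem Tri.bind {c d s t₁ t₂ Q₁ Q} (h : Tri c s t₁ Q₁)
    (h' : ∀ s', Frame c s s' → Q₁ s' → Tri d s' t₂ Q) : Tri (c ;; d) s (t₁ + t₂) Q :=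
  let ⟨s', _, h1, h2, h3⟩ := h
  let ⟨s'', _, h4, h5, h6⟩ := h' s' h1.frame h3
  ⟨s'', _, .seq h1 h4, Nat.add_le_add h2 h5, h6⟩

theorem Tri.ite {r c d s t Q} (h : s.reg r ≠ 0 → Tri c s t Q) (h' : s.reg r = 0 → Tri d s t Q) :
    Tri (.ite r c d) s (t + 1) Q := by
  by_cases hr : s.reg r = 0
  · obtain ⟨s', _, h1, h2, h3⟩ := h' hr
    exact ⟨s', _, .iteFalse hr h1, Nat.add_le_add_right h2 1, h3⟩
  · obtain ⟨s', _, h1, h2, h3⟩ := h hr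
    exact ⟨s', _, .iteTrue hr h1, Nat.add_le_add_right h2 1, h3⟩

/-- Programs without loops. -/
def Cmd.flat : Cmd → Bool
  | .seq c d => c.flat && d.flat
  | .ite _ c d => c.flat && d.flat
  | .loop _ _ => false
  | _ => true

def Cmd.len : Cmd → ℕ
  | .seq c d => c.len + d.len
  | .ite _ c d => max c.len d.len + 1
  | _ => 1

/-- The effect of a program without loops. -/
def Cmd.run : Cmd → State → State
  | .const r k, s => s.setReg r k
  | .copy r u, s => s.setReg r (s.reg u)
  | .add r u v, s => s.setReg r (s.reg u + s.reg v)
  | .sub r u v, s => s.setReg r (s.reg u - s.reg v)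
  | .load r a u, s => s.setReg r (s.arr a (s.reg u))
  | .store a u v, s => s.setArr a (s.reg u) (s.reg v)
  | .seq c d, s => d.run (c.run s)
  | .ite r c d, s => if s.reg r = 0 then d.run s else c.run s
  | .loop _ _, s => s

theorem Cmd.exec_run (c : Cmd) (s : State) (hc : c.flat = true) :
    ∃ t ≤ c.len, Exec c s (c.run s) t := by
  induction c generalizing s with
  | const => exact ⟨1, le_rfl, .const ..⟩
  | copy => exact ⟨1, le_rfl, .copy ..⟩
  | add => exact ⟨1, le_rfl, .add ..⟩
  | sub => exact ⟨1, le_rfl, .sub ..⟩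
  | load => exact ⟨1, le_rfl, .load ..⟩
  | store => exact ⟨1, le_rfl, .store ..⟩
  | seq c d ihc ihd =>
    simp only [Cmd.flat, Bool.and_eq_true] at hc
    obtain ⟨t, ht, h⟩ := ihc s hc.1
    obtain ⟨t', ht', h'⟩ := ihd (c.run s) hc.2
    exact ⟨t + t', Nat.add_le_add ht ht', .seq h h'⟩
  | ite r c d ihc ihd =>
    simp only [Cmd.flat, Bool.and_eq_true] at hc
    simp only [Cmd.run, Cmd.len]
    split_ifs with hr
    · obtain ⟨t, ht, h⟩ := ihd s hc.2
      exact ⟨t + 1, by omega, .iteFalse hr h⟩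
    · obtain ⟨t, ht, h⟩ := ihc s hc.1
      exact ⟨t + 1, by omega, .iteTrue hr h⟩
  | loop => simp [Cmd.flat] at hc

theorem Tri.run {c s t} {Q : State → Prop} (hc : c.flat = true) (ht : c.len ≤ t) (hQ : Q (c.run s)) :
    Tri c s t Q :=
  let ⟨u, hu, h⟩ := c.exec_run s hc
  ⟨_, u, h, hu.trans ht, hQ⟩

/-- Do `c` for the values `n - 1, …, 0` of the register `i`, where `n` is its initial value. -/
def forC (i : ℕ) (c : Cmd) : Cmd := .loop i (.sub i i rgOne ;; c)

/-- The counter is lowered before the body runs, so the body sees `n - 1, …, 0`, and the invariant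
must tolerate a write to the counter (`hI`). The frame relative to `s₀` makes loop constants
available in every pass. -/
theorem Tri.forC {i c s₀ n} (I : ℕ → State → Prop) (tb : ℕ → ℕ) (h1 : s₀.reg rgOne = 1)
    (hn : s₀.reg i = n) (hw1 : c.wr rgOne = false) (hwi : c.wr i = false) (hi : i ≠ rgOne)
    (hI : ∀ j s v, I j s → I j (s.setReg i v)) (h0 : I n s₀)
    (step : ∀ j < n, ∀ s, Frame (forC i c) s₀ s → s.reg i = j → I (j + 1) s → Tri c s (tb j) (I j)) :
    Tri (forC i c) s₀ (∑ j ∈ Finset.range n, (tb j + 2) + 1) (I 0) := by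
  have hwr : (RAM.forC i c).wr i = true := by simp [RAM.forC, Cmd.wr]
  have hwr1 : (RAM.forC i c).wr rgOne = false := by
    have : Nat.beq i rgOne = false := by rw [← Bool.not_eq_true, Nat.beq_eq]; exact hi
    simp [RAM.forC, Cmd.wr, hw1, this]
  have key : ∀ j ≤ n, ∀ s, Frame (RAM.forC i c) s₀ s → s.reg i = j → I j s →
      Tri (RAM.forC i c) s (∑ j ∈ Finset.range j, (tb j + 2) + 1) (I 0) := by
    intro j
    induction j with
    | zero => intro _ s _ hs hIs; exact ⟨s, 1, .loopStop hs, by simp, hIs⟩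
    | succ j ih =>
      intro hj s hf hs hIs
      have hone : s.reg rgOne = 1 := (hf.reg _ hwr1).trans h1
      have hf' : Frame (RAM.forC i c) s₀ (s.setReg i j) := hf.trans (.setReg _ _ _ _ hwr)
      obtain ⟨s', t, h2, h3, h4⟩ := step j (by omega) (s.setReg i j) hf' (by simp) (hI _ _ _ hIs)
      have hf2 : Frame (RAM.forC i c) s₀ s' := by
        refine hf'.trans (h2.frame.weaken ?_ ?_)
        · intro r; simp +contextual [RAM.forC, Cmd.wr]
        · intro r; simp +contextual [RAM.forC, Cmd.wa]
      have hi' : s'.reg i = j := by rw [h2.frame.reg _ hwi]; simp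
      obtain ⟨s'', t', h5, h6, h7⟩ := ih (by omega) s' hf2 hi' h4
      have h2' : Exec c (s.setReg i (s.reg i - s.reg rgOne)) s' t := by
        rw [hs, hone, Nat.add_sub_cancel]; exact h2
      refine ⟨s'', _, .loopStep (by omega) (.seq (.sub s i i rgOne) h2') h5, ?_, h7⟩
      rw [Finset.sum_range_succ]; omega
  exact key n le_rfl s₀ (.refl _ _) hn h0

/-- A loop whose body has a uniform time bound. -/
theorem Tri.forC' {i c s₀ n} (I : ℕ → State → Prop) (tb : ℕ) (h1 : s₀.reg rgOne = 1)
    (hn : s₀.reg i = n) (hw1 : c.wr rgOne = false) (hwi : c.wr i = false) (hi : i ≠ rgOne)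
    (hI : ∀ j s v, I j s → I j (s.setReg i v)) (h0 : I n s₀)
    (step : ∀ j < n, ∀ s, Frame (RAM.forC i c) s₀ s → s.reg i = j → I (j + 1) s → Tri c s tb (I j)) :
    Tri (RAM.forC i c) s₀ (n * (tb + 2) + 1) (I 0) := by
  have := Tri.forC I (fun _ => tb) h1 hn hw1 hwi hi hI h0 step
  simpa using this

def skip : Cmd := .const 76 0

notation "rgN" => 7
notation "rgK" => 8
notation "rgTC" => 9
notation "rgRC" => 10
notation "rgTd" => 11
notation "rgGrp" => 20
notation "rgAbs" => 21
notation "rgPop" => 22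
notation "rgFl" => 23
notation "rgNv" => 24
notation "rgAp" => 25
notation "rgBp" => 26
notation "rgZb" => 27
notation "rgSb" => 28
notation "rgDb" => 29
notation "rgAb" => 30
notation "rgBb" => 31
notation "rgLb" => 32
notation "arRul" => 1
notation "arFml" => 2
notation "arLab" => 3
notation "arPow" => 4
notation "arRow" => 5
notation "arMul" => 6
notation "arRs" => 7
notation "arDr" => 8
notation "arF" => 9
notation "arG" => 10
notation "arF1" => 11
notation "arPos" => 12
notation "arEnd" => 13
notation "arPol" => 14

/-! ### Extracting a bit -/

/-- Register `72` gets the bit of register `70` at the position in register `71`. -/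
def testbit : Cmd :=
  (.const 72 0 ;; .copy 73 rgK) ;;
  forC 73 (.load 74 arPow 73 ;; .sub 75 74 70 ;;
    .ite 75 skip (.sub 70 70 74 ;; .sub 76 73 71 ;; .sub 77 71 73 ;; .add 76 76 77 ;;
      .ite 76 skip (.const 72 1)))

/-- Constants that bit extraction relies on. -/
structure Env0 (s : State) (K : ℕ) : Prop where
  one : s.reg rgOne = 1
  k : s.reg rgK = K
  pow : ∀ i < K, s.arr arPow i = 2 ^ i

theorem Env0.frame {s s' : State} {K : ℕ} (h : Env0 s K) {c : Cmd} (hf : Frame c s s')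
    (h1 : c.wr rgOne = false) (h2 : c.wr rgK = false) (h3 : c.wa arPow = false) : Env0 s' K :=
  ⟨(hf.reg _ h1).trans h.one, (hf.reg _ h2).trans h.k, fun i hi => by
    rw [hf.arr _ h3]; exact h.pow i hi⟩

/-- Powers of two are subtracted from the highest downwards whenever they fit; the power `2 ^ i`
fits exactly if bit `i` is set. -/
theorem tri_testbit {s : State} {K x i : ℕ} (hE : Env0 s K) (hx : s.reg 70 = x) (hi : s.reg 71 = i)
    (hlt : x < 2 ^ K) :
    Tri testbit s (14 * K + 3) fun s' => s'.reg 72 = (x.testBit i).toNat := by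
  refine Tri.le (t := 2 + (K * (12 + 2) + 1)) (by omega) (Tri.bind (Q₁ := fun s' =>
    s'.reg 70 = x ∧ s'.reg 72 = 0 ∧ s'.reg 73 = K) (Tri.run rfl (by decide) ?_) ?_)
  · simp [Cmd.run, hx, hE.k]
  intro s1 f1 ⟨h70, h72, h73⟩
  have hE1 := hE.frame f1 rfl rfl rfl
  have hi1 : s1.reg 71 = i := (f1.reg _ rfl).trans hi
  -- A position `i ≥ K` is never met and the answer stays `0`, which is correct as `x < 2 ^ K`; the
  -- node parameters use such positions as constants.
  refine (Tri.forC' (fun j s => s.reg 70 = x % 2 ^ j ∧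
    s.reg 72 = (decide (j ≤ i) && x.testBit i).toNat) 12 hE1.one h73 rfl rfl (by decide)
    (fun _ _ _ h => h) ?_ ?_).imp ?_
  · refine ⟨by rw [h70, Nat.mod_eq_of_lt hlt], ?_⟩
    rw [h72]
    by_cases hKi : K ≤ i
    · rw [Nat.testBit_lt_two_pow (hlt.trans_le (Nat.pow_le_pow_right (by norm_num) hKi))]; simp
    · simp [hKi]
  · intro j hj s2 f2 h2 ⟨h3, h4⟩
    have hE2 := hE1.frame f2 rfl rfl rfl
    have hi2 : s2.reg 71 = i := (f2.reg _ rfl).trans hi1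
    refine Tri.run rfl (by decide) ?_
    have hmod : x % 2 ^ (j + 1) = x % 2 ^ j + 2 ^ j * (x.testBit j).toNat := by
      rw [Nat.mod_pow_succ, Nat.toNat_testBit]
    have hxj := Nat.mod_lt x (show 0 < 2 ^ j by positivity)
    have hp := hE2.pow j hj
    rw [hmod] at h3
    simp only [Cmd.run, skip, State.reg_setReg, State.arr_setReg, State.reg_ite, State.arr_ite, h2,
      hp, hi2, Nat.reduceEqDiff, if_true, if_false, h3, h4]
    by_cases hij : j = i
    · subst hij
      cases hb : x.testBit j
      · simp [hb, hxj]
        try omega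
      · simp [hb]
    · have e2 : ¬ (j - i + (i - j) = 0) := by omega
      have e3 : (j + 1 ≤ i) ↔ j ≤ i := by omega
      rw [if_neg e2, if_neg e2]
      cases hb : x.testBit j
      · simp [hxj, e3]
        try omega
      · simp [e3]
  · rintro s' - ⟨-, h⟩
    simpa using h

/-! ### The state during the computation of the tables -/

/-- The program writes neither the registers `R` nor the arrays `A`. -/
def Cmd.keeps (c : Cmd) (R A : List ℕ) : Bool := R.all (fun r => !c.wr r) && A.all fun a => !c.wa a

theorem Frame.keepR {c : Cmd} {s s' : State} (hf : Frame c s s') {R A : List ℕ}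
    (hk : c.keeps R A = true) {r : ℕ} (hr : r ∈ R) : s'.reg r = s.reg r := by
  simp only [Cmd.keeps, Bool.and_eq_true, List.all_eq_true, Bool.not_eq_true'] at hk
  exact hf.reg r (hk.1 r hr)

theorem Frame.keepA {c : Cmd} {s s' : State} (hf : Frame c s s') {R A : List ℕ}
    (hk : c.keeps R A = true) {a : ℕ} (ha : a ∈ A) : s'.arr a = s.arr a := by
  simp only [Cmd.keeps, Bool.and_eq_true, List.all_eq_true, Bool.not_eq_true'] at hk
  exact hf.arr a (hk.2 a ha)

/-- The size parameters of the tables. -/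
structure Dim (m n : ℕ) where
  N : ℕ
  nG : ℕ
  TC : ℕ
  Td : ℕ
  rs : List (Rule (Fin m) (Fin n))

variable {m n : ℕ}

def Dim.K (c : Dim m n) : ℕ := (c.N + 1) * m

/-- The full table size is demanded only if there are rules. Without rules no entry is ever looked
up for a stack symbol, and one cell is allowed. -/
structure Dim.Ok (c : Dim m n) : Prop where
  two : 2 * m ≤ c.K
  pos : 0 < c.TC
  td : c.Td < 2 ^ c.K
  tc : c.rs ≠ [] → c.TC = 2 ^ c.K
  g : c.rs ≠ [] → n ≤ c.nG

def tabR : List ℕ := [rgM, rgG, rgNR, rgOne, rgK, rgTC, rgRC, rgTd]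

def tabA : List ℕ := [arRul, arPow, arRow, arMul, arRs, arDr]

/-- The constants for the computation of tables. -/
structure BEnv (c : Dim m n) (s : State) : Prop where
  e0 : Env0 s c.K
  pm : s.reg rgM = m
  g : s.reg rgG = c.nG
  nr : s.reg rgNR = c.rs.length
  tc : s.reg rgTC = c.TC
  rc : s.reg rgRC = m * ((c.nG + 1) * c.TC)
  td : s.reg rgTd = c.Td
  row : ∀ i ≤ c.nG + 1, s.arr arRow i = i * c.TC
  mul : ∀ i < m, s.arr arMul i = i * m
  rul : ∀ (i : ℕ) (h : i < c.rs.length) (j : ℕ) (hj : j < (encRule c.rs[i]).length),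
    s.arr arRul (s.arr arRs i + j) = (encRule c.rs[i])[j]
  dr : c.rs ≠ [] → ∀ (p q : Fin m) (g : Fin n),
    s.arr arDr (g * c.TC + (p * m + q)) = (dret c.rs p g q).toNat

theorem BEnv.frame {c : Dim m n} {s s' : State} (h : BEnv c s) {d : Cmd} (hf : Frame d s s')
    (hk : d.keeps tabR tabA = true) : BEnv c s' := by
  have hr : ∀ r ∈ tabR, s'.reg r = s.reg r := fun r => hf.keepR hk
  have ha : ∀ a ∈ tabA, s'.arr a = s.arr a := fun r => hf.keepA hk
  simp only [tabR, tabA, List.mem_cons, List.not_mem_nil, or_false, forall_eq_or_imp, forall_eq] at hr ha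
  obtain ⟨r1, r2, r3, r4, r5, r6, r7, r8⟩ := hr
  obtain ⟨a1, a2, a3, a4, a5, a6⟩ := ha
  obtain ⟨⟨x1, x2, x3⟩, h1, h2, h3, h4, h5, h6, h7, h8, h9, h10⟩ := h
  exact ⟨⟨r4.trans x1, r5.trans x2, a2 ▸ x3⟩, r1.trans h1, r2.trans h2, r3.trans h3, r6.trans h4,
    r7.trans h5, r8.trans h6, a3 ▸ h7, a4 ▸ h8, by rw [a1, a5]; exact h9, a6 ▸ h10⟩

def prmR : List ℕ :=
  [rgGrp, rgAbs, rgPop, rgFl, rgNv, rgAp, rgBp, rgZb, rgSb, rgDb, rgAb, rgBb, rgLb]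

/-- The parameters of a node. -/
structure PEnv (m : ℕ) (k : Prm) (s : State) : Prop where
  grp : s.reg rgGrp = k.grp
  abs : s.reg rgAbs = (decide (k.md = 1)).toNat
  pop : s.reg rgPop = (decide (k.md = 2)).toNat
  fl : s.reg rgFl = k.fl.toNat
  nv : s.reg rgNv = k.nv.toNat
  ap : s.reg rgAp = k.ap.toNat
  bp : s.reg rgBp = k.bp.toNat
  zb : s.reg rgZb = k.zb
  sb : s.reg rgSb = k.sb
  db : s.reg rgDb = k.db
  ab : s.reg rgAb = k.ab
  bb : s.reg rgBb = k.bb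
  lab : 2 < k.grp → ∀ p < m, s.arr arLab (s.reg rgLb + p) = (k.lab p).toNat

theorem PEnv.frame {k : Prm} {s s' : State} (h : PEnv m k s) {d : Cmd} (hf : Frame d s s')
    (hk : d.keeps prmR [arLab] = true) : PEnv m k s' := by
  have hr : ∀ r ∈ prmR, s'.reg r = s.reg r := fun r => hf.keepR hk
  have ha : s'.arr arLab = s.arr arLab := hf.keepA hk (by simp)
  simp only [prmR, List.mem_cons, List.not_mem_nil, or_false, forall_eq_or_imp, forall_eq] at hr
  obtain ⟨r1, r2, r3, r4, r5, r6, r7, r8, r9, r10, r11, r12, r13⟩ := hr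
  obtain ⟨h1, h2, h3, h4, h5, h6, h7, h8, h9, h10, h11, h12, h13⟩ := h
  exact ⟨r1.trans h1, r2.trans h2, r3.trans h3, r4.trans h4, r5.trans h5, r6.trans h6, r7.trans h7,
    r8.trans h8, r9.trans h9, r10.trans h10, r11.trans h11, r12.trans h12, by rw [ha, r13]; exact h13⟩

/-- The array `a` holds the table `F`. -/
def TabAt (c : Dim m n) (a : ℕ) (F : Table) (s : State) : Prop :=
  ∀ g ≤ c.nG, ∀ T < c.TC, s.arr a (g * c.TC + T) = F g T

def Small (c : Dim m n) (F : Table) : Prop := ∀ g ≤ c.nG, ∀ T < c.TC, F g T < 2 ^ c.K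

theorem Small.rng {c : Dim m n} {F : Table} (h : Small c F) (htc : c.TC = 2 ^ c.K) :
    Rng c.nG c.TC F := fun g T hg hT => htc ▸ h g hg T hT

/-- The environment of one update of the table `F`. -/
structure SEnv (c : Dim m n) (F1 : Table) (k : Prm) (F : Table) (s : State) : Prop where
  b : BEnv c s
  p : PEnv m k s
  f1 : TabAt c arF1 F1 s
  f : TabAt c arF F s

/-- The program writes nothing that `SEnv` speaks of; for a concrete program this holds by
evaluation. -/
def Cmd.pure (d : Cmd) : Bool :=
  d.keeps tabR tabA && (d.keeps prmR [arLab] && d.keeps [] [arF1, arF])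

theorem SEnv.frame {c : Dim m n} {F1 F : Table} {k : Prm} {s s' : State} (h : SEnv c F1 k F s)
    {d : Cmd} (hf : Frame d s s') (hd : d.pure = true) : SEnv c F1 k F s' := by
  simp only [Cmd.pure, Bool.and_eq_true] at hd
  refine ⟨h.b.frame hf hd.1, h.p.frame hf hd.2.1, ?_, ?_⟩
  · rw [TabAt, hf.keepA hd.2.2 (by simp)]; exact h.f1
  · rw [TabAt, hf.keepA hd.2.2 (by simp)]; exact h.f

/-- The situation in the evaluation of the rule `r` for the type `T`. -/
structure REnv (T : ℕ) (r : Rule (Fin m) (Fin n)) (s : State) : Prop where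
  t : s.reg 42 = T
  src : s.reg 56 = r.src
  top : s.reg 57 = r.top
  tgt : s.reg 58 = r.tgt
  len : s.reg 59 = r.word.length
  word : ∀ (i : ℕ) (h : i < r.word.length), s.arr arRul (s.reg 54 + i) = r.word[i]

theorem REnv.frame {T : ℕ} {r : Rule (Fin m) (Fin n)} {s s' : State} (h : REnv T r s) {d : Cmd}
    (hf : Frame d s s') (hk : d.keeps [42, 54, 56, 57, 58, 59] [arRul] = true) : REnv T r s' := by
  have hr : ∀ r ∈ [42, 54, 56, 57, 58, 59], s'.reg r = s.reg r := fun r => hf.keepR hk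
  have ha : s'.arr arRul = s.arr arRul := hf.keepA hk (by simp)
  simp only [List.mem_cons, List.not_mem_nil, or_false, forall_eq_or_imp, forall_eq] at hr
  obtain ⟨r1, r2, r3, r4, r5, r6⟩ := hr
  obtain ⟨h1, h2, h3, h4, h5, h6⟩ := h
  exact ⟨r1.trans h1, r3.trans h2, r4.trans h3, r5.trans h4, r6.trans h5, by rw [ha, r2]; exact h6⟩

/-! ### Evaluating a rule -/

/-- Set register `53` if the type in register `60` counts for the location in register `q`. -/
def hitC (q : ℕ) : Cmd :=
  (.copy 70 60 ;; .add 71 rgDb q) ;; testbit ;; .ite 72 skip (.ite 61 (.const 53 1) skip)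

/-- Register `61` gets the possibly negated bit of the location in register `q`. -/
def zvC (q : ℕ) : Cmd :=
  (.copy 70 60 ;; .add 71 rgZb q) ;; testbit ;; .ite 72 (.sub 61 rgOne 62) (.copy 61 62)

variable {c : Dim m n} {F1 F : Table} {k : Prm} {s : State} {x q T : ℕ} {v e f : Bool}
  {r : Rule (Fin m) (Fin n)}

theorem tri_hit {a : ℕ} (hS : SEnv c F1 k F s) (hx : s.reg 60 = x) (hlt : x < 2 ^ c.K)
    (hq : s.reg a = q) (hv : s.reg 61 = v.toNat) (he : s.reg 53 = e.toNat) (ha : a ≠ 70) :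
    Tri (hitC a) s (14 * c.K + 8) fun s' => s'.reg 53 = (e || k.hit x q v).toNat := by
  refine Tri.le (t := 2 + ((14 * c.K + 3) + 3)) (by omega) (Tri.bind (Q₁ := fun s' =>
    s'.reg 70 = x ∧ s'.reg 71 = k.db + q) (Tri.run rfl le_rfl ?_) ?_)
  · simp [Cmd.run, hx, hq, hS.p.db, ha]
  intro s1 f1 ⟨h1, h2⟩
  refine Tri.bind (tri_testbit (hS.b.e0.frame f1 rfl rfl rfl) h1 h2 hlt) fun s2 f2 h3 => ?_
  have hv2 : s2.reg 61 = v.toNat := (f2.reg _ rfl).trans ((f1.reg _ rfl).trans hv)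
  have he2 : s2.reg 53 = e.toNat := (f2.reg _ rfl).trans ((f1.reg _ rfl).trans he)
  refine Tri.run rfl (by decide) ?_
  simp only [Cmd.run, skip, State.reg_setReg, State.reg_ite, h3, hv2, he2, Prm.hit]
  cases x.testBit (k.db + q) <;> cases v <;> cases e <;> rfl

theorem tri_zv {a : ℕ} (hS : SEnv c F1 k F s) (hx : s.reg 60 = x) (hlt : x < 2 ^ c.K)
    (hq : s.reg a = q) (hf : s.reg 62 = f.toNat) (ha : a ≠ 70) :
    Tri (zvC a) s (14 * c.K + 7) fun s' => s'.reg 61 = (k.zv x q f).toNat := by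
  refine Tri.le (t := 2 + ((14 * c.K + 3) + 2)) (by omega) (Tri.bind (Q₁ := fun s' =>
    s'.reg 70 = x ∧ s'.reg 71 = k.zb + q) (Tri.run rfl le_rfl ?_) ?_)
  · simp [Cmd.run, hx, hq, hS.p.zb, ha]
  intro s1 f1 ⟨h1, h2⟩
  refine Tri.bind (tri_testbit (hS.b.e0.frame f1 rfl rfl rfl) h1 h2 hlt) fun s2 f2 h3 => ?_
  have hf2 : s2.reg 62 = f.toNat := (f2.reg _ rfl).trans ((f1.reg _ rfl).trans hf)
  have h1 : s2.reg rgOne = 1 := (f2.reg _ rfl).trans ((f1.reg _ rfl).trans hS.b.e0.one)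
  refine Tri.run rfl (by decide) ?_
  simp only [Cmd.run, skip, State.reg_setReg, State.reg_ite, h3, hf2, Prm.zv, h1]
  cases x.testBit (k.zb + q) <;> cases f <;> rfl

/-- Register `60` gets the type of the word of the rule. -/
def wordC : Cmd :=
  (.copy 60 42 ;; .copy 46 59) ;;
  forC 46 (.add 63 54 46 ;; .load 63 arRul 63 ;; .load 63 arRow 63 ;; .add 63 63 60 ;; .load 60 arF 63)

theorem tri_word (hc : c.Ok) (hS : SEnv c F1 k F s) (hR : REnv T r s) (hF : Small c F)
    (hr : c.rs ≠ []) (hT : T < c.TC) :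
    Tri wordC s (7 * r.word.length + 3) fun s' => s'.reg 60 = evalW F r.word T := by
  refine Tri.le (t := 2 + (r.word.length * (5 + 2) + 1)) (by omega) (Tri.bind (Q₁ := fun s' =>
    s'.reg 60 = T ∧ s'.reg 46 = r.word.length) (Tri.run rfl (by decide) ?_) ?_)
  · simp [Cmd.run, hR.t, hR.len]
  intro s1 f1 ⟨h1, h2⟩
  have hS1 := hS.frame f1 rfl
  have hR1 := hR.frame f1 rfl
  -- Counting down fits `evalW`, which processes a word from its lowest symbol upwards.
  refine (Tri.forC' (fun j s => s.reg 60 = evalW F (r.word.drop j) T) 5 hS1.b.e0.one h2 rfl rfl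
    (by decide) (fun _ _ _ h => h) (by simpa using h1) ?_).imp fun s' _ h => by simpa using h
  intro j hj s2 f2 h3 h4
  have hS2 := hS1.frame f2 rfl
  have hR2 := hR1.frame f2 rfl
  have hlt := evalW_lt (hc.g hr) (hF.rng (hc.tc hr)) hT (r.word.drop (j + 1))
  refine Tri.run rfl (by decide) ?_
  have hg : (r.word[j] : ℕ) ≤ c.nG := (r.word[j]).2.le.trans (hc.g hr)
  simp only [Cmd.run, State.reg_setReg, State.arr_setReg, h3, h4, Nat.reduceEqDiff, if_true, if_false,
    hR2.word j hj, hS2.b.row _ (hg.trans (Nat.le_succ _)), hS2.f _ hg _ hlt]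
  rw [List.drop_eq_getElem_cons hj, evalW_cons]

/-- Register `62` gets the flag for the rule. -/
def ffC : Cmd :=
  .copy 62 rgFl ;; .ite rgPop
    ((.load 63 arRow 57 ;; .load 64 arMul 56 ;; .add 63 63 64 ;; .add 63 63 58 ;; .load 63 arDr 63) ;;
      .ite 63 ((.copy 70 60 ;; .add 71 rgM 58) ;; testbit ;; .copy 62 72) skip) skip

theorem tri_ff (hc : c.Ok) (hS : SEnv c F1 k F s) (hR : REnv T r s) (hr : c.rs ≠ [])
    (hx : s.reg 60 = x) (hlt : x < 2 ^ c.K) :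
    Tri ffC s (14 * c.K + 14) fun s' => s'.reg 62 = (if k.md = 2 ∧ dret c.rs r.src r.top r.tgt = true
      then x.testBit (m + r.tgt) else k.fl).toNat := by
  refine Tri.le (t := 1 + ((14 * c.K + 12) + 1)) (by omega) (Tri.bind (Q₁ := fun s' =>
    s'.reg 62 = k.fl.toNat) (Tri.run rfl (by decide) ?_) ?_)
  · simp [Cmd.run, hS.p.fl]
  intro s1 f1 h1
  have hS1 := hS.frame f1 rfl
  have hR1 := hR.frame f1 rfl
  have hx1 : s1.reg 60 = x := (f1.reg _ rfl).trans hx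
  refine Tri.ite (fun hp => ?_) fun hp => ?_
  · rw [hS1.p.pop] at hp
    have hmd : k.md = 2 := by
      by_contra h; exact hp (by simp [h])
    refine Tri.le (t := 5 + (14 * c.K + 6 + 1)) (by omega) (Tri.bind (Q₁ := fun s' =>
      s'.reg 63 = (dret c.rs r.src r.top r.tgt).toNat) (Tri.run rfl (by decide) ?_) ?_)
    · have hg : (r.top : ℕ) ≤ c.nG := r.top.2.le.trans (hc.g hr)
      simp only [Cmd.run, State.reg_setReg, State.arr_setReg, Nat.reduceEqDiff, if_true, if_false,
        hR1.top, hR1.src, hR1.tgt, hS1.b.row _ (hg.trans (Nat.le_succ _)), hS1.b.mul _ r.src.2, add_assoc,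
        hS1.b.dr hr]
    intro s2 f2 h2
    have hS2 := hS1.frame f2 rfl
    have hR2 := hR1.frame f2 rfl
    have hx2 : s2.reg 60 = x := (f2.reg _ rfl).trans hx1
    have h12 : s2.reg 62 = k.fl.toNat := (f2.reg _ rfl).trans h1
    refine Tri.ite (fun hd => ?_) fun hd => ?_
    · have hd' : dret c.rs r.src r.top r.tgt = true := by
        by_contra h; exact hd (by rw [h2]; simp [h])
      refine Tri.le (t := 2 + (14 * c.K + 3 + 1)) (by omega) (Tri.bind (Q₁ := fun s' =>
        s'.reg 70 = x ∧ s'.reg 71 = m + r.tgt) (Tri.run rfl (by decide) ?_) ?_)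
      · simp [Cmd.run, hx2, hS2.b.pm, hR2.tgt]
      intro s3 f3 ⟨h3, h4⟩
      refine Tri.bind (tri_testbit (hS2.b.e0.frame f3 rfl rfl rfl) h3 h4 hlt) fun s4 f4 h5 => ?_
      refine Tri.run rfl (by decide) ?_
      simp [Cmd.run, h5, hmd, hd']
    · have hd' : dret c.rs r.src r.top r.tgt = false := by
        rw [h2] at hd; simpa using hd
      refine Tri.run rfl (by simp [skip, Cmd.len]) ?_
      simp [Cmd.run, skip, hd', h12]
  · rw [hS1.p.pop] at hp
    have hmd : ¬ k.md = 2 := by simpa using hp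
    refine Tri.run rfl (by simp [skip, Cmd.len]) ?_
    simp [Cmd.run, skip, hmd, h1]

def normC : Cmd := wordC ;; ffC ;; zvC 58 ;; hitC 58

theorem tri_norm (hc : c.Ok) (hS : SEnv c F1 k F s) (hR : REnv T r s) (hF : Small c F)
    (hr : c.rs ≠ []) (hT : T < c.TC) (he : s.reg 53 = e.toNat) :
    Tri normC s (7 * r.word.length + 42 * c.K + 32) fun s' =>
      s'.reg 53 = (e || normGood c.rs k F T r).toNat := by
  have hlt : evalW F r.word T < 2 ^ c.K := by
    have := evalW_lt (hc.g hr) (hF.rng (hc.tc hr)) hT r.word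
    rwa [hc.tc hr] at this
  refine Tri.le (t := 7 * r.word.length + 3 + ((14 * c.K + 14) + ((14 * c.K + 7) + (14 * c.K + 8))))
    (by omega) (Tri.bind (tri_word hc hS hR hF hr hT) fun s1 f1 h1 => ?_)
  have hS1 := hS.frame f1 rfl
  have hR1 := hR.frame f1 rfl
  refine Tri.bind (tri_ff hc hS1 hR1 hr h1 hlt) fun s2 f2 h2 => ?_
  have hS2 := hS1.frame f2 rfl
  have hR2 := hR1.frame f2 rfl
  have hx2 := (f2.reg 60 rfl).trans h1
  refine Tri.bind (tri_zv hS2 hx2 hlt hR2.tgt h2 (by decide)) fun s3 f3 h3 => ?_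
  refine tri_hit (hS2.frame f3 rfl) ((f3.reg 60 rfl).trans hx2) hlt ((hR2.frame f3 rfl).tgt) h3 ?_
    (by decide)
  rw [f3.reg _ rfl, f2.reg _ rfl, f1.reg _ rfl, he]

def retC : Cmd := (.copy 60 42 ;; .copy 61 rgNv) ;; hitC 58

theorem tri_ret (hc : c.Ok) (hS : SEnv c F1 k F s) (hR : REnv T r s)
    (hr : c.rs ≠ []) (hT : T < c.TC) (he : s.reg 53 = e.toNat) :
    Tri retC s (14 * c.K + 10) fun s' => s'.reg 53 = (e || k.hit T r.tgt k.nv).toNat := by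
  refine Tri.le (t := 2 + (14 * c.K + 8)) (by omega) (Tri.bind (Q₁ := fun s' =>
    s'.reg 60 = T ∧ s'.reg 61 = k.nv.toNat) (Tri.run rfl (by decide) ?_) ?_)
  · simp [Cmd.run, hR.t, hS.p.nv]
  intro s1 f1 ⟨h1, h2⟩
  exact tri_hit (hS.frame f1 rfl) h1 (hc.tc hr ▸ hT) (hR.frame f1 rfl).tgt h2
    ((f1.reg _ rfl).trans he) (by decide)

variable {m n : ℕ} {c : Dim m n} {F1 F : Table} {k : Prm} {s : State} {x q T : ℕ} {v e f : Bool}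
  {r : Rule (Fin m) (Fin n)}

theorem drop_range_self (m : ℕ) : (List.range m).drop m = [] := by simp

theorem drop_range {j m : ℕ} (hj : j < m) :
    (List.range m).drop j = j :: (List.range m).drop (j + 1) := by
  rw [List.drop_eq_getElem_cons (by simpa using hj), List.getElem_range]

/-- Take into account the return of a call at the location in register `45`. -/
def callBody : Cmd :=
  (.add 63 rgM 45 ;; .load 63 arPow 63 ;; .add 63 66 63 ;; .load 70 arF1 63 ;; .copy 71 58) ;;
  testbit ;; .ite 72 (.copy 62 rgFl ;; zvC 45 ;; hitC 45) skip ;;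
  (.add 63 rgM 45 ;; .load 63 arPow 63 ;; .load 64 arPow 45 ;; .add 63 63 64 ;; .add 63 66 63 ;;
    .load 70 arF1 63 ;; .copy 71 58) ;;
  testbit ;; .ite 72 (.copy 61 rgNv ;; hitC 45) skip

theorem tri_callBody {g q' : ℕ} (hc : c.Ok) (hS : SEnv c F1 k F s) (hF1 : Small c F1)
    (hr : c.rs ≠ []) (hg : g ≤ c.nG) (hx : s.reg 60 = x) (hlt : x < 2 ^ c.K) (hq : s.reg 58 = q)
    (hq' : s.reg 45 = q') (hm : q' < m) (h66 : s.reg 66 = g * c.TC) (he : s.reg 53 = e.toNat) :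
    Tri callBody s (70 * c.K + 45) fun s' =>
      s'.reg 53 = (e || callGood (m := m) k F1 x g q q').toNat := by
  have hK := hc.two
  -- The larger of the two columns of the pop table is a type: both powers are at most `2 ^ (2 * m -
  -- 1)`, the second one being smaller, and `2 * m ≤ K`.
  have hp : 2 ^ (m + q') + 2 ^ q' < 2 ^ c.K := by
    have h1 : (2 : ℕ) ^ q' < 2 ^ m := Nat.pow_lt_pow_right (by norm_num) hm
    have h2 : (2 : ℕ) ^ (m + q') ≤ 2 ^ (m + (m - 1)) := Nat.pow_le_pow_right (by norm_num) (by omega)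
    have h3 : (2 : ℕ) ^ m ≤ 2 ^ (m + (m - 1)) := Nat.pow_le_pow_right (by norm_num) (by omega)
    have h4 : (2 : ℕ) ^ (m + (m - 1) + 1) ≤ 2 ^ c.K := Nat.pow_le_pow_right (by norm_num) (by omega)
    rw [pow_succ] at h4
    omega
  have htc := hc.tc hr
  have hp1 : 2 ^ (m + q') < c.TC := by
    have := Nat.two_pow_pos q'
    omega
  rw [← htc] at hp
  set R1 := F1 g (2 ^ (m + q')) with hR1
  set R0 := F1 g (2 ^ (m + q') + 2 ^ q') with hR0
  refine Tri.le (t := 5 + ((14 * c.K + 3) + ((1 + ((14 * c.K + 7) + (14 * c.K + 8)) + 1) +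
    (7 + ((14 * c.K + 3) + (1 + (14 * c.K + 8) + 1)))))) (by omega) (Tri.bind (Q₁ := fun s' =>
    s'.reg 70 = R1 ∧ s'.reg 71 = q) (Tri.run rfl (by decide) ?_) ?_)
  · simp only [Cmd.run, State.reg_setReg, State.arr_setReg, Nat.reduceEqDiff, if_true, if_false,
      hS.b.pm, hq', h66, hS.b.e0.pow _ (show m + q' < c.K by omega), hS.f1 g hg _ hp1, hq, hR1, and_self]
  intro s1 f1 ⟨h1, h2⟩
  have hS1 := hS.frame f1 rfl
  have e1 : Frame callBody s s1 := f1.weaken (by simp +contextual [callBody, Cmd.wr]) (by simp +contextual [callBody, Cmd.wa])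
  refine Tri.bind (tri_testbit hS1.b.e0 h1 h2 (hF1 g hg _ hp1)) fun s2 f2 h3 => ?_
  have hS2 := hS1.frame f2 rfl
  have k60 := (f2.reg 60 rfl).trans (f1.reg 60 rfl)
  have k58 := (f2.reg 58 rfl).trans (f1.reg 58 rfl)
  have k45 := (f2.reg 45 rfl).trans (f1.reg 45 rfl)
  have k66 := (f2.reg 66 rfl).trans (f1.reg 66 rfl)
  have k53 := (f2.reg 53 rfl).trans (f1.reg 53 rfl)
  rw [hx] at k60; rw [hq] at k58; rw [hq'] at k45; rw [h66] at k66; rw [he] at k53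
  refine Tri.bind (Q₁ := fun s' => s'.reg 53 =
    (e || (R1.testBit q && k.hit x q' (k.zv x q' k.fl))).toNat) ?_ ?_
  · refine Tri.ite (fun h => ?_) fun h => ?_
    · have hb : R1.testBit q = true := by
        by_contra hn; exact h (by rw [h3]; simp [hn])
      refine Tri.bind (Q₁ := fun s' => s'.reg 62 = k.fl.toNat) (Tri.run rfl le_rfl ?_) ?_
      · simp [Cmd.run, hS2.p.fl]
      intro s3 f3 h4
      have hS3 := hS2.frame f3 rfl
      refine Tri.bind (tri_zv hS3 ((f3.reg 60 rfl).trans k60) hlt ((f3.reg 45 rfl).trans k45) h4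
        (by decide)) fun s4 f4 h5 => ?_
      have hS4 := hS3.frame f4 rfl
      have := tri_hit (a := 45) hS4 ((f4.reg 60 rfl).trans ((f3.reg 60 rfl).trans k60)) hlt
        ((f4.reg 45 rfl).trans ((f3.reg 45 rfl).trans k45)) h5
        ((f4.reg 53 rfl).trans ((f3.reg 53 rfl).trans k53)) (by decide)
      simpa [hb] using this
    · have hb : R1.testBit q = false := by
        rw [h3] at h; simpa using h
      refine Tri.run rfl (by simp [skip, Cmd.len]) ?_
      simp [Cmd.run, skip, hb, k53]
  intro s3 f3 h4
  have hS3 := hS2.frame f3 rfl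
  have j60 := (f3.reg 60 rfl).trans k60
  have j58 := (f3.reg 58 rfl).trans k58
  have j45 := (f3.reg 45 rfl).trans k45
  have j66 := (f3.reg 66 rfl).trans k66
  refine Tri.bind (Q₁ := fun s' => s'.reg 70 = R0 ∧ s'.reg 71 = q) (Tri.run rfl (by decide) ?_) ?_
  · simp only [Cmd.run, State.reg_setReg, State.arr_setReg, Nat.reduceEqDiff, if_true, if_false,
      hS3.b.pm, j45, j66, hS3.b.e0.pow _ (show m + q' < c.K by omega),
      hS3.b.e0.pow _ (show q' < c.K by omega), hS3.f1 g hg _ hp, j58, hR0, and_self]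
  intro s4 f4 ⟨h5, h6⟩
  have hS4 := hS3.frame f4 rfl
  refine Tri.bind (tri_testbit hS4.b.e0 h5 h6 (hF1 g hg _ hp)) fun s5 f5 h7 => ?_
  have hS5 := hS4.frame f5 rfl
  have l53 := (f5.reg 53 rfl).trans ((f4.reg 53 rfl).trans h4)
  have l60 := (f5.reg 60 rfl).trans ((f4.reg 60 rfl).trans j60)
  have l45 := (f5.reg 45 rfl).trans ((f4.reg 45 rfl).trans j45)
  rw [callGood, ← hR1, ← hR0, ← Bool.or_assoc]
  refine Tri.ite (fun h => ?_) fun h => ?_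
  · have hb : R0.testBit q = true := by
      by_contra hn; exact h (by rw [h7]; simp [hn])
    refine Tri.bind (Q₁ := fun s' => s'.reg 61 = k.nv.toNat) (Tri.run rfl le_rfl ?_) ?_
    · simp [Cmd.run, hS5.p.nv]
    intro s6 f6 h8
    have := tri_hit (a := 45) (hS5.frame f6 rfl) ((f6.reg 60 rfl).trans l60) hlt
      ((f6.reg 45 rfl).trans l45) h8 ((f6.reg 53 rfl).trans l53) (by decide)
    simpa [hb] using this
  · have hb : R0.testBit q = false := by
      rw [h7] at h; simpa using h
    refine Tri.run rfl (by simp [skip, Cmd.len]) ?_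
    simp [Cmd.run, skip, hb, l53]

def callC : Cmd :=
  (.load 66 arRul 54 ;; .load 66 arRow 66 ;; .add 63 54 rgOne ;; .load 63 arRul 63 ;;
    .load 63 arRow 63 ;; .add 63 63 42 ;; .load 60 arF 63 ;; .copy 45 rgM) ;;
  forC 45 callBody ;;
  (.load 63 arRul 54 ;; .load 63 arRow 63 ;; .add 63 63 rgTd ;; .load 60 arF 63 ;; .copy 61 rgNv) ;;
  hitC 58

theorem tri_call {p t : Fin m} {γ g₁ g₂ : Fin n} (hc : c.Ok) (hS : SEnv c F1 k F s)
    (hR : REnv T (.call p γ t g₁ g₂) s) (hF1 : Small c F1) (hF : Small c F)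
    (hr : c.rs ≠ []) (hT : T < c.TC) (he : s.reg 53 = e.toNat) :
    Tri callC s (m * (70 * c.K + 47) + 14 * c.K + 22) fun s' => s'.reg 53 =
      (e || (((List.range m).any fun q' => callGood (m := m) k F1 (F g₂ T) g₁ t q') ||
        k.hit (F g₁ c.Td) t k.nv)).toNat := by
  have hg₁ : (g₁ : ℕ) ≤ c.nG := g₁.2.le.trans (hc.g hr)
  have hg₂ : (g₂ : ℕ) ≤ c.nG := g₂.2.le.trans (hc.g hr)
  have hTd : c.Td < c.TC := hc.tc hr ▸ hc.td
  refine Tri.le (t := 8 + ((m * (70 * c.K + 47) + 1) + (5 + (14 * c.K + 8)))) (by omega)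
    (Tri.bind (Q₁ := fun s' => s'.reg 66 = g₁ * c.TC ∧ s'.reg 60 = F g₂ T ∧ s'.reg 45 = m)
    (Tri.run rfl (by decide) ?_) ?_)
  · have w0 := hR.word 0 (by simp [Rule.word])
    have w1 := hR.word 1 (by simp [Rule.word])
    simp only [Rule.word, List.getElem_cons_zero, List.getElem_cons_succ, add_zero] at w0 w1
    simp only [Cmd.run, State.reg_setReg, State.arr_setReg, Nat.reduceEqDiff, if_true, if_false, w0, w1,
      hS.b.e0.one, hS.b.row _ (hg₁.trans (Nat.le_succ _)), hS.b.row _ (hg₂.trans (Nat.le_succ _)), hR.t,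
      hS.f _ hg₂ _ hT, hS.b.pm, and_self]
  intro s1 f1 ⟨h1, h2, h3⟩
  have hS1 := hS.frame f1 rfl
  have hR1 := hR.frame f1 rfl
  have he1 := (f1.reg 53 rfl).trans he
  refine Tri.bind (Q₁ := fun s' => s'.reg 53 =
    (e || ((List.range m).any fun q' => callGood (m := m) k F1 (F g₂ T) g₁ t q')).toNat) ?_ ?_
  · refine (Tri.forC' (fun j s => s.reg 53 = (e || (((List.range m).drop j).any fun q' =>
        callGood (m := m) k F1 (F g₂ T) g₁ t q')).toNat) _ hS1.b.e0.one h3 rfl rfl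
      (by decide) (fun _ _ _ h => h) (by simpa [drop_range_self] using he1) ?_).imp fun s' _ h => by simpa using h
    intro j hj s2 f2 h4 h5
    have := tri_callBody hc (hS1.frame f2 rfl) hF1 hr hg₁ ((f2.reg 60 rfl).trans h2)
      (hF _ hg₂ _ hT) ((f2.reg 58 rfl).trans hR1.tgt) h4 hj ((f2.reg 66 rfl).trans h1) h5
    refine this.imp fun s' _ h => ?_
    rw [h, drop_range hj]
    simp only [List.any_cons, Rule.tgt]
    rw [Bool.or_assoc, Bool.or_comm (List.any _ _)]
  intro s2 f2 h4
  have hS2 := hS1.frame f2 rfl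
  have hR2 := hR1.frame f2 rfl
  refine Tri.bind (Q₁ := fun s' => s'.reg 60 = F g₁ c.Td ∧ s'.reg 61 = k.nv.toNat)
    (Tri.run rfl (by decide) ?_) ?_
  · have w0 := hR2.word 0 (by simp [Rule.word])
    simp only [Rule.word, List.getElem_cons_zero, List.getElem_cons_succ, add_zero] at w0
    simp only [Cmd.run, State.reg_setReg, State.arr_setReg, Nat.reduceEqDiff, if_true, if_false, w0,
      hS2.b.row _ (hg₁.trans (Nat.le_succ _)), hS2.b.td, hS2.f _ hg₁ _ hTd, hS2.p.nv, and_self]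
  intro s3 f3 ⟨h5, h6⟩
  rw [← Bool.or_assoc]
  exact tri_hit (hS2.frame f3 rfl) h5 (hF _ hg₁ _ hTd) (hR2.frame f3 rfl).tgt h6
    ((f3.reg 53 rfl).trans h4) (by decide)

def goodC : Cmd := .ite rgAbs (.ite 55 (.sub 65 55 rgOne ;; .ite 65 normC retC) callC) normC

theorem tri_good (hc : c.Ok) (hS : SEnv c F1 k F s)
    (hR : REnv T r s) (hF1 : Small c F1) (hF : Small c F)
    (hr : c.rs ≠ []) (hT : T < c.TC) (he : s.reg 53 = e.toNat)
    (hk : s.reg 55 = match r.kind with | .call => 0 | .ret => 1 | .int => 2) :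
    Tri goodC s (7 * r.word.length + m * (70 * c.K + 47) + 42 * c.K + 36) fun s' => s'.reg 53 =
      (e || good c.rs F1 c.Td k F T r).toNat := by
  refine Tri.le (t := 7 * r.word.length + m * (70 * c.K + 47) + 42 * c.K + 35 + 1) (by omega) ?_
  refine Tri.ite (fun h => ?_) fun h => ?_
  · have hmd : k.md = 1 := by
      by_contra hn; exact h (by rw [hS.p.abs]; simp [hn])
    refine Tri.le (t := 7 * r.word.length + m * (70 * c.K + 47) + 42 * c.K + 34 + 1) (by omega) ?_
    cases r with
    | call p γ t g₁ g₂ =>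
      refine Tri.ite (fun h => absurd hk h) fun _ => ?_
      simpa only [good, hmd, if_true] using
        (tri_call hc hS hR hF1 hF hr hT he).le (by omega)
    | ret p γ t =>
      refine Tri.ite (fun _ => ?_) fun h => by simp [Rule.kind, h] at hk
      simp only [Rule.kind] at hk
      refine Tri.le (t := 1 + (14 * c.K + 10 + 1)) (by omega) (Tri.bind (Q₁ := fun s' => s'.reg 65 = 0)
        (Tri.run rfl (by decide) (by simp [Cmd.run, hk, hS.b.e0.one])) fun s1 f1 h1 => ?_)
      refine Tri.ite (fun h => absurd h1 h) fun _ => ?_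
      simpa only [good, hmd, if_true, Rule.tgt] using
        (tri_ret hc (hS.frame f1 rfl) (hR.frame f1 rfl) hr hT ((f1.reg 53 rfl).trans he))
    | int p γ t w =>
      refine Tri.ite (fun _ => ?_) fun h => by simp [Rule.kind, h] at hk
      simp only [Rule.kind] at hk
      refine Tri.le (t := 1 + (7 * w.length + 42 * c.K + 32 + 1)) (by simp only [Rule.word]; omega)
        (Tri.bind (Q₁ := fun s' => s'.reg 65 = 1)
        (Tri.run rfl (by decide) (by simp [Cmd.run, hk, hS.b.e0.one])) fun s1 f1 h1 => ?_)
      refine Tri.ite (fun _ => ?_) fun h => by simp [h1] at h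
      simpa only [good, hmd, if_true, Rule.word] using
        (tri_norm hc (hS.frame f1 rfl) (hR.frame f1 rfl) hF hr hT ((f1.reg 53 rfl).trans he))
  · have hmd : ¬ k.md = 1 := by rw [hS.p.abs] at h; simpa using h
    simpa only [good, hmd, if_false] using (tri_norm hc hS hR hF hr hT he).le (by omega)

/-- Evaluate the rule number `i`, where `i` is in register `44`. -/
def ruleC : Cmd :=
  (.load 54 arRs 44 ;; .load 55 arRul 54 ;; .add 54 54 rgOne ;; .load 56 arRul 54 ;; .add 54 54 rgOne ;;
    .load 57 arRul 54 ;; .add 54 54 rgOne ;; .load 58 arRul 54 ;; .add 54 54 rgOne ;;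
    .load 59 arRul 54 ;; .add 54 54 rgOne) ;;
  (.sub 63 56 43 ;; .sub 64 43 56 ;; .add 63 63 64 ;; .sub 64 57 41 ;; .add 63 63 64 ;;
    .sub 64 41 57 ;; .add 63 63 64) ;;
  .ite 63 skip goodC

theorem tri_rule {p g i : ℕ} (hc : c.Ok) (hS : SEnv c F1 k F s) (hF1 : Small c F1) (hF : Small c F)
    (hT : T < c.TC) (h42 : s.reg 42 = T) (h41 : s.reg 41 = g) (h43 : s.reg 43 = p)
    (h44 : s.reg 44 = i) (hi : i < c.rs.length) (he : s.reg 53 = e.toNat) :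
    Tri ruleC s (7 * c.rs[i].word.length + m * (70 * c.K + 47) + 42 * c.K + 55) fun s' => s'.reg 53 =
      (e || ((c.rs[i].src.val == p && c.rs[i].top.val == g) &&
        good c.rs F1 c.Td k F T c.rs[i])).toNat := by
  have hr : c.rs ≠ [] := by rintro h; simp [h] at hi
  have hw := hS.b.rul i hi
  set r := c.rs[i] with hrdef
  set b := s.arr arRs i
  refine Tri.le (t := 11 + (7 + (7 * r.word.length + m * (70 * c.K + 47) + 42 * c.K + 36 + 1)))
    (by omega) (Tri.bind (Q₁ := fun s' => REnv T r s' ∧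
      s'.reg 55 = match r.kind with | .call => 0 | .ret => 1 | .int => 2)
    (Tri.run rfl (by decide) ?_) ?_)
  · have e0 := hw 0 (by simp [encRule])
    have e1 := hw 1 (by simp [encRule])
    have e2 := hw 2 (by simp [encRule])
    have e3 := hw 3 (by simp [encRule])
    have e4 := hw 4 (by simp [encRule])
    simp only [encRule, List.getElem_cons_zero, List.getElem_cons_succ, add_zero] at e0 e1 e2 e3 e4
    refine ⟨⟨?_, ?_, ?_, ?_, ?_, fun j hj => ?_⟩, ?_⟩
    case refine_1.refine_6 =>
      have e5 := hw (j + 5) (by simpa [encRule] using hj)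
      simp only [encRule, List.getElem_cons_succ, List.getElem_map] at e5
      simp only [Cmd.run, State.reg_setReg, State.arr_setReg, Nat.reduceEqDiff, if_true, if_false,
        hS.b.e0.one, h44, add_assoc, Nat.reduceAdd]
      rw [← e5]
      congr 1
      show b + _ = _
      omega
    all_goals
      simp only [Cmd.run, State.reg_setReg, State.arr_setReg, Nat.reduceEqDiff, if_true, if_false,
        hS.b.e0.one, h44, add_assoc, Nat.reduceAdd]
      assumption
  intro s1 f1 ⟨hR1, h1⟩
  have hS1 := hS.frame f1 rfl
  have j41 := (f1.reg 41 rfl).trans h41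
  have j43 := (f1.reg 43 rfl).trans h43
  -- With truncated subtraction this sum vanishes exactly if `r.src = p` and `r.top = g`.
  refine Tri.bind (Q₁ := fun s' => s'.reg 63 = r.src - p + (p - r.src) + (r.top - g) + (g - r.top))
    (Tri.run rfl (by decide) ?_) fun s2 f2 h2 => ?_
  · simp [Cmd.run, hR1.src, hR1.top, j41, j43]
  have he2 := (f2.reg 53 rfl).trans ((f1.reg 53 rfl).trans he)
  refine Tri.ite (fun h => ?_) fun h => ?_
  · have hb : (r.src.val == p && r.top.val == g) = false := by
      rw [Bool.and_eq_false_iff, beq_eq_false_iff_ne, beq_eq_false_iff_ne]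
      by_contra hn
      push Not at hn
      omega
    refine Tri.run rfl (by simp [skip, Cmd.len]) ?_
    simp [Cmd.run, skip, hb, he2]
  · have hb : (r.src.val == p && r.top.val == g) = true := by
      rw [Bool.and_eq_true, beq_iff_eq, beq_iff_eq]
      omega
    have := tri_good hc (hS1.frame f2 rfl) (hR1.frame f2 rfl) hF1 hF hr hT he2
      ((f2.reg 55 rfl).trans h1)
    simpa only [hb, Bool.true_and] using this

end RAM

/-- The machine sets a bit by addition. Writing `x` as a multiple of `2 ^ (i + 1)` plus a remainder
below `2 ^ i`, the three parts have disjoint bits, and each union is a sum. -/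
theorem or_two_pow_of_testBit {x i : ℕ} (h : x.testBit i = false) : x ||| 2 ^ i = x + 2 ^ i := by
  have h1 : x % 2 ^ (i + 1) = x % 2 ^ i := by
    rw [Nat.mod_pow_succ, ← Nat.toNat_testBit, h]; simp
  have hl : x % 2 ^ i < 2 ^ i := Nat.mod_lt _ (by positivity)
  have hx : 2 ^ (i + 1) * (x / 2 ^ (i + 1)) + x % 2 ^ i = x := by
    rw [← h1]; exact Nat.div_add_mod _ _
  have hpp : (2 : ℕ) ^ i < 2 ^ (i + 1) := Nat.pow_lt_pow_right (by norm_num) (by omega)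
  have e1 := Nat.two_pow_add_eq_or_of_lt (hl.trans hpp) (x / 2 ^ (i + 1))
  have e2 := Nat.two_pow_add_eq_or_of_lt hpp (x / 2 ^ (i + 1))
  have e3 := Nat.two_pow_add_eq_or_of_lt hl (2 * (x / 2 ^ (i + 1)) + 1)
  have e4 : 2 ^ i * (2 * (x / 2 ^ (i + 1)) + 1) = 2 ^ (i + 1) * (x / 2 ^ (i + 1)) + 2 ^ i := by
    rw [pow_succ]; ring
  rw [e4, e2] at e3
  generalize 2 ^ (i + 1) * (x / 2 ^ (i + 1)) = a at *
  generalize x % 2 ^ i = b at *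
  rw [← hx, e1, Nat.or_assoc, Nat.or_comm b, ← Nat.or_assoc, ← e3, ← e2, ← e1]
  omega

/-- The size of a list of rules. -/
def rulesSize {P Γ : Type*} (rs : List (Rule P Γ)) : ℕ := (rs.map fun r => 1 + r.word.length).sum

theorem sum_range_getD (l : List ℕ) : ∑ j ∈ Finset.range l.length, l.getD j 0 = l.sum := by
  induction l with
  | nil => simp
  | cons a l ih => rw [List.length_cons, Finset.sum_range_succ']; simpa [add_comm] using ih

namespace RAM

/-! ### One update of the table -/

variable {m n : ℕ} {c : Dim m n} {F1 F : Table} {k : Prm} {s : State} {x y p g T : ℕ} {v e f : Bool}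

def ebitC : Cmd := (.const 53 0 ;; .copy 44 rgNR) ;; forC 44 ruleC

def Dim.ruleTime (c : Dim m n) : ℕ := m * (70 * c.K + 47) + 42 * c.K + 55

theorem tri_ebit (hc : c.Ok) (hS : SEnv c F1 k F s) (hF1 : Small c F1) (hF : Small c F)
    (hT : T < c.TC) (h42 : s.reg 42 = T) (h41 : s.reg 41 = g) (h43 : s.reg 43 = p) :
    Tri ebitC s ((c.ruleTime + 9) * rulesSize c.rs + 3) fun s' => s'.reg 53 =
      (ebit c.rs F1 c.Td k F p g T).toNat := by
  set l := c.rs.map fun r => 1 + r.word.length with hl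
  have hlen : c.rs.length = l.length := by simp [hl]
  -- Every rule has size at least one, so the fixed costs of a rule are absorbed and the sum is
  -- proportional to `rulesSize`.
  have htime : ∑ j ∈ Finset.range c.rs.length, ((c.ruleTime + 7) * l.getD j 0 + 2) ≤
      (c.ruleTime + 9) * rulesSize c.rs := by
    rw [rulesSize, ← sum_range_getD, ← hl, hlen, Finset.mul_sum]
    refine Finset.sum_le_sum fun j hj => ?_
    have : 1 ≤ l.getD j 0 := by
      have hj' : j < l.length := by simpa using hj
      rw [List.getD_eq_getElem _ _ hj']
      simp [hl]
    nlinarith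
  refine Tri.le (t := 2 + (∑ j ∈ Finset.range c.rs.length, ((c.ruleTime + 7) * l.getD j 0 + 2) + 1))
    (by omega) (Tri.bind (Q₁ := fun s' => s'.reg 53 = 0 ∧ s'.reg 44 = c.rs.length)
    (Tri.run rfl (by decide) (by simp [Cmd.run, hS.b.nr])) fun s1 f1 ⟨h1, h2⟩ => ?_)
  have hS1 := hS.frame f1 rfl
  have j41 := (f1.reg 41 rfl).trans h41
  have j42 := (f1.reg 42 rfl).trans h42
  have j43 := (f1.reg 43 rfl).trans h43
  refine (Tri.forC (fun j s => s.reg 53 = ((c.rs.drop j).any fun r =>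
      (r.src.val == p && r.top.val == g) && good c.rs F1 c.Td k F T r).toNat) _ hS1.b.e0.one h2 rfl rfl
      (by decide) (fun _ _ _ h => h) (by simpa using h1) ?_).imp fun s' _ h => by simpa [ebit] using h
  intro j hj s2 f2 h3 h4
  refine (tri_rule hc (hS1.frame f2 rfl) hF1 hF hT ((f2.reg 42 rfl).trans j42)
    ((f2.reg 41 rfl).trans j41) ((f2.reg 43 rfl).trans j43) h3 hj h4).le ?_ |>.imp fun s' _ h => ?_
  · rw [List.getD_eq_getElem _ _ (by simpa [hl] using hj)]
    simp only [hl, List.getElem_map]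
    have : c.ruleTime + 7 * (1 + c.rs[j].word.length) ≤ (c.ruleTime + 7) * (1 + c.rs[j].word.length) := by
      nlinarith [Nat.zero_le (c.ruleTime * c.rs[j].word.length)]
    unfold Dim.ruleTime at *
    omega
  · rw [h, List.drop_eq_getElem_cons hj]
    simp only [List.any_cons]
    rw [Bool.or_comm]

def bitsC : Cmd :=
  (.copy 70 51 ;; .add 71 rgDb 43) ;; testbit ;;
  (.copy 66 72 ;; .copy 70 51 ;; .add 71 rgAb 43) ;; testbit ;;
  (.ite 72 (.sub 67 rgOne rgAp) (.copy 67 rgAp) ;; .copy 70 51 ;; .add 71 rgBb 43) ;; testbit ;;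
  .ite 72 (.sub 68 rgOne rgBp) (.copy 68 rgBp)

theorem tri_bits (hS : SEnv c F1 k F s) (h51 : s.reg 51 = y) (hy : y < 2 ^ c.K) (h43 : s.reg 43 = p) :
    Tri bitsC s (42 * c.K + 20) fun s' => s'.reg 66 = (y.testBit (k.db + p)).toNat ∧
      s'.reg 67 = ((y.testBit (k.ab + p)) ^^ k.ap).toNat ∧
      s'.reg 68 = ((y.testBit (k.bb + p)) ^^ k.bp).toNat := by
  refine Tri.le (t := 2 + ((14 * c.K + 3) + (3 + ((14 * c.K + 3) + (4 + ((14 * c.K + 3) + 2))))))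
    (by omega) (Tri.bind (Q₁ := fun s' => s'.reg 70 = y ∧ s'.reg 71 = k.db + p)
    (Tri.run rfl (by decide) (by simp [Cmd.run, h51, hS.p.db, h43])) fun s1 f1 ⟨h1, h2⟩ => ?_)
  have hS1 := hS.frame f1 rfl
  refine Tri.bind (tri_testbit hS1.b.e0 h1 h2 hy) fun s2 f2 h3 => ?_
  have hS2 := hS1.frame f2 rfl
  have k51 := (f2.reg 51 rfl).trans ((f1.reg 51 rfl).trans h51)
  have k43 := (f2.reg 43 rfl).trans ((f1.reg 43 rfl).trans h43)
  refine Tri.bind (Q₁ := fun s' => s'.reg 66 = (y.testBit (k.db + p)).toNat ∧ s'.reg 70 = y ∧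
    s'.reg 71 = k.ab + p) (Tri.run rfl (by decide) (by simp [Cmd.run, k51, hS2.p.ab, k43, h3]))
    fun s3 f3 ⟨h4, h5, h6⟩ => ?_
  have hS3 := hS2.frame f3 rfl
  refine Tri.bind (tri_testbit hS3.b.e0 h5 h6 hy) fun s4 f4 h7 => ?_
  have hS4 := hS3.frame f4 rfl
  have l51 := (f4.reg 51 rfl).trans ((f3.reg 51 rfl).trans k51)
  have l43 := (f4.reg 43 rfl).trans ((f3.reg 43 rfl).trans k43)
  refine Tri.bind (Q₁ := fun s' => s'.reg 67 = ((y.testBit (k.ab + p)) ^^ k.ap).toNat ∧ s'.reg 70 = y ∧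
    s'.reg 71 = k.bb + p) (Tri.run rfl (by decide) ?_)
    fun s5 f5 ⟨h8, h9, h10⟩ => ?_
  · simp only [Cmd.run, State.reg_setReg, State.reg_ite, h7, hS4.p.ap, hS4.b.e0.one, l51, l43, hS4.p.bb]
    cases y.testBit (k.ab + p) <;> cases k.ap <;> simp
  have hS5 := hS4.frame f5 rfl
  refine Tri.bind (tri_testbit hS5.b.e0 h9 h10 hy) fun s6 f6 h11 => ?_
  have hS6 := hS5.frame f6 rfl
  have i66 := (f6.reg 66 rfl).trans ((f5.reg 66 rfl).trans ((f4.reg 66 rfl).trans h4))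
  have i67 := (f6.reg 67 rfl).trans h8
  refine Tri.run rfl (by decide) ?_
  simp only [Cmd.run, State.reg_setReg, State.reg_ite, h11, hS6.p.bp, hS6.b.e0.one, i66, i67]
  cases y.testBit (k.bb + p) <;> cases k.bp <;> simp

def combC : Cmd :=
  .ite rgGrp (.sub 63 rgGrp rgOne ;; .ite 63 (.sub 63 63 rgOne ;; .ite 63
    (.add 63 rgLb 43 ;; .load 69 arLab 63)
    (.const 69 0 ;; .ite 66 (.const 69 1) skip ;; .ite 68 (.const 69 1) skip ;;
      .ite 67 (.ite 53 skip (.const 69 1)) skip))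
    (.const 69 0 ;; .ite 66 skip (.copy 69 68) ;; .ite 67 (.ite 53 (.const 69 1) skip) skip))
    (.ite 67 (.const 69 1) (.copy 69 68))

theorem tri_comb (hS : SEnv c F1 k F s) (h43 : s.reg 43 = p) (hp : p < m) (h53 : s.reg 53 = e.toNat)
    (h66 : s.reg 66 = (y.testBit (k.db + p)).toNat)
    (h67 : s.reg 67 = ((y.testBit (k.ab + p)) ^^ k.ap).toNat)
    (h68 : s.reg 68 = ((y.testBit (k.bb + p)) ^^ k.bp).toNat) :
    Tri combC s 15 fun s' => s'.reg 69 = (comb k y p e).toNat := by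
  refine Tri.run rfl (by decide) ?_
  have h1 := hS.b.e0.one
  have hgrp := hS.p.grp
  have hl := hS.p.lab
  simp only [comb]
  generalize y.testBit (k.db + p) = d at *
  generalize ((y.testBit (k.ab + p)) ^^ k.ap) = a at *
  generalize ((y.testBit (k.bb + p)) ^^ k.bp) = b at *
  split
  · rename_i hg
    cases a <;> simp [combC, Cmd.run, hgrp, hg, h67, h68]
  · rename_i hg
    cases a <;> cases b <;> cases d <;> cases e <;>
      simp [combC, Cmd.run, skip, hgrp, hg, h1, h53, h66, h67, h68]
  · rename_i hg
    cases a <;> cases b <;> cases d <;> cases e <;>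
      simp [combC, Cmd.run, skip, hgrp, hg, h1, h53, h66, h67, h68]
  · rename_i hg0 hg1 hg2
    replace hg0 : k.grp ≠ 0 := hg0
    replace hg1 : k.grp ≠ 1 := hg1
    replace hg2 : k.grp ≠ 2 := hg2
    have e1 : ¬ k.grp - 1 = 0 := by omega
    have e2 : ¬ k.grp - 1 - 1 = 0 := by omega
    simp [combC, Cmd.run, hgrp, hg0, h1, e1, e2, h43, hl (by omega) p hp]

/-- Evaluate the bit of the location in register `43`. -/
def locC : Cmd :=
  ebitC ;; bitsC ;; combC ;; .ite 69 ((.copy 70 52 ;; .add 71 rgSb 43) ;; testbit ;;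
    .ite 72 skip (.load 63 arPow 71 ;; .add 52 52 63)) skip

def Dim.locTime (c : Dim m n) : ℕ := (c.ruleTime + 9) * rulesSize c.rs + 56 * c.K + 50

theorem tri_loc {acc : ℕ} (hc : c.Ok) (hS : SEnv c F1 k F s) (hF1 : Small c F1) (hF : Small c F)
    (hk : k.sb + m ≤ c.K) (hg : g ≤ c.nG) (hT : T < c.TC) (h42 : s.reg 42 = T) (h41 : s.reg 41 = g)
    (h43 : s.reg 43 = p) (hp : p < m)
    (h51 : s.reg 51 = F g T) (h52 : s.reg 52 = acc) (hacc : acc < 2 ^ c.K) :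
    Tri locC s c.locTime fun s' => s'.reg 52 =
      if newb c.rs F1 c.Td k F p g T then acc ||| 2 ^ (k.sb + p) else acc := by
  refine Tri.le (t := ((c.ruleTime + 9) * rulesSize c.rs + 3) + ((42 * c.K + 20) +
    (15 + ((2 + ((14 * c.K + 3) + 3)) + 1)))) (by unfold Dim.locTime; omega)
    (Tri.bind (tri_ebit hc hS hF1 hF hT h42 h41 h43) fun s1 f1 h1 => ?_)
  have hS1 := hS.frame f1 rfl
  have i43 := (f1.reg 43 rfl).trans h43
  refine Tri.bind (tri_bits hS1 ((f1.reg 51 rfl).trans h51) (hF g hg T hT) i43)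
    fun s2 f2 ⟨h2, h3, h4⟩ => ?_
  have hS2 := hS1.frame f2 rfl
  have j43 := (f2.reg 43 rfl).trans i43
  refine Tri.bind (tri_comb hS2 j43 hp ((f2.reg 53 rfl).trans h1) h2 h3 h4) fun s3 f3 h5 => ?_
  have hS3 := hS2.frame f3 rfl
  have k43 := (f3.reg 43 rfl).trans j43
  have k52 := (f3.reg 52 rfl).trans ((f2.reg 52 rfl).trans ((f1.reg 52 rfl).trans h52))
  rw [← newb] at h5
  refine Tri.ite (fun h => ?_) fun h => ?_
  · have hb : newb c.rs F1 c.Td k F p g T = true := by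
      by_contra hn; exact h (by rw [h5]; simp [hn])
    refine Tri.bind (Q₁ := fun s' => s'.reg 70 = acc ∧ s'.reg 71 = k.sb + p)
      (Tri.run rfl (by decide) (by simp [Cmd.run, k52, hS3.p.sb, k43])) fun s4 f4 ⟨h6, h7⟩ => ?_
    have hS4 := hS3.frame f4 rfl
    refine Tri.bind (tri_testbit hS4.b.e0 h6 h7 hacc) fun s5 f5 h8 => ?_
    have hS5 := hS4.frame f5 rfl
    have l52 := (f5.reg 52 rfl).trans ((f4.reg 52 rfl).trans k52)
    have l71 := (f5.reg 71 rfl).trans h7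
    refine Tri.run rfl (by decide) ?_
    simp only [Cmd.run, skip, State.reg_setReg, State.arr_setReg, State.reg_ite, h8, l52, l71,
      Nat.reduceEqDiff, if_true, if_false, hS5.b.e0.pow _ (show k.sb + p < c.K by omega), hb]
    -- The power is added only if the bit is still off; otherwise the addition would carry.
    cases hbit : acc.testBit (k.sb + p) with
    | false => simp [or_two_pow_of_testBit hbit]
    | true =>
      simp only [Bool.toNat_true, one_ne_zero, if_false]
      refine Nat.eq_of_testBit_eq fun i => ?_
      rw [Nat.testBit_or, Nat.testBit_two_pow]
      by_cases hi : k.sb + p = i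
      · subst hi; simp [hbit]
      · simp [hi]
  · have hb : newb c.rs F1 c.Td k F p g T = false := by rw [h5] at h; simpa using h
    refine Tri.run rfl (by show 1 ≤ _; omega) ?_
    simp [Cmd.run, skip, hb, k52]

/-- Compute the new entry for the type in register `42`. -/
def cellC : Cmd :=
  (.add 63 50 42 ;; .load 51 arF 63 ;; .copy 52 51 ;; .copy 43 rgM) ;; forC 43 locC ;;
  (.add 63 50 42 ;; .store arG 63 52)

theorem tri_cell (hc : c.Ok) (hS : SEnv c F1 k F s) (hF1 : Small c F1) (hF : Small c F)
    (hk : k.sb + m ≤ c.K) (hg : g ≤ c.nG) (hT : T < c.TC) (h42 : s.reg 42 = T) (h41 : s.reg 41 = g)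
    (h50 : s.reg 50 = g * c.TC) :
    Tri cellC s (m * (c.locTime + 2) + 7) fun s' => ∀ i, s'.arr arG i =
      if i = g * c.TC + T then upd m c.nG c.TC k.sb (newb c.rs F1 c.Td k) F g T else s.arr arG i := by
  refine Tri.le (t := 4 + ((m * (c.locTime + 2) + 1) + 2)) (by omega) (Tri.bind (Q₁ := fun s' =>
    s'.reg 51 = F g T ∧ s'.reg 52 = F g T ∧ s'.reg 43 = m)
    (Tri.run rfl (by decide) ?_) fun s1 f1 ⟨h1, h2, h3⟩ => ?_)
  · simp [Cmd.run, h50, h42, hS.f g hg T hT, hS.b.pm]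
  have hS1 := hS.frame f1 rfl
  have j41 := (f1.reg 41 rfl).trans h41
  have j42 := (f1.reg 42 rfl).trans h42
  have j50 := (f1.reg 50 rfl).trans h50
  refine Tri.bind (Tri.forC' (fun j s => s.reg 52 = orB k.sb (fun p => newb c.rs F1 c.Td k F p g T)
    (F g T) ((List.range m).drop j)) _ hS1.b.e0.one h3 rfl rfl (by decide) (fun _ _ _ h => h)
    (by rw [drop_range_self]; exact h2) ?_) fun s2 f2 h4 => ?_
  · intro j hj s2 f2 h4 h5
    refine (tri_loc hc (hS1.frame f2 rfl) hF1 hF hk hg hT ((f2.reg 42 rfl).trans j42)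
      ((f2.reg 41 rfl).trans j41) h4 hj ((f2.reg 51 rfl).trans h1) h5
      (orB_lt (hF g hg T hT) hk fun p hp => ?_)).imp fun s' _ h => ?_
    · simpa using List.mem_of_mem_drop hp
    · rw [h, drop_range hj]; rfl
  · refine Tri.run rfl (by decide) ?_
    have l42 := (f2.reg 42 rfl).trans j42
    have l50 := (f2.reg 50 rfl).trans j50
    have larr : s2.arr arG = s.arr arG := (f2.arr _ rfl).trans (f1.arr _ rfl)
    rw [List.drop_zero] at h4
    intro i
    simp [Cmd.run, State.arr_setArr, l42, l50, h4, larr, upd, hg, hT]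

variable {m n : ℕ} {c : Dim m n} {F1 F : Table} {k : Prm} {s : State} {g T : ℕ}

theorem cell_inj {C g g' T T' : ℕ} (hT : T < C) (hT' : T' < C) :
    g * C + T = g' * C + T' ↔ g = g' ∧ T = T' := by
  constructor
  · intro h
    have h1 : (g * C + T) / C = g := by
      rw [mul_comm, Nat.mul_add_div (by omega), Nat.div_eq_of_lt hT, add_zero]
    have h2 : (g' * C + T') / C = g' := by
      rw [mul_comm, Nat.mul_add_div (by omega), Nat.div_eq_of_lt hT', add_zero]
    have : g = g' := by rw [← h1, h, h2]
    subst this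
    exact ⟨rfl, by omega⟩
  · rintro ⟨rfl, rfl⟩; rfl

theorem cell_lt {C G g T : ℕ} (hg : g ≤ G) (hT : T < C) : g * C + T < (G + 1) * C := by
  nlinarith [Nat.mul_le_mul_right C hg]

def Dim.cells (c : Dim m n) : ℕ := (c.nG + 1) * c.TC

/-- Compute the row in register `41`. -/
def rowC : Cmd := (.load 50 arRow 41 ;; .copy 42 rgTC) ;; forC 42 cellC

def Dim.cellTime (c : Dim m n) : ℕ := m * (c.locTime + 2) + 7

theorem tri_row (hc : c.Ok) (hS : SEnv c F1 k F s) (hF1 : Small c F1) (hF : Small c F)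
    (hk : k.sb + m ≤ c.K) (hg : g ≤ c.nG) (h41 : s.reg 41 = g) :
    Tri rowC s (c.TC * (c.cellTime + 2) + 3) fun s' =>
      (∀ T < c.TC, s'.arr arG (g * c.TC + T) = upd m c.nG c.TC k.sb (newb c.rs F1 c.Td k) F g T) ∧
      ∀ i, (∀ T < c.TC, i ≠ g * c.TC + T) → s'.arr arG i = s.arr arG i := by
  refine Tri.le (t := 2 + (c.TC * (c.cellTime + 2) + 1)) (by omega) (Tri.bind (Q₁ := fun s' =>
    s'.reg 50 = g * c.TC ∧ s'.reg 42 = c.TC) (Tri.run rfl (by decide) ?_) fun s1 f1 ⟨h1, h2⟩ => ?_)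
  · simp [Cmd.run, h41, hS.b.row g (by omega), hS.b.tc]
  have hS1 := hS.frame f1 rfl
  have j41 := (f1.reg 41 rfl).trans h41
  have hG : s1.arr arG = s.arr arG := f1.arr _ rfl
  refine (Tri.forC' (fun j s' => (∀ T < c.TC, j ≤ T → s'.arr arG (g * c.TC + T) =
      upd m c.nG c.TC k.sb (newb c.rs F1 c.Td k) F g T) ∧
      ∀ i, (∀ T < c.TC, i ≠ g * c.TC + T) → s'.arr arG i = s.arr arG i) _ hS1.b.e0.one h2 rfl rfl
      (by decide) (fun _ _ _ h => h) ⟨fun T hT hT' => by omega, fun i _ => by rw [hG]⟩ ?_).imp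
      fun s' _ h => ⟨fun T hT => h.1 T hT (Nat.zero_le _), h.2⟩
  intro j hj s2 f2 h3 ⟨h4, h5⟩
  refine (tri_cell hc (hS1.frame f2 rfl) hF1 hF hk hg hj h3 ((f2.reg 41 rfl).trans j41)
    ((f2.reg 50 rfl).trans h1)).imp fun s' _ h => ⟨fun T hT hT' => ?_, fun i hi => ?_⟩
  · rw [h]
    split_ifs with he
    · rw [((cell_inj hT hj).1 he).2]
    · exact h4 T hT (Nat.lt_of_le_of_ne hT' fun e => he (by rw [e]))
  · rw [h, if_neg (hi j hj), h5 i hi]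

/-- The new entries go to a second array and are copied back only when all rows are finished,
because `upd` is a simultaneous update that reads the old table. -/
def roundC : Cmd :=
  .add 41 rgG rgOne ;; forC 41 rowC ;; (.add 41 rgG rgOne ;; .load 42 arRow 41) ;;
  forC 42 (.load 63 arG 42 ;; .store arF 42 63)

def Dim.roundTime (c : Dim m n) : ℕ := (c.nG + 1) * (c.TC * (c.cellTime + 2) + 5) + c.cells * 4 + 5

theorem tri_round (hc : c.Ok) (hS : SEnv c F1 k F s) (hF1 : Small c F1) (hF : Small c F)
    (hk : k.sb + m ≤ c.K) :
    Tri roundC s c.roundTime (SEnv c F1 k (upd m c.nG c.TC k.sb (newb c.rs F1 c.Td k) F)) := by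
  set F' := upd m c.nG c.TC k.sb (newb c.rs F1 c.Td k) F with hF'
  refine Tri.le (t := 1 + (((c.nG + 1) * (c.TC * (c.cellTime + 2) + 5) + 1) + (2 +
    (c.cells * 4 + 1)))) (by unfold Dim.roundTime; omega) (Tri.bind (Q₁ := fun s' =>
    s'.reg 41 = c.nG + 1) (Tri.run rfl (by decide) ?_) fun s1 f1 h1 => ?_)
  · simp [Cmd.run, hS.b.g, hS.b.e0.one]
  have hS1 := hS.frame f1 rfl
  refine Tri.bind (Tri.forC' (fun j s' => ∀ g ≤ c.nG, j ≤ g → ∀ T < c.TC,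
    s'.arr arG (g * c.TC + T) = F' g T) _ hS1.b.e0.one h1 rfl rfl
    (by decide) (fun _ _ _ h => h) (fun g hg hg' => by omega) ?_) fun s2 f2 h2 => ?_
  · intro j hj s2 f2 h3 h4
    refine (tri_row hc (hS1.frame f2 rfl) hF1 hF hk (by omega) h3).imp fun s' _ h g hg hg' T hT => ?_
    rcases Nat.lt_or_eq_of_le hg' with hlt | rfl
    · rw [h.2 _ fun T' hT' he => ?_]
      · exact h4 g hg hlt T hT
      · have := ((cell_inj hT hT').1 he).1
        omega
    · exact h.1 T hT
  have hS2 := hS1.frame f2 rfl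
  refine Tri.bind (Q₁ := fun s' => s'.reg 42 = c.cells) (Tri.run rfl (by decide) ?_) fun s3 f3 h3 => ?_
  · simp [Cmd.run, hS2.b.g, hS2.b.e0.one, hS2.b.row, Dim.cells]
  have hS3 := hS2.frame f3 rfl
  have hG3 : s3.arr arG = s2.arr arG := f3.arr _ rfl
  refine (Tri.forC' (fun j s' => ∀ i < c.cells, j ≤ i → s'.arr arF i = s3.arr arG i) 2
    hS3.b.e0.one h3 rfl rfl (by decide) (fun _ _ _ h => h) (fun i hi hi' => by omega) ?_).imp ?_
  · intro j hj s4 f4 h5 h6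
    refine Tri.run rfl (by decide) fun i hi hi' => ?_
    have hG4 : s4.arr arG = s3.arr arG := f4.arr _ rfl
    simp only [Cmd.run, State.arr_setArr, State.reg_setReg, State.arr_setReg, h5, hG4,
      Nat.reduceEqDiff, if_true, if_false, true_and]
    split_ifs with he
    · rw [he]
    · exact h6 i hi (by omega)
  · intro s' f' h
    refine ⟨hS3.b.frame f' rfl, hS3.p.frame f' rfl, ?_, fun g hg T hT => ?_⟩
    · rw [TabAt, f'.arr _ rfl]; exact hS3.f1
    · rw [h _ (cell_lt hg hT) (Nat.zero_le _), hG3]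
      exact h2 g hg (Nat.zero_le _) T hT

/-- Update the table until it is stable. -/
def stageC : Cmd := .copy 40 rgRC ;; forC 40 roundC

def Dim.stageTime (c : Dim m n) : ℕ := m * c.cells * (c.roundTime + 2) + 2

theorem Small.iterate (hF : Small c F) (hk : k.sb + m ≤ c.K) (i : ℕ) :
    Small c ((upd m c.nG c.TC k.sb (newb c.rs F1 c.Td k))^[i] F) := fun g hg T hT =>
  iterate_lt (hF g hg T hT) hk i

theorem tri_stage (hc : c.Ok) (hS : SEnv c F1 k F s) (hF1 : Small c F1) (hF : Small c F)
    (hk : k.sb + m ≤ c.K) :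
    Tri stageC s c.stageTime (SEnv c F1 k
      ((upd m c.nG c.TC k.sb (newb c.rs F1 c.Td k))^[m * ((c.nG + 1) * c.TC)] F)) := by
  refine Tri.le (t := 1 + (m * c.cells * (c.roundTime + 2) + 1)) (by unfold Dim.stageTime; omega)
    (Tri.bind (Q₁ := fun s' => s'.reg 40 = m * c.cells ∧ SEnv c F1 k F s') ?_ fun s1 f1 ⟨h1, hS1⟩ => ?_)
  · refine (Tri.run (Q := fun s' => s'.reg 40 = m * c.cells) rfl le_rfl ?_).imp
      fun s' f h => ⟨h, hS.frame f rfl⟩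
    simp [Cmd.run, hS.b.rc, Dim.cells]
  -- The counter `j` gives the rounds that are left, whereas the table depends on the number `i` of
  -- rounds done.
  refine (Tri.forC' (fun j s' => j ≤ m * c.cells → ∃ i, i + j = m * c.cells ∧
    SEnv c F1 k ((upd m c.nG c.TC k.sb (newb c.rs F1 c.Td k))^[i] F) s') _
    hS1.b.e0.one h1 rfl rfl (by decide) ?_ ?_ ?_).imp ?_
  · intro j s v h hj
    obtain ⟨i, hi, hS⟩ := h hj
    exact ⟨i, hi, hS.frame (Frame.setReg (.const 40 0) s 40 v rfl) rfl⟩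
  · exact fun _ => ⟨0, by omega, hS1⟩
  · intro j hj s2 f2 h2 h3
    obtain ⟨i, hi, hS2⟩ := h3 hj
    refine (tri_round hc hS2 hF1 (hF.iterate hk i) hk).imp fun s' _ h _ => ⟨i + 1, by omega, ?_⟩
    rwa [Function.iterate_succ_apply']
  · intro s' _ h
    obtain ⟨i, hi, hS'⟩ := h (Nat.zero_le _)
    obtain rfl : i = m * ((c.nG + 1) * c.TC) := hi
    exact hS'

end RAM

/-! ### Reading the input and preparing the arrays -/

/-- The part of the encoding of a formula that belongs to its root. -/
def Formula.hd {k : ℕ} : Formula (Fin k) → List ℕ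
  | .tt => [0]
  | .ff => [1]
  | .atom e => [2, e]
  | .natom e => [3, e]
  | .or _ _ => [4]
  | .and _ _ => [5]
  | .EX b _ => [6 + b.num]
  | .AX b _ => [8 + b.num]
  | .EU b _ _ => [10 + b.num]
  | .AU b _ _ => [12 + b.num]
  | .ER b _ _ => [14 + b.num]
  | .AR b _ _ => [16 + b.num]

theorem encFormula_eq {k : ℕ} (φ : Formula (Fin k)) :
    encFormula φ = φ.hd ++ φ.kids.flatMap encFormula := by
  cases φ with
  | EX b | AX b | EU b | AU b | ER b | AR b =>
    cases b <;> simp [encFormula, Formula.hd, Formula.kids, Mode.num]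
  | _ => simp [encFormula, Formula.hd, Formula.kids]

namespace RAM

/-- The word `l` is written in the array `A` from position `p` on. -/
def At (A : ℕ → ℕ) (p : ℕ) (l : List ℕ) : Prop := ∀ (i : ℕ) (h : i < l.length), A (p + i) = l[i]

theorem At.left {A : ℕ → ℕ} {p : ℕ} {l l' : List ℕ} (h : At A p (l ++ l')) : At A p l :=
  fun i hi => by rw [h i (by simp; omega), List.getElem_append_left hi]

theorem At.right {A : ℕ → ℕ} {p : ℕ} {l l' : List ℕ} (h : At A p (l ++ l')) : At A (p + l.length) l' :=
  fun i hi => by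
    rw [add_assoc, h (l.length + i) (by simp; omega), List.getElem_append_right (by omega)]
    simp

theorem At.head {A : ℕ → ℕ} {p a : ℕ} {l : List ℕ} (h : At A p (a :: l)) : A p = a :=
  h 0 (Nat.succ_pos _)

theorem At.getD (l : List ℕ) : At (fun i => l.getD i 0) 0 l := fun i hi => by
  simp [hi]

theorem Tri.loopStop {c s r} {Q : State → Prop} (h : s.reg r = 0) (hQ : Q s) : Tri (.loop r c) s 1 Q :=
  ⟨s, 1, .loopStop h, le_rfl, hQ⟩

theorem Tri.loopStep {c s r t₁ t₂} {Q₁ Q : State → Prop} (hr : s.reg r ≠ 0) (h : Tri c s t₁ Q₁)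
    (h' : ∀ s', Frame c s s' → Q₁ s' → Tri (.loop r c) s' t₂ Q) :
    Tri (.loop r c) s (t₁ + t₂ + 1) Q :=
  let ⟨s', _, h1, h2, h3⟩ := h
  let ⟨s'', _, h4, h5, h6⟩ := h' s' h1.frame h3
  ⟨s'', _, .loopStep hr h1 h4, by omega, h6⟩

variable {m n : ℕ} {s : State}

/-! ### Filling arrays -/

/-- Fill the first cells of the array `a`, as many as register `46` says, with the multiples of
register `r`. -/
def fillC (a r : ℕ) : Cmd :=
  (.const 64 0 ;; .const 65 0) ;;
  forC 46 (.store a 64 65 ;; .add 64 64 rgOne ;; .add 65 65 r)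

theorem tri_fill {a r x v : ℕ} (h1 : s.reg rgOne = 1) (hx : s.reg 46 = x) (hv : s.reg r = v)
    (hr : (fillC a r).wr r = false) :
    Tri (fillC a r) s (x * 5 + 3) fun s' => ∀ i < x, s'.arr a i = i * v := by
  refine Tri.le (t := 2 + (x * (3 + 2) + 1)) (by omega) (Tri.bind (Q₁ := fun s' =>
    s'.reg 64 = 0 ∧ s'.reg 65 = 0) (Tri.run rfl le_rfl (by simp [Cmd.run]))
    fun s1 f1 ⟨h3, h4⟩ => ?_)
  have hw : (forC 46 (.store a 64 65 ;; .add 64 64 rgOne ;; .add 65 65 r)).wr r = false := by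
    simp only [fillC, Cmd.wr, Bool.or_eq_false_iff] at hr ⊢
    exact hr.2
  have hw1 : ((.const 64 0 ;; .const 65 0) : Cmd).wr r = false := by
    simp only [fillC, Cmd.wr, Bool.or_eq_false_iff] at hr ⊢
    exact hr.1
  refine (Tri.forC' (fun j s' => j ≤ x → ∃ i, i + j = x ∧ s'.reg 64 = i ∧ s'.reg 65 = i * v ∧
    ∀ i' < i, s'.arr a i' = i' * v) _ ((f1.reg _ rfl).trans h1) ((f1.reg _ rfl).trans hx) rfl rfl
    (by decide) (fun _ _ _ h => h) ?_ ?_).imp ?_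
  · exact fun _ => ⟨0, by omega, h3, by simpa using h4, fun _ h => absurd h (by omega)⟩
  · intro j hj s2 f2 h5 h6
    obtain ⟨i, e1, e2, e3, e4⟩ := h6 hj
    have hv2 : s2.reg r = v := (f2.reg _ hw).trans ((f1.reg _ hw1).trans hv)
    have ho : s2.reg rgOne = 1 := (f2.reg _ rfl).trans ((f1.reg _ rfl).trans h1)
    have hr65 : r ≠ 64 := by
      rintro rfl
      revert hw1
      simp [Cmd.wr]
    refine Tri.run rfl le_rfl fun _ => ⟨i + 1, by omega, ?_, ?_, fun i' hi' => ?_⟩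
    · simp [Cmd.run, e2, ho]
    · simp [Cmd.run, e3, hv2, hr65, Nat.succ_mul]
    · simp only [Cmd.run, State.arr_setReg, State.arr_setArr, e2, e3, true_and]
      split_ifs with he
      · rw [he]
      · exact e4 i' (by omega)
  · intro s' _ h
    obtain ⟨i, e1, -, -, e4⟩ := h (Nat.zero_le _)
    rwa [← e1, add_zero]

/-- Fill the array of powers of two; register `65` gets the next power. -/
def powC : Cmd :=
  (.const 64 0 ;; .const 65 1 ;; .copy 46 rgK) ;;
  forC 46 (.store arPow 64 65 ;; .add 64 64 rgOne ;; .add 65 65 65)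

theorem tri_pow {K : ℕ} (h1 : s.reg rgOne = 1) (hK : s.reg rgK = K) :
    Tri powC s (K * 5 + 4) fun s' => Env0 s' K ∧ s'.reg 65 = 2 ^ K := by
  refine Tri.le (t := 3 + (K * (3 + 2) + 1)) (by omega) (Tri.bind (Q₁ := fun s' =>
    s'.reg 64 = 0 ∧ s'.reg 65 = 1 ∧ s'.reg 46 = K) (Tri.run rfl le_rfl (by simp [Cmd.run, hK]))
    fun s1 f1 ⟨h3, h4, h5⟩ => ?_)
  have ho := (f1.reg _ rfl).trans h1
  refine (Tri.forC' (fun j s' => j ≤ K → ∃ i, i + j = K ∧ s'.reg 64 = i ∧ s'.reg 65 = 2 ^ i ∧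
    ∀ i' < i, s'.arr arPow i' = 2 ^ i') _ ho h5 rfl rfl
    (by decide) (fun _ _ _ h => h) ?_ ?_).imp ?_
  · exact fun _ => ⟨0, by omega, h3, by simpa using h4, fun _ h => absurd h (by omega)⟩
  · intro j hj s2 f2 h5 h6
    obtain ⟨i, e1, e2, e3, e4⟩ := h6 hj
    have ho2 := (f2.reg _ rfl).trans ho
    refine Tri.run rfl le_rfl fun _ => ⟨i + 1, by omega, ?_, ?_, fun i' hi' => ?_⟩
    · simp [Cmd.run, e2, ho2]
    · simp [Cmd.run, e3, pow_succ, mul_two]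
    · simp only [Cmd.run, State.arr_setReg, State.arr_setArr, e2, e3, true_and]
      split_ifs with he
      · rw [he]
      · exact e4 i' (by omega)
  · intro s' f' h
    obtain ⟨i, e1, -, e3, e4⟩ := h (Nat.zero_le _)
    rw [add_zero] at e1
    rw [← e1]
    exact ⟨⟨(f'.reg _ rfl).trans ho, e1 ▸ (f'.reg _ rfl).trans ((f1.reg _ rfl).trans hK), e4⟩, e3⟩

/-! ### Parsing the formula -/

/-- Register `12` is the reading position and register `13` the number of subformulas still to be
read. A binary node (codes `4`, `5` and from `10` on) raises this number by one, a unary node (`6`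
to `9`) keeps it, a leaf lowers it, and the literals `2`, `3` also skip their proposition. -/
def parseBody : Cmd :=
  (.store arPos rgN 12 ;; .add rgN rgN rgOne ;; .load 63 arFml 12 ;; .add 12 12 rgOne) ;;
  .const 64 9 ;; .sub 65 63 64 ;; .ite 65 (.add 13 13 rgOne)
    (.const 64 5 ;; .sub 65 63 64 ;; .ite 65 skip
      (.const 64 3 ;; .sub 65 63 64 ;; .ite 65 (.add 13 13 rgOne)
        (.const 64 1 ;; .sub 65 63 64 ;; .ite 65 (.add 12 12 rgOne ;; .sub 13 13 rgOne)
          (.sub 13 13 rgOne))))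

theorem tri_parseBody {k : ℕ} {φ : Formula (Fin k)} {q p N : ℕ} (h1 : s.reg rgOne = 1)
    (h12 : s.reg 12 = p) (h13 : s.reg 13 = q + 1) (hN : s.reg rgN = N) (hA : At (s.arr arFml) p φ.hd) :
    Tri parseBody s 18 fun s' => s'.reg 12 = p + φ.hd.length ∧ s'.reg 13 = q + φ.kids.length ∧
      s'.reg rgN = N + 1 ∧ ∀ i, s'.arr arPos i = if i = N then p else s.arr arPos i := by
  have h0 : s.arr arFml p = φ.hd.headD 0 := by
    have : φ.hd ≠ [] := by cases φ <;> simp [Formula.hd]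
    obtain ⟨a, l, hl⟩ := List.exists_cons_of_ne_nil this
    rw [hl] at hA ⊢
    exact hA.head
  refine Tri.bind (t₁ := 4) (t₂ := 14) (Q₁ := fun s' => s'.reg 63 = φ.hd.headD 0 ∧ s'.reg 12 = p + 1 ∧
    s'.reg rgN = N + 1 ∧ ∀ i, s'.arr arPos i = if i = N then p else s.arr arPos i)
    (Tri.run rfl le_rfl ?_) fun s1 f1 ⟨e1, e2, e3, e4⟩ => ?_
  · simp [Cmd.run, hN, h12, h1, State.arr_setArr, h0]
  have ho := (f1.reg _ rfl).trans h1
  have j13 := (f1.reg 13 rfl).trans h13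
  have fin : ∀ d : Cmd, d.flat = true → d.len ≤ 14 → d.wa arPos = false →
      ((d.run s1).reg 12 = p + φ.hd.length ∧ (d.run s1).reg 13 = q + φ.kids.length ∧
        (d.run s1).reg rgN = N + 1) → Tri d s1 14 (fun s' => s'.reg 12 = p + φ.hd.length ∧
        s'.reg 13 = q + φ.kids.length ∧ s'.reg rgN = N + 1 ∧
        ∀ i, s'.arr arPos i = if i = N then p else s.arr arPos i) := fun d hd hl ha h =>
    (Tri.run (Q := fun s' => s'.reg 12 = p + φ.hd.length ∧ s'.reg 13 = q + φ.kids.length ∧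
        s'.reg rgN = N + 1) hd hl h).imp fun s' f' h' =>
      ⟨h'.1, h'.2.1, h'.2.2, fun i => by rw [f'.arr _ ha, e4]⟩
  refine fin _ rfl (by decide) rfl ?_
  clear fin e4 hA h0
  cases φ with
  | EX b | AX b | EU b | AU b | ER b | AR b =>
    cases b <;> simp [Cmd.run, skip, e1, e2, e3, j13, ho, Formula.hd, Formula.kids, Mode.num]
  | _ => simp [Cmd.run, skip, e1, e2, e3, j13, ho, Formula.hd, Formula.kids]

/-- The loop is described for a list of pending formulas: one pass replaces the first formula by its
children and removes one node. The bound `M` on the remaining nodes serves for the induction. -/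
theorem tri_parseList {k : ℕ} (M : ℕ) : ∀ (l : List (Formula (Fin k))) (s : State) (p N : ℕ),
    (l.flatMap Formula.nodes).length ≤ M → s.reg rgOne = 1 → s.reg 12 = p → s.reg 13 = l.length →
    s.reg rgN = N → At (s.arr arFml) p (l.flatMap encFormula) →
    Tri (.loop 13 parseBody) s (19 * (l.flatMap Formula.nodes).length + 1) fun s' =>
      s'.reg rgN = N + (l.flatMap Formula.nodes).length ∧
      (∀ i ψ, (l.flatMap Formula.nodes)[i]? = some ψ →
        At (s.arr arFml) (s'.arr arPos (N + i)) ψ.hd) ∧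
      ∀ i < N, s'.arr arPos i = s.arr arPos i := by
  induction M with
  | zero =>
    intro l s p N hl h1 h12 h13 hN hA
    cases l with
    | nil => exact Tri.loopStop h13 ⟨hN, by simp, fun _ _ => rfl⟩
    | cons φ l =>
      have := φ.size_pos
      simp [Formula.length_nodes] at hl
      omega
  | succ M ih =>
    intro l s p N hl h1 h12 h13 hN hA
    cases l with
    | nil => exact Tri.loopStop h13 ⟨hN, by simp, fun _ _ => rfl⟩
    | cons φ l =>
      have hn : (φ :: l).flatMap Formula.nodes = φ :: (φ.kids ++ l).flatMap Formula.nodes := by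
        rw [List.flatMap_cons, φ.nodes_eq, List.flatMap_append, List.cons_append]
      have he : (φ :: l).flatMap encFormula = φ.hd ++ (φ.kids ++ l).flatMap encFormula := by
        rw [List.flatMap_cons, encFormula_eq, List.flatMap_append, List.append_assoc]
      rw [hn] at hl ⊢
      rw [he] at hA
      have hb := tri_parseBody (φ := φ) h1 h12 (by simpa using h13) hN hA.left
      refine (Tri.loopStep (by rw [h13]; simp) hb
        (t₂ := 19 * ((φ.kids ++ l).flatMap Formula.nodes).length + 1)
        fun s1 f1 ⟨e1, e2, e3, e4⟩ => ?_).le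
        (by rw [List.length_cons]; omega)
      have hF : s1.arr arFml = s.arr arFml := f1.arr _ rfl
      refine (ih (φ.kids ++ l) s1 _ _ (by simpa using hl) ((f1.reg _ rfl).trans h1) e1
        (by rw [e2, List.length_append]; omega) e3 (by rw [hF]; exact hA.right)).imp
        fun s' _ ⟨g1, g2, g3⟩ => ⟨by rw [g1, List.length_cons]; omega, ?_, fun i hi => ?_⟩
      · intro i ψ hi
        cases i with
        | zero =>
          obtain rfl : φ = ψ := by simpa using hi
          rw [add_zero, g3 N (by omega), e4, if_pos rfl]
          exact hA.left
        | succ i =>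
          have := g2 i ψ (by simpa using hi)
          rwa [hF, show N + 1 + i = N + (i + 1) by omega] at this
      · rw [g3 i (by omega), e4, if_neg (by omega)]

def parseC : Cmd := (.const 12 0 ;; .const 13 1 ;; .const rgN 0) ;; .loop 13 parseBody

theorem tri_parse {k : ℕ} {φ : Formula (Fin k)} (h1 : s.reg rgOne = 1)
    (hA : At (s.arr arFml) 0 (encFormula φ)) :
    Tri parseC s (19 * φ.size + 4) fun s' => s'.reg rgN = φ.size ∧
      ∀ i ψ, φ.nodes[i]? = some ψ → At (s'.arr arFml) (s'.arr arPos i) ψ.hd := by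
  refine Tri.le (t := 3 + (19 * φ.size + 1)) (by omega) (Tri.bind (Q₁ := fun s' =>
    s'.reg 12 = 0 ∧ s'.reg 13 = 1 ∧ s'.reg rgN = 0) (Tri.run rfl le_rfl (by simp [Cmd.run]))
    fun s1 f1 ⟨e1, e2, e3⟩ => ?_)
  have hF : s1.arr arFml = s.arr arFml := f1.arr _ rfl
  have := tri_parseList _ [φ] s1 0 0 le_rfl ((f1.reg _ rfl).trans h1) e1 e2 e3
    (by simpa [hF] using hA)
  simp only [List.flatMap_cons, List.flatMap_nil, List.append_nil, φ.length_nodes] at this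
  refine this.imp fun s' f' ⟨g1, g2, _⟩ => ⟨by omega, fun i ψ hi => ?_⟩
  have := g2 i ψ hi
  rwa [zero_add, ← f'.arr arFml rfl] at this

variable {m n k : ℕ} {s : State}

/-! ### Reading the rules -/

def rulesBody : Cmd :=
  (.store arRs 65 54 ;; .add 65 65 rgOne ;; .load 55 arRul 54 ;; .add 54 54 rgOne ;;
    .load 56 arRul 54 ;; .add 54 54 rgOne ;; .load 57 arRul 54 ;; .add 54 54 rgOne ;;
    .load 58 arRul 54 ;; .add 54 54 rgOne ;; .load 59 arRul 54 ;; .add 54 54 rgOne ;;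
    .add 54 54 59) ;;
  .ite 55 (.sub 63 55 rgOne ;; .ite 63 skip (.load 63 arRow 57 ;; .load 64 arMul 56 ;;
    .add 63 63 64 ;; .add 63 63 58 ;; .store arDr 63 rgOne)) skip

/-- Store where the rules are, and which return rules there are. -/
def rulesC : Cmd := (.const 54 0 ;; .const 65 0 ;; .copy 46 rgNR) ;; forC 46 rulesBody

/-- The rules `rs` have been read. -/
structure RulesAt (rs : List (Rule (Fin m) (Fin n))) (TC : ℕ) (s : State) : Prop where
  at' : ∀ (i : ℕ) (h : i < rs.length), At (s.arr arRul) (s.arr arRs i) (encRule rs[i])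
  dr : ∀ (p q : Fin m) (g : Fin n), s.arr arDr (g * TC + (p * m + q)) = (dret rs p g q).toNat

theorem tri_rulesBody {rs : List (Rule (Fin m) (Fin n))} {r : Rule (Fin m) (Fin n)} {TC o : ℕ}
    (h1 : s.reg rgOne = 1) (h54 : s.reg 54 = o) (h65 : s.reg 65 = rs.length)
    (hA : At (s.arr arRul) o (encRule r)) (hrow : s.arr arRow r.top = r.top * TC)
    (hmul : s.arr arMul r.src = r.src * m) (hTC : m * m ≤ TC) (hR : RulesAt rs TC s) :
    Tri rulesBody s 21 fun s' => s'.reg 54 = o + (encRule r).length ∧ s'.reg 65 = rs.length + 1 ∧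
      RulesAt (rs ++ [r]) TC s' := by
  refine (Tri.bind (t₁ := 13) (t₂ := 8) (Q₁ := fun s' => s'.reg 54 = o + (encRule r).length ∧
    s'.reg 65 = rs.length + 1 ∧
    (∀ i, s'.arr arRs i = if i = rs.length then o else s.arr arRs i) ∧
    s'.reg 55 = (match r.kind with | .call => 0 | .ret => 1 | .int => 2) ∧ s'.reg 56 = r.src ∧
    s'.reg 57 = r.top ∧ s'.reg 58 = r.tgt) (Tri.run rfl le_rfl ?_)
    (Q := fun s' => s'.reg 54 = o + (encRule r).length ∧ s'.reg 65 = rs.length + 1 ∧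
    (∀ i, s'.arr arRs i = if i = rs.length then o else s.arr arRs i) ∧
    ∀ (p q : Fin m) (g : Fin n), s'.arr arDr (g * TC + (p * m + q)) =
      (dret (rs ++ [r]) p g q).toNat)
    fun s1 f1 ⟨e1, e2, e3, e4, e5, e6, e7⟩ => ?_).imp fun s' f' ⟨e1, e2, e3, e4⟩ =>
      ⟨e1, e2, fun i hi => ?_, e4⟩
  · have e0 := hA 0 (by simp [encRule])
    have e1 := hA 1 (by simp [encRule])
    have e2 := hA 2 (by simp [encRule])
    have e3 := hA 3 (by simp [encRule])
    have e4 := hA 4 (by simp [encRule])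
    have hl : (encRule r).length = 5 + r.word.length := by simp [encRule]; omega
    simp only [encRule, List.getElem_cons_zero, List.getElem_cons_succ, add_zero] at e0 e1 e2 e3 e4
    have ha : ∀ x, (s.setArr arRs rs.length x).arr arRul = s.arr arRul := fun x => by
      simp [State.setArr]
    refine ⟨?_, ?_, fun i => ?_, ?_, ?_, ?_, ?_⟩
    case refine_4 =>
      simp only [Cmd.run, State.reg_setReg, State.arr_setReg, State.reg_setArr, Nat.reduceEqDiff,
        if_true, if_false, h1, h54, h65, ha, e0]
    all_goals
      simp only [Cmd.run, State.reg_setReg, State.arr_setReg, State.reg_setArr, Nat.reduceEqDiff,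
        if_true, if_false, h1, h54, h65, ha, add_assoc, Nat.reduceAdd, e0, e1, e2, e3, e4, hl,
        State.arr_setArr, true_and, false_and]
  · have ho := (f1.reg _ rfl).trans h1
    have hrow1 : s1.arr arRow = s.arr arRow := f1.arr _ rfl
    have hmul1 : s1.arr arMul = s.arr arMul := f1.arr _ rfl
    have hdr1 : s1.arr arDr = s.arr arDr := f1.arr _ rfl
    refine (Tri.run (Q := fun s' => ∀ (p q : Fin m) (g : Fin n), s'.arr arDr (g * TC + (p * m + q)) =
      (dret (rs ++ [r]) p g q).toNat) rfl (by decide) ?_).imp fun s' f' h =>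
      ⟨(f'.reg _ rfl).trans e1, (f'.reg _ rfl).trans e2, fun i => by rw [f'.arr _ rfl, e3], h⟩
    intro p q g
    have hd : dret (rs ++ [r]) p g q = (dret rs p g q || isRet (p : ℕ) g q r) := by
      simp [dret]
    have hdr := hR.dr p q g
    cases r with
    | call => simp [Cmd.run, skip, e4, Rule.kind, hdr1, hdr, hd, isRet]
    | int => simp [Cmd.run, skip, e4, Rule.kind, hdr1, hdr, hd, isRet, ho]
    | ret a b t =>
      simp only [Rule.kind, Rule.src, Rule.top, Rule.tgt] at e4 e5 e6 e7 hrow hmul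
      have hlt : ∀ x y : Fin m, (x : ℕ) * m + y < TC := fun x y => by
        have := cell_lt (G := m - 1) (show (x : ℕ) ≤ m - 1 by omega) y.2
        rw [Nat.sub_add_cancel (by omega)] at this
        omega
      -- The array of return rules reuses the row offsets of the table; different triples get
      -- different cells because `p * m + q < m * m ≤ TC`.
      have hiff : (g * TC + (p * m + q) : ℕ) = b * TC + (a * m + t) ↔ a = p ∧ b = g ∧ t = q := by
        rw [cell_inj (hlt _ _) (hlt _ _), cell_inj q.2 t.2]
        simp only [← Fin.val_inj]
        tauto
      have hrun : ∀ i, s1.arr arDr i = s.arr arDr i := fun i => by rw [hdr1]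
      simp only [Cmd.run, State.reg_setReg, State.arr_setReg, State.reg_setArr, e4, e5, e6, e7, ho,
        one_ne_zero, if_false, Nat.reduceEqDiff, if_true, Nat.sub_self, State.arr_setArr, hrow1, hrow,
        hmul1, hmul, true_and, add_assoc, hiff, hrun, hdr, hd, isRet]
      split_ifs with hh
      · obtain ⟨rfl, rfl, rfl⟩ := hh
        simp
      · have : ((a : ℕ) == p && (b : ℕ) == g && (t : ℕ) == q) = false := by
          rw [← Bool.not_eq_true]
          simpa [Fin.val_inj, and_assoc] using hh
        rw [this, Bool.or_false]
  · rw [f'.arr arRul rfl, e3]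
    split_ifs with hh
    · subst hh
      simpa using hA
    · rw [List.getElem_append_left (by simp at hi; omega)]
      exact hR.at' i _

theorem tri_rules {rs : List (Rule (Fin m) (Fin n))} {TC : ℕ} (h1 : s.reg rgOne = 1)
    (hNR : s.reg rgNR = rs.length) (hA : At (s.arr arRul) 0 (rs.flatMap encRule))
    (hrow : ∀ r ∈ rs, s.arr arRow r.top = r.top * TC) (hmul : ∀ i < m, s.arr arMul i = i * m)
    (hTC : rs ≠ [] → m * m ≤ TC) (hz : ∀ i, s.arr arDr i = 0) :
    Tri rulesC s (rs.length * 23 + 4) (RulesAt rs TC) := by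
  refine Tri.le (t := 3 + (rs.length * (21 + 2) + 1)) (by omega) (Tri.bind (Q₁ := fun s' =>
    s'.reg 54 = 0 ∧ s'.reg 65 = 0 ∧ s'.reg 46 = rs.length)
    (Tri.run rfl le_rfl (by simp [Cmd.run, hNR])) fun s1 f1 ⟨h2, h3, h4⟩ => ?_)
  have ho := (f1.reg _ rfl).trans h1
  have aR : s1.arr arRul = s.arr arRul := f1.arr _ rfl
  have aW : s1.arr arRow = s.arr arRow := f1.arr _ rfl
  have aM : s1.arr arMul = s.arr arMul := f1.arr _ rfl
  have aD : s1.arr arDr = s.arr arDr := f1.arr _ rfl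
  refine (Tri.forC' (fun j s' => j ≤ rs.length → ∃ l l', rs = l ++ l' ∧ l'.length = j ∧
    s'.reg 54 = (l.flatMap encRule).length ∧ s'.reg 65 = l.length ∧ RulesAt l TC s') _ ho h4 rfl rfl
    (by decide) ?_ ?_ ?_).imp ?_
  · rintro j s v h hj
    obtain ⟨l, l', e1, e2, e3, e4, e5⟩ := h hj
    exact ⟨l, l', e1, e2, e3, e4, e5.1, e5.2⟩
  · exact fun _ => ⟨[], rs, rfl, rfl, h2, h3, fun i hi => absurd hi (by simp),
      fun p q g => by rw [aD, hz]; rfl⟩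
  · intro j hj s2 f2 h5 h6
    obtain ⟨l, l', e1, e2, e3, e4, e5⟩ := h6 hj
    cases l' with
    | nil => simp at e2
    | cons r l' =>
      have hr : r ∈ rs := by rw [e1]; simp
      have hne : rs ≠ [] := by rintro h; simp [h] at hr
      have bR : s2.arr arRul = s.arr arRul := (f2.arr _ rfl).trans aR
      have bW : s2.arr arRow = s.arr arRow := (f2.arr _ rfl).trans aW
      have bM : s2.arr arMul = s.arr arMul := (f2.arr _ rfl).trans aM
      have hAr : At (s2.arr arRul) (l.flatMap encRule).length (encRule r) := by
        rw [bR]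
        rw [e1, List.flatMap_append, List.flatMap_cons] at hA
        simpa using hA.right.left
      refine (tri_rulesBody ((f2.reg _ rfl).trans ho) e3 e4 hAr (by rw [bW]; exact hrow r hr)
        (by rw [bM]; exact hmul _ r.src.2) (hTC hne) e5).imp fun s' _ ⟨g1, g2, g3⟩ _ =>
        ⟨l ++ [r], l', by simp [e1], by simpa using e2, ?_, ?_, g3⟩
      · rw [g1]; simp
      · rw [g2]; simp
  · intro s' _ h
    obtain ⟨l, l', e1, e2, -, -, e5⟩ := h (Nat.zero_le _)
    rw [List.length_eq_zero_iff] at e2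
    rw [e1, e2, List.append_nil]
    exact e5

/-! ### The preparation of the tables -/

variable (rs : List (Rule (Fin m) (Fin n))) (f : Fin k → Finset (Fin m)) (φ : Formula (Fin k))
  (p : Fin m) (ω : List (Fin n))

/-- The part of the input that stays unchanged. -/
structure Src (s : State) : Prop where
  pm : s.reg rgM = m
  loc : s.reg 3 = p
  nr : s.reg rgNR = rs.length
  word : At (s.arr 0) 0 (ω.map Fin.val)
  rul : At (s.arr arRul) 0 (rs.flatMap encRule)
  fml : At (s.arr arFml) 0 (encFormula φ)
  lab : ∀ e : Fin k, ∀ q < m, s.arr arLab (e * m + q) = (labB f e q).toNat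

variable {rs f φ p ω}

theorem Src.frame {s s' : State} (h : Src rs f φ p ω s) {d : Cmd} (hf : Frame d s s')
    (hk : d.keeps [rgM, 3, rgNR] [0, arRul, arFml, arLab] = true) : Src rs f φ p ω s' := by
  obtain ⟨h1, h2, h3, h4, h5, h6, h7⟩ := h
  refine ⟨(hf.keepR hk (by simp)).trans h1, (hf.keepR hk (by simp)).trans h2,
    (hf.keepR hk (by simp)).trans h3, ?_, ?_, ?_, ?_⟩
  · rwa [hf.keepA hk (by simp)]
  · rwa [hf.keepA hk (by simp)]
  · rwa [hf.keepA hk (by simp)]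
  · rwa [hf.keepA hk (by simp)]

variable (rs f φ p ω)

/-- The sizes of the tables that the program works with. Without rules, a single cell suffices. -/
def dim : Dim m n where
  N := φ.size
  nG := if rs.isEmpty then 0 else n
  TC := if rs.isEmpty then 1 else 2 ^ ((φ.size + 1) * m)
  Td := deadType φ.size m
  rs := rs

/-- The tables can be computed. -/
structure Ready (s : State) : Prop where
  src : Src rs f φ p ω s
  b : BEnv (dim rs φ) s
  lw : s.reg rgLW = if rs.isEmpty then 0 else ω.length
  size : s.reg rgN = φ.size
  hd : ∀ i ψ, φ.nodes[i]? = some ψ → At (s.arr arFml) (s.arr arPos i) ψ.hd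
  mul : ∀ i ≤ φ.size + 1, s.arr arMul i = i * m

variable {rs f φ p ω}

theorem dim_ok : (dim rs φ).Ok := by
  have hN := φ.size_pos
  refine ⟨Nat.mul_le_mul_right m (by show 2 ≤ φ.size + 1; omega), ?_, deadType_lt _ _, fun h => ?_,
    fun h => ?_⟩
  · simp only [dim]; split_ifs <;> positivity
  · have : rs.isEmpty = false := by simpa [dim] using h
    simp [dim, this, Dim.K]
  · have : rs.isEmpty = false := by simpa [dim] using h
    simp [dim, this]

theorem Ready.frame {s s' : State} (h : Ready rs f φ p ω s) {d : Cmd} (hf : Frame d s s')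
    (hk : d.keeps [rgM, 3, rgNR, rgLW, rgN] [0, arRul, arFml, arLab, arPos, arMul] = true)
    (hk' : d.keeps tabR tabA = true) : Ready rs f φ p ω s' := by
  obtain ⟨⟨a1, a2, a3, a4, a5, a6, a7⟩, h2, h3, h4, h5, h6⟩ := h
  refine ⟨⟨(hf.keepR hk (by simp)).trans a1, (hf.keepR hk (by simp)).trans a2,
    (hf.keepR hk (by simp)).trans a3, ?_, ?_, ?_, ?_⟩, h2.frame hf hk',
    (hf.keepR hk (by simp)).trans h3, (hf.keepR hk (by simp)).trans h4, ?_, ?_⟩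
  · rwa [hf.keepA hk (by simp)]
  · rwa [hf.keepA hk (by simp)]
  · rwa [hf.keepA hk (by simp)]
  · rwa [hf.keepA hk (by simp)]
  · rwa [hf.keepA hk (by simp), hf.keepA hk (by simp)]
  · rwa [hf.keepA hk (by simp)]

/-- Products come from arrays of multiples filled by repeated addition. The multiples of `|P|` reach
far enough for two uses, as offsets of node blocks up to `K` and as row offsets for pairs of
locations. Without rules `|Γ|` and the stack length are replaced by `0`, so the stack is never read.
-/
def setupC : Cmd :=
  .const rgOne 1 ;; .ite rgNR skip (.const rgG 0 ;; .const rgLW 0) ;; parseC ;;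
  (.add 46 rgM rgN ;; .add 46 46 rgOne ;; .add 46 46 rgOne) ;; fillC arMul rgM ;;
  (.add 63 rgN rgOne ;; .load rgK arMul 63) ;; powC ;;
  (.load 63 arMul rgN ;; .load 63 arPow 63 ;; .sub rgTd 65 63 ;;
    .ite rgNR (.copy rgTC 65) (.const rgTC 1) ;; .add 46 rgG rgOne ;; .add 46 46 rgOne) ;;
  fillC arRow rgTC ;; rulesC ;;
  (.const rgRC 0 ;; .copy 46 rgM ;; .add 63 rgG rgOne ;; .load 63 arRow 63) ;;
  forC 46 (.add rgRC rgRC 63)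

theorem tri_setup (hS : Src rs f φ p ω s) (hG : s.reg rgG = n) (hL : s.reg rgLW = ω.length)
    (hz : ∀ i, s.arr arDr i = 0) :
    Tri setupC s (24 * φ.size + 8 * m + 5 * (dim rs φ).K + 5 * (dim rs φ).nG + 23 * rs.length + 70)
      (Ready rs f φ p ω) := by
  have hm : 0 < m := p.pos
  have hN := φ.size_pos
  set K := (dim rs φ).K with hK
  have hKe : K = (φ.size + 1) * m := rfl
  set nG := (dim rs φ).nG with hnG
  set TC := (dim rs φ).TC with hTC
  refine Tri.le (t := 1 + (3 + ((19 * φ.size + 4) + (3 + (((m + φ.size + 2) * 5 + 3) + (2 +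
    ((K * 5 + 4) + (7 + (((nG + 2) * 5 + 3) + ((rs.length * 23 + 4) + (4 + (m * 3 + 1))))))))))))
    (by omega) ?_
  refine Tri.bind (Q₁ := fun s' => s'.reg rgOne = 1) (Tri.run rfl le_rfl (by simp [Cmd.run]))
    fun s1 f1 o1 => ?_
  have S1 := hS.frame f1 rfl
  have z1 : s1.arr arDr = s.arr arDr := f1.arr _ rfl
  refine Tri.bind (Q₁ := fun s' => s'.reg rgG = nG ∧
    s'.reg rgLW = if rs.isEmpty then 0 else ω.length) (Tri.run rfl (by decide) ?_)
    fun s2 f2 ⟨g2, w2⟩ => ?_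
  · have hG1 := (f1.reg rgG rfl).trans hG
    have hL1 := (f1.reg rgLW rfl).trans hL
    have hNR := S1.nr
    simp only [Cmd.run, skip, State.reg_ite, State.reg_setReg, hNR, List.length_eq_zero_iff, hnG, dim,
      List.isEmpty_iff, Nat.reduceEqDiff, if_true, if_false, hG1, hL1, and_self]
  have S2 := S1.frame f2 rfl
  have o2 := (f2.reg rgOne rfl).trans o1
  have z2 : s2.arr arDr = s.arr arDr := (f2.arr _ rfl).trans z1
  refine Tri.bind (tri_parse o2 S2.fml) fun s3 f3 ⟨n3, p3⟩ => ?_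
  have S3 := S2.frame f3 rfl
  have o3 := (f3.reg rgOne rfl).trans o2
  have z3 : s3.arr arDr = s.arr arDr := (f3.arr _ rfl).trans z2
  refine Tri.bind (Q₁ := fun s' => s'.reg 46 = m + φ.size + 2) (Tri.run rfl le_rfl ?_)
    fun s4 f4 c4 => ?_
  · simp [Cmd.run, S3.pm, n3, o3]
  have S4 := S3.frame f4 rfl
  have o4 := (f4.reg rgOne rfl).trans o3
  refine Tri.bind (tri_fill (a := arMul) (r := rgM) o4 c4 S4.pm rfl) fun s5 f5 m5 => ?_
  have S5 := S4.frame f5 rfl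
  have o5 := (f5.reg rgOne rfl).trans o4
  have n5 := (f5.reg rgN rfl).trans ((f4.reg rgN rfl).trans n3)
  refine Tri.bind (Q₁ := fun s' => s'.reg rgK = K) (Tri.run rfl le_rfl ?_) fun s6 f6 k6 => ?_
  · simp only [Cmd.run, State.reg_setReg, State.arr_setReg, Nat.reduceEqDiff, if_true, n5, o5]
    rw [m5 _ (by omega), hKe]
  have o6 := (f6.reg rgOne rfl).trans o5
  refine Tri.bind (tri_pow o6 k6) fun s7 f7 ⟨E7, w7⟩ => ?_
  have S7 := (S5.frame f6 rfl).frame f7 rfl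
  have n7 := (f7.reg rgN rfl).trans ((f6.reg rgN rfl).trans n5)
  have m7 : ∀ i < m + φ.size + 2, s7.arr arMul i = i * m := by
    rw [f7.arr arMul rfl, f6.arr arMul rfl]; exact m5
  have g7 : s7.reg rgG = nG := by
    rw [f7.reg _ rfl, f6.reg _ rfl, f5.reg _ rfl, f4.reg _ rfl, f3.reg _ rfl, g2]
  have l7 : s7.reg rgLW = if rs.isEmpty then 0 else ω.length := by
    rw [f7.reg _ rfl, f6.reg _ rfl, f5.reg _ rfl, f4.reg _ rfl, f3.reg _ rfl, w2]
  have z7 : s7.arr arDr = s.arr arDr := by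
    rw [f7.arr _ rfl, f6.arr _ rfl, f5.arr _ rfl, f4.arr _ rfl, z3]
  have p7 : ∀ i ψ, φ.nodes[i]? = some ψ → At (s7.arr arFml) (s7.arr arPos i) ψ.hd := by
    rw [f7.arr arFml rfl, f6.arr arFml rfl, f5.arr arFml rfl, f4.arr arFml rfl,
      f7.arr arPos rfl, f6.arr arPos rfl, f5.arr arPos rfl, f4.arr arPos rfl]
    exact p3
  clear_value K nG TC
  clear f1 f2 f3 f4 f5 f6 f7 S1 S2 S3 S4 S5 o1 o2 o3 o4 o5 o6 z1 z2 z3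
  refine Tri.bind (Q₁ := fun s' => s'.reg rgTd = deadType φ.size m ∧ s'.reg rgTC = TC ∧
    s'.reg 46 = nG + 2) (Tri.run rfl (by decide) ?_) fun s8 f8 ⟨d8, t8, c8⟩ => ?_
  · have hlt : φ.size * m < K := by rw [hKe, Nat.succ_mul]; omega
    have hp := E7.pow _ hlt
    simp only [Cmd.run, State.reg_ite, State.arr_ite, State.reg_setReg, State.arr_setReg,
      Nat.reduceEqDiff, if_true, if_false, n7, m7 φ.size (by omega), hp, w7, S7.nr, E7.one,
      List.length_eq_zero_iff, hTC, dim, List.isEmpty_iff, g7]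
    rw [hKe]
    refine ⟨?_, ?_, ?_⟩
    · split_ifs <;> rfl
    · rfl
    · split_ifs <;> rfl
  have E8 := E7.frame f8 rfl rfl rfl
  refine Tri.bind (tri_fill (a := arRow) (r := rgTC) E8.one c8 t8 rfl) fun s9 f9 r9 => ?_
  have E9 := E8.frame f9 rfl rfl rfl
  have S9 := (S7.frame f8 rfl).frame f9 rfl
  have m9 : s9.arr arMul = s7.arr arMul := (f9.arr _ rfl).trans (f8.arr _ rfl)
  have z9 : s9.arr arDr = s.arr arDr := ((f9.arr _ rfl).trans (f8.arr _ rfl)).trans z7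
  refine Tri.bind (tri_rules (TC := TC) E9.one S9.nr S9.rul (fun r hr => r9 _ ?_)
    (fun i hi => by rw [m9, m7 i (by omega)]) (fun hr => ?_) (by rw [z9]; exact hz))
    fun s10 f10 R10 => ?_
  · have hne : rs.isEmpty = false := by
      rw [← Bool.not_eq_true, List.isEmpty_iff]; rintro h; simp [h] at hr
    have := r.top.2
    simp only [hnG, dim, hne, Bool.false_eq_true, if_false]
    omega
  · rw [hTC, dim_ok.tc hr]
    -- A formula has at least one node, so a type has at least `2 * m` bits and a row has room for
    -- all pairs of locations.
    calc m * m ≤ 2 ^ m * 2 ^ m := Nat.mul_le_mul Nat.lt_two_pow_self.le Nat.lt_two_pow_self.le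
      _ = 2 ^ (2 * m) := by rw [← pow_add, two_mul]
      _ ≤ _ := Nat.pow_le_pow_right (by norm_num) dim_ok.two
  have E10 := E9.frame f10 rfl rfl rfl
  have S10 := S9.frame f10 rfl
  have g10 : s10.reg rgG = nG := by rw [f10.reg _ rfl, f9.reg _ rfl, f8.reg _ rfl, g7]
  have r10 : s10.arr arRow = s9.arr arRow := f10.arr _ rfl
  refine Tri.bind (Q₁ := fun s' => s'.reg rgRC = 0 ∧ s'.reg 46 = m ∧ s'.reg 63 = (nG + 1) * TC)
    (Tri.run rfl le_rfl ?_) fun s11 f11 ⟨a11, b11, c11⟩ => ?_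
  · simp [Cmd.run, S10.pm, g10, E10.one, r10, r9 (nG + 1) (by omega)]
  have E11 := E10.frame f11 rfl rfl rfl
  have S11 := S10.frame f11 rfl
  refine (Tri.forC' (fun j s' => j ≤ m → s'.reg rgRC = (m - j) * ((nG + 1) * TC)) 1 E11.one b11 rfl
    rfl (by decide) (fun _ _ _ h => h) (fun _ => by simpa using a11) ?_).imp fun s12 f12 h => ?_
  · intro j hj s12 f12 _ h12
    refine Tri.run rfl le_rfl fun _ => ?_
    have hc := (f12.reg 63 rfl).trans c11
    simp only [Cmd.run, State.reg_setReg, if_true, h12 hj, hc]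
    rw [show m - j = m - (j + 1) + 1 by omega, Nat.add_mul (m - (j + 1)) 1, one_mul]
  have hr12 : s12.arr arRow = s9.arr arRow := by rw [f12.arr _ rfl, f11.arr _ rfl, r10]
  have hm12 : s12.arr arMul = s7.arr arMul := by rw [f12.arr _ rfl, f11.arr _ rfl, f10.arr _ rfl, m9]
  refine ⟨S11.frame f12 rfl, ?_, ?_, ?_, ?_, ?_⟩
  · refine ⟨?_, (S11.frame f12 rfl).pm, ?_, (S11.frame f12 rfl).nr, ?_, ?_, ?_, ?_, ?_, ?_, ?_⟩
    · rw [← hK]; exact E11.frame f12 rfl rfl rfl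
    · rw [← hnG, f12.reg _ rfl, f11.reg _ rfl, g10]
    · rw [← hTC, f12.reg _ rfl, f11.reg _ rfl, f10.reg _ rfl, f9.reg _ rfl, t8]
    · rw [h (Nat.zero_le _), hnG, hTC, Nat.sub_zero]
    · rw [f12.reg _ rfl, f11.reg _ rfl, f10.reg _ rfl, f9.reg _ rfl, d8]; rfl
    · rw [hr12, ← hnG, ← hTC]
      exact fun i hi => r9 i (by omega)
    · rw [hm12]
      exact fun i hi => m7 i (by omega)
    · rw [f12.arr arRul rfl, f11.arr arRul rfl, f12.arr arRs rfl, f11.arr arRs rfl]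
      exact R10.at'
    · intro _
      rw [f12.arr arDr rfl, f11.arr arDr rfl, ← hTC]
      exact R10.dr
  · rw [f12.reg _ rfl, f11.reg _ rfl, f10.reg _ rfl, f9.reg _ rfl, f8.reg _ rfl, l7]
  · rw [f12.reg _ rfl, f11.reg _ rfl, f10.reg _ rfl, f9.reg _ rfl, f8.reg _ rfl, n7]
  · rw [f12.arr arFml rfl, f11.arr arFml rfl, f10.arr arFml rfl, f9.arr arFml rfl, f8.arr arFml rfl,
      f12.arr arPos rfl, f11.arr arPos rfl, f10.arr arPos rfl, f9.arr arPos rfl, f8.arr arPos rfl]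
    exact p7
  · rw [hm12]
    exact fun i hi => m7 i (by omega)

variable {m n k : ℕ} {s : State} {rs : List (Rule (Fin m) (Fin n))} {f : Fin k → Finset (Fin m)}
  {φ : Formula (Fin k)} {p : Fin m} {ω : List (Fin n)}

theorem _root_.BCARET.Mode.num_ne_two (x : Mode) : x.num ≠ 2 := by cases x <;> decide

/-! ### Decoding a node of the formula -/

/-- Execute the program in the list with the number in register `63`. -/
def ladder : List Cmd → Cmd
  | [] => skip
  | c :: cs => .ite 63 (.sub 63 63 rgOne ;; ladder cs) c

theorem tri_ladder {Q : State → Prop} {t : ℕ} {c : Cmd} : ∀ {cs : List Cmd} {i : ℕ} {s : State},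
    s.reg rgOne = 1 → s.reg 63 = i → cs[i]? = some c →
    (∀ s', (∀ r, r ≠ 63 → s'.reg r = s.reg r) → s'.arr = s.arr → Tri c s' t Q) →
    Tri (ladder cs) s (2 * i + t + 1) Q := by
  intro cs
  induction cs with
  | nil => simp
  | cons d cs ih =>
    intro i s h1 h63 hi h
    refine Tri.ite (fun hn => ?_) fun hz => ?_
    · obtain ⟨i, rfl⟩ : ∃ j, i = j + 1 := ⟨i - 1, by omega⟩
      refine Tri.le (t := 1 + (2 * i + t + 1)) (by omega) (Tri.bind
        (Q₁ := fun s' => s' = s.setReg 63 i) (Tri.run rfl le_rfl (by simp [Cmd.run, h63, h1]))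
        fun s1 _ e1 => ?_)
      subst e1
      refine ih (by simpa using h1) (by simp) (by simpa using hi) fun s' hs' ha => h s' ?_ ha
      intro r hr
      rw [hs' r hr]
      simp [hr]
    · obtain rfl : i = 0 := by omega
      obtain rfl : d = c := by simpa using hi
      exact (h s (fun _ _ => rfl) rfl).le (by omega)

/-- The defaults are those of `basePrm`. Registers `65` and `67` get the polarities of the two
children and `56`, `57` their negations. The end of the first child, in register `66`, is the
position of the second. For a child that does not exist the values are meaningless and not used. -/
def preC : Cmd :=
  .const rgGrp 0 ;; .const rgAbs 0 ;; .const rgPop 0 ;; .const rgFl 0 ;; .const rgNv 0 ;;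
  .const rgAp 0 ;; .const rgBp 0 ;; .load rgZb arMul 47 ;; .copy rgSb rgZb ;; .load rgDb arMul rgN ;;
  .copy rgAb rgK ;; .copy rgBb rgK ;; .add 64 47 rgOne ;; .load 65 arPol 64 ;; .load 66 arEnd 64 ;;
  .load 67 arPol 66 ;; .load 68 arEnd 66 ;; .sub 56 rgOne 65 ;; .sub 57 rgOne 67 ;;
  .load 58 arPos 47 ;; .load 63 arFml 58 ;; .add 58 58 rgOne ;; .load 54 arFml 58 ;;
  .const rgLb 0 ;; .copy 46 rgM

def leafC : Cmd := .store arEnd 47 64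

def unC (fl : ℕ) : Cmd :=
  .store arEnd 47 66 ;; .load rgZb arMul 64 ;; .const rgGrp 1 ;; .const rgAp 1 ;; .copy rgFl fl

def binC (a b grp fl nv : ℕ) : Cmd :=
  .store arEnd 47 68 ;; .copy rgAp a ;; .copy rgBp b ;; .load rgAb arMul 64 ;; .load rgBb arMul 66 ;;
  .const rgGrp grp ;; .const rgFl fl ;; .const rgNv nv

def polC (v : ℕ) : Cmd := .const 63 v ;; .store arPol 47 63

def exC (b : ℕ) : Cmd := unC 65 ;; .const rgAbs b ;; polC 0
def axC (b : ℕ) : Cmd := unC 56 ;; .const rgNv 1 ;; .const rgAbs b ;; polC 1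
def euC (b : ℕ) : Cmd := binC 65 67 1 0 0 ;; .const rgAbs b ;; polC 0
def auC (b : ℕ) : Cmd := binC 65 67 2 1 1 ;; .const rgAbs b ;; polC 0
def erC (b : ℕ) : Cmd := binC 56 57 2 1 0 ;; .const rgAbs b ;; polC 1
def arC (b : ℕ) : Cmd := binC 56 57 1 0 1 ;; .const rgAbs b ;; polC 1

def blocks : List Cmd :=
  [leafC ;; .const rgAp 1 ;; polC 0, leafC ;; polC 0, leafC ;; .const rgGrp 3 ;; polC 0,
    leafC ;; .const rgGrp 3 ;; polC 1, binC 65 67 0 0 0 ;; polC 0, binC 56 57 0 0 0 ;; polC 1,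
    exC 0, exC 1, axC 0, axC 1, euC 0, euC 1, auC 0, auC 1, erC 0, erC 1, arC 0, arC 1]

/-- Set the parameters for the node with the number in register `47`. -/
def decodeC : Cmd := preC ;; forC 46 (.add rgLb rgLb 54) ;; ladder blocks

/-- The ends and the polarities of the nodes from `j` on have been computed. -/
def Kids (φ : Formula (Fin k)) (j : ℕ) (s : State) : Prop :=
  ∀ i ψ, j ≤ i → φ.nodes[i]? = some ψ → s.arr arEnd i = i + ψ.size ∧ s.arr arPol i = ψ.pol.toNat

/-- The situation before the parameters are adapted to the node. -/
structure Pre (N m j : ℕ) (s : State) : Prop where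
  p : PEnv m (basePrm ((N + 1) * m) (N * m) (j * m)) s
  r47 : s.reg 47 = j
  r64 : s.reg 64 = j + 1
  r65 : s.reg 65 = s.arr arPol (j + 1)
  r66 : s.reg 66 = s.arr arEnd (j + 1)
  r67 : s.reg 67 = s.arr arPol (s.arr arEnd (j + 1))
  r68 : s.reg 68 = s.arr arEnd (s.arr arEnd (j + 1))
  r56 : s.reg 56 = 1 - s.reg 65
  r57 : s.reg 57 = 1 - s.reg 67

theorem tri_decode {j : ℕ} {ψ : Formula (Fin k)} (hS : Ready rs f φ p ω s) (h47 : s.reg 47 = j)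
    (hψ : φ.nodes[j]? = some ψ) (hK : Kids φ (j + 1) s) :
    Tri decodeC s (3 * m + 80) fun s' => PEnv m (nodePrm φ.size j f ψ) s' ∧ Kids φ j s' := by
  have hjlt : j < φ.size := by have := φ.end_le hψ; have := ψ.size_pos; omega
  -- The last of the blocks has index `17`, every level of the ladder costs two steps, and a block
  -- takes at most `12`.
  refine Tri.le (t := 25 + ((m * (1 + 2) + 1) + (2 * 17 + 12 + 1))) (by omega) ?_
  refine Tri.bind (Q₁ := fun s' => Pre φ.size m j s' ∧ s'.reg 63 = ψ.hd.headD 0 ∧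
    (∀ e, ψ.hd.tail = [e] → s'.reg 54 = e) ∧ s'.reg rgLb = 0 ∧ s'.reg 46 = m)
    (Tri.run rfl (by decide) ?_) fun s1 f1 ⟨e1, e2, e3, e4, e5⟩ => ?_
  · have hd := hS.hd j ψ hψ
    have hd0 : s.arr arFml (s.arr arPos j) = ψ.hd.headD 0 := by
      have : ψ.hd ≠ [] := by cases ψ <;> simp [Formula.hd]
      obtain ⟨a, l, hl⟩ := List.exists_cons_of_ne_nil this
      rw [hl] at hd ⊢
      exact hd.head
    have hd1 : ∀ e, ψ.hd.tail = [e] → s.arr arFml (s.arr arPos j + 1) = e := by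
      intro e he
      have : ψ.hd = ψ.hd.headD 0 :: [e] := by
        cases ψ <;> simp_all [Formula.hd]
      rw [this] at hd
      exact hd 1 (by simp)
    have q1 := hS.b.e0.one
    have q2 := hS.b.e0.k
    have q3 := hS.size
    have q4 := hS.src.pm
    have q5 := hS.mul j (by omega)
    have q6 := hS.mul φ.size (by omega)
    refine ⟨⟨⟨?_, ?_, ?_, ?_, ?_, ?_, ?_, ?_, ?_, ?_, ?_, ?_, fun h => absurd h (by simp [basePrm])⟩,
      ?_, ?_, ?_, ?_, ?_, ?_, ?_, ?_⟩, ?_, fun e he => ?_, ?_, ?_⟩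
    all_goals simp [preC, Cmd.run, h47, q1, q2, q3, q4, q5, q6, basePrm, hd0, dim, Dim.K]
    exact hd1 e he
  have hS1 := hS.frame f1 rfl rfl
  have hK1 : Kids φ (j + 1) s1 := by
    unfold Kids; rw [f1.arr arEnd rfl, f1.arr arPol rfl]; exact hK
  -- The row of the label table for the proposition in register `54`, found by repeated addition. At
  -- nodes that are not literals this register holds an unrelated number, and the result is not
  -- used.
  refine Tri.bind (Q₁ := fun s' => Pre φ.size m j s' ∧ s'.reg rgLb = m * s1.reg 54) ?_
    fun s2 f2 ⟨g1, g2⟩ => ?_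
  · refine (Tri.forC' (fun i s' => i ≤ m → s'.reg rgLb = (m - i) * s1.reg 54) 1 hS1.b.e0.one e5 rfl
      rfl (by decide) (fun _ _ _ h => h) (fun _ => by simpa using e4) ?_).imp fun s2 f2 h =>
      ⟨⟨?_, (f2.reg _ rfl).trans e1.r47, (f2.reg _ rfl).trans e1.r64, ?_, ?_, ?_, ?_, ?_, ?_⟩, ?_⟩
    · intro i hi s2 f2 _ h12
      refine Tri.run rfl le_rfl fun _ => ?_
      have hc := f2.reg 54 rfl
      simp only [Cmd.run, State.reg_setReg, if_true, h12 hi, hc]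
      rw [show m - i = m - (i + 1) + 1 by omega, Nat.add_mul (m - (i + 1)) 1, one_mul]
    · have q := e1.p
      exact ⟨(f2.reg _ rfl).trans q.grp, (f2.reg _ rfl).trans q.abs, (f2.reg _ rfl).trans q.pop,
        (f2.reg _ rfl).trans q.fl, (f2.reg _ rfl).trans q.nv, (f2.reg _ rfl).trans q.ap,
        (f2.reg _ rfl).trans q.bp, (f2.reg _ rfl).trans q.zb, (f2.reg _ rfl).trans q.sb,
        (f2.reg _ rfl).trans q.db, (f2.reg _ rfl).trans q.ab, (f2.reg _ rfl).trans q.bb,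
        fun h => absurd h (by simp [basePrm])⟩
    · rw [f2.reg _ rfl, f2.arr _ rfl, e1.r65]
    · rw [f2.reg _ rfl, f2.arr _ rfl, e1.r66]
    · rw [f2.reg _ rfl, f2.arr _ rfl, f2.arr _ rfl, e1.r67]
    · rw [f2.reg _ rfl, f2.arr _ rfl, e1.r68]
    · rw [f2.reg _ rfl, f2.reg _ rfl, e1.r56]
    · rw [f2.reg _ rfl, f2.reg _ rfl, e1.r57]
    · simpa using h (Nat.zero_le _)
  have hS2 := hS1.frame f2 rfl rfl
  have hK2 : Kids φ (j + 1) s2 := by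
    unfold Kids; rw [f2.arr arEnd rfl, f2.arr arPol rfl]; exact hK1
  have l63 := (f2.reg 63 rfl).trans e2
  have run : ∀ (c : Cmd) (i : ℕ), ψ.hd.headD 0 = i → blocks[i]? = some c → c.flat = true → c.len ≤ 12 →
      (∀ s', (∀ r, r ≠ 63 → s'.reg r = s2.reg r) → s'.arr = s2.arr →
        PEnv m (nodePrm φ.size j f ψ) (c.run s') ∧
        (∀ i, (c.run s').arr arEnd i = if i = j then j + ψ.size else s2.arr arEnd i) ∧
        ∀ i, (c.run s').arr arPol i = if i = j then ψ.pol.toNat else s2.arr arPol i) →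
      Tri (ladder blocks) s2 (2 * 17 + 12 + 1) fun s' =>
        PEnv m (nodePrm φ.size j f ψ) s' ∧ Kids φ j s' := by
    intro c i hi hc hfl hlen h
    have hi17 : i ≤ 17 := by
      have := (List.getElem?_eq_some_iff.1 hc).1
      simp [blocks] at this
      omega
    refine (tri_ladder (t := 12) hS2.b.e0.one (l63.trans hi) hc fun s' h1 h2 => ?_).le (by omega)
    obtain ⟨a1, a2, a3⟩ := h s' h1 h2
    refine Tri.run hfl hlen ⟨a1, fun i ψ' hij hi => ?_⟩
    rw [a2, a3]
    split_ifs with he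
    · subst he
      obtain rfl : ψ' = ψ := by rw [hψ] at hi; exact (Option.some.inj hi).symm
      exact ⟨rfl, rfl⟩
    · exact hK2 i ψ' (by omega) hi
  clear f1 f2 hS1 hK1 hK
  have ht : ∀ b : Bool, 1 - b.toNat = (!b).toNat := by decide
  have un : ∀ a : Formula (Fin k), φ.nodes[j + 1]? = some a →
      s2.reg 65 = a.pol.toNat ∧ s2.reg 56 = (!a.pol).toNat ∧ s2.reg 66 = j + 1 + a.size ∧
      s2.arr arMul (j + 1) = (j + 1) * m := by
    intro a ha
    obtain ⟨b1, b2⟩ := hK2 (j + 1) a le_rfl ha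
    refine ⟨by rw [g1.r65, b2], by rw [g1.r56, g1.r65, b2, ht], by rw [g1.r66, b1], hS2.mul _ (by omega)⟩
  have bin : ∀ a b : Formula (Fin k), φ.nodes[j + 1]? = some a → φ.nodes[j + 1 + a.size]? = some b →
      s2.reg 67 = b.pol.toNat ∧ s2.reg 57 = (!b.pol).toNat ∧ s2.reg 68 = j + (a.size + b.size + 1) ∧
      s2.arr arMul (j + 1 + a.size) = (j + 1 + a.size) * m := by
    intro a b ha hb
    obtain ⟨b1, b2⟩ := hK2 (j + 1) a le_rfl ha
    obtain ⟨b3, b4⟩ := hK2 _ b (by omega) hb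
    have := φ.end_le ha
    refine ⟨by rw [g1.r67, b1, b4], by rw [g1.r57, g1.r67, b1, b4, ht], by rw [g1.r68, b1, b3]; omega,
      hS2.mul _ (by omega)⟩
  obtain ⟨q1, q2, q3, q4, q5, q6, q7, q8, q9, q10, q11, q12, -⟩ := g1.p
  have q47 := g1.r47
  have q64 := g1.r64
  cases ψ with
  | tt =>
    refine run _ 0 rfl rfl rfl (Nat.le_of_ble_eq_true rfl) fun s' h1 h2 => ?_
    refine ⟨⟨?_, ?_, ?_, ?_, ?_, ?_, ?_, ?_, ?_, ?_, ?_, ?_, fun h => absurd h (by simp [nodePrm, basePrm])⟩,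
      ?_, ?_⟩
    all_goals
      simp [Cmd.run, leafC, polC, h1, h2, q1, q2, q3, q4, q5, q6, q7, q8, q9, q10, q11, q12, q47, q64,
        nodePrm, State.arr_setArr, Formula.size, Formula.pol, basePrm]
  | ff =>
    refine run _ 1 rfl rfl rfl (Nat.le_of_ble_eq_true rfl) fun s' h1 h2 => ?_
    refine ⟨⟨?_, ?_, ?_, ?_, ?_, ?_, ?_, ?_, ?_, ?_, ?_, ?_, fun h => absurd h (by simp [nodePrm, basePrm])⟩,
      ?_, ?_⟩
    all_goals
      simp [Cmd.run, leafC, polC, h1, h2, q1, q2, q3, q4, q5, q6, q7, q8, q9, q10, q11, q12, q47, q64,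
        nodePrm, State.arr_setArr, Formula.size, Formula.pol, basePrm]
  | atom e =>
    refine run _ 2 rfl rfl rfl (Nat.le_of_ble_eq_true rfl) fun s' h1 h2 => ?_
    refine ⟨⟨?_, ?_, ?_, ?_, ?_, ?_, ?_, ?_, ?_, ?_, ?_, ?_, fun _ q hq => ?_⟩,
      ?_, ?_⟩
    case refine_13 =>
      have := hS2.src.lab e q hq
      simpa [Cmd.run, leafC, polC, h1, h2, g2, e3 e rfl, mul_comm m, State.arr_setArr, nodePrm] using this
    all_goals
      simp [Cmd.run, leafC, polC, h1, h2, q1, q2, q3, q4, q5, q6, q7, q8, q9, q10, q11, q12, q47, q64,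
        nodePrm, State.arr_setArr, Formula.size, Formula.pol, basePrm]
  | natom e =>
    refine run _ 3 rfl rfl rfl (Nat.le_of_ble_eq_true rfl) fun s' h1 h2 => ?_
    refine ⟨⟨?_, ?_, ?_, ?_, ?_, ?_, ?_, ?_, ?_, ?_, ?_, ?_, fun _ q hq => ?_⟩,
      ?_, ?_⟩
    case refine_13 =>
      have := hS2.src.lab e q hq
      simpa [Cmd.run, leafC, polC, h1, h2, g2, e3 e rfl, mul_comm m, State.arr_setArr, nodePrm] using this
    all_goals
      simp [Cmd.run, leafC, polC, h1, h2, q1, q2, q3, q4, q5, q6, q7, q8, q9, q10, q11, q12, q47, q64,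
        nodePrm, State.arr_setArr, Formula.size, Formula.pol, basePrm]
  | or a b =>
    have ha := φ.getElem?_kid1 hψ rfl
    have hb := φ.getElem?_kid2 hψ rfl
    obtain ⟨u1, u2, u3, u4⟩ := un a ha
    obtain ⟨v1, v2, v3, v4⟩ := bin a b ha hb
    refine run _ 4 rfl rfl rfl (Nat.le_of_ble_eq_true rfl) fun s' h1 h2 => ?_
    refine ⟨⟨?_, ?_, ?_, ?_, ?_, ?_, ?_, ?_, ?_, ?_, ?_, ?_, fun h => absurd h (by simp [nodePrm, basePrm])⟩,
      ?_, ?_⟩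
    all_goals
      simp [Cmd.run, binC, polC, h1, h2, q1, q2, q3, q4, q5, q6, q7, q8, q9, q10, q11, q12, q47, q64,
        nodePrm, State.arr_setArr, Formula.size, Formula.pol, basePrm,
        u1, u2, u3, u4, v1, v2, v3, v4]
  | and a b =>
    have ha := φ.getElem?_kid1 hψ rfl
    have hb := φ.getElem?_kid2 hψ rfl
    obtain ⟨u1, u2, u3, u4⟩ := un a ha
    obtain ⟨v1, v2, v3, v4⟩ := bin a b ha hb
    refine run _ 5 rfl rfl rfl (Nat.le_of_ble_eq_true rfl) fun s' h1 h2 => ?_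
    refine ⟨⟨?_, ?_, ?_, ?_, ?_, ?_, ?_, ?_, ?_, ?_, ?_, ?_, fun h => absurd h (by simp [nodePrm, basePrm])⟩,
      ?_, ?_⟩
    all_goals
      simp [Cmd.run, binC, polC, h1, h2, q1, q2, q3, q4, q5, q6, q7, q8, q9, q10, q11, q12, q47, q64,
        nodePrm, State.arr_setArr, Formula.size, Formula.pol, basePrm,
        u1, u2, u3, u4, v1, v2, v3, v4]
  | EX x a =>
    have ha := φ.getElem?_kid1 hψ rfl
    obtain ⟨u1, u2, u3, u4⟩ := un a ha
    refine run (exC x.num) (6 + x.num) rfl (by cases x <;> rfl) rfl (Nat.le_of_ble_eq_true rfl) fun s' h1 h2 => ?_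
    refine ⟨⟨?_, ?_, ?_, ?_, ?_, ?_, ?_, ?_, ?_, ?_, ?_, ?_, fun h => absurd h (by simp [nodePrm, basePrm])⟩,
      ?_, ?_⟩
    case refine_2 => cases x <;> simp [Cmd.run, exC, unC, polC, nodePrm, basePrm, Mode.num]
    all_goals
      simp [Cmd.run, exC, unC, polC, h1, h2, q1, q2, q3, q4, q5, q6, q7, q8, q9, q10, q11, q12, q47, q64,
        nodePrm, State.arr_setArr, Formula.size, Formula.pol, basePrm, x.num_ne_two,
        u1, u2, u3, u4, show j + 1 + a.size = j + (a.size + 1) by omega]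
  | AX x a =>
    have ha := φ.getElem?_kid1 hψ rfl
    obtain ⟨u1, u2, u3, u4⟩ := un a ha
    refine run (axC x.num) (8 + x.num) rfl (by cases x <;> rfl) rfl (Nat.le_of_ble_eq_true rfl) fun s' h1 h2 => ?_
    refine ⟨⟨?_, ?_, ?_, ?_, ?_, ?_, ?_, ?_, ?_, ?_, ?_, ?_, fun h => absurd h (by simp [nodePrm, basePrm])⟩,
      ?_, ?_⟩
    case refine_2 => cases x <;> simp [Cmd.run, axC, unC, polC, nodePrm, basePrm, Mode.num]
    all_goals
      simp [Cmd.run, axC, unC, polC, h1, h2, q1, q2, q3, q4, q5, q6, q7, q8, q9, q10, q11, q12, q47, q64,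
        nodePrm, State.arr_setArr, Formula.size, Formula.pol, basePrm, x.num_ne_two,
        u1, u2, u3, u4, show j + 1 + a.size = j + (a.size + 1) by omega]
  | EU x a b =>
    have ha := φ.getElem?_kid1 hψ rfl
    have hb := φ.getElem?_kid2 hψ rfl
    obtain ⟨u1, u2, u3, u4⟩ := un a ha
    obtain ⟨v1, v2, v3, v4⟩ := bin a b ha hb
    refine run (euC x.num) (10 + x.num) rfl (by cases x <;> rfl) rfl (Nat.le_of_ble_eq_true rfl) fun s' h1 h2 => ?_
    refine ⟨⟨?_, ?_, ?_, ?_, ?_, ?_, ?_, ?_, ?_, ?_, ?_, ?_, fun h => absurd h (by simp [nodePrm, basePrm])⟩,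
      ?_, ?_⟩
    case refine_2 => cases x <;> simp [Cmd.run, euC, binC, polC, nodePrm, basePrm, Mode.num]
    all_goals
      simp [Cmd.run, euC, binC, polC, h1, h2, q1, q2, q3, q4, q5, q6, q7, q8, q9, q10, q11, q12, q47, q64,
        nodePrm, State.arr_setArr, Formula.size, Formula.pol, basePrm, x.num_ne_two,
        u1, u2, u3, u4, v1, v2, v3, v4]
  | AU x a b =>
    have ha := φ.getElem?_kid1 hψ rfl
    have hb := φ.getElem?_kid2 hψ rfl
    obtain ⟨u1, u2, u3, u4⟩ := un a ha
    obtain ⟨v1, v2, v3, v4⟩ := bin a b ha hb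
    refine run (auC x.num) (12 + x.num) rfl (by cases x <;> rfl) rfl (Nat.le_of_ble_eq_true rfl) fun s' h1 h2 => ?_
    refine ⟨⟨?_, ?_, ?_, ?_, ?_, ?_, ?_, ?_, ?_, ?_, ?_, ?_, fun h => absurd h (by simp [nodePrm, basePrm])⟩,
      ?_, ?_⟩
    case refine_2 => cases x <;> simp [Cmd.run, auC, binC, polC, nodePrm, basePrm, Mode.num]
    all_goals
      simp [Cmd.run, auC, binC, polC, h1, h2, q1, q2, q3, q4, q5, q6, q7, q8, q9, q10, q11, q12, q47, q64,
        nodePrm, State.arr_setArr, Formula.size, Formula.pol, basePrm, x.num_ne_two,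
        u1, u2, u3, u4, v1, v2, v3, v4]
  | ER x a b =>
    have ha := φ.getElem?_kid1 hψ rfl
    have hb := φ.getElem?_kid2 hψ rfl
    obtain ⟨u1, u2, u3, u4⟩ := un a ha
    obtain ⟨v1, v2, v3, v4⟩ := bin a b ha hb
    refine run (erC x.num) (14 + x.num) rfl (by cases x <;> rfl) rfl (Nat.le_of_ble_eq_true rfl) fun s' h1 h2 => ?_
    refine ⟨⟨?_, ?_, ?_, ?_, ?_, ?_, ?_, ?_, ?_, ?_, ?_, ?_, fun h => absurd h (by simp [nodePrm, basePrm])⟩,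
      ?_, ?_⟩
    case refine_2 => cases x <;> simp [Cmd.run, erC, binC, polC, nodePrm, basePrm, Mode.num]
    all_goals
      simp [Cmd.run, erC, binC, polC, h1, h2, q1, q2, q3, q4, q5, q6, q7, q8, q9, q10, q11, q12, q47, q64,
        nodePrm, State.arr_setArr, Formula.size, Formula.pol, basePrm, x.num_ne_two,
        u1, u2, u3, u4, v1, v2, v3, v4]
  | AR x a b =>
    have ha := φ.getElem?_kid1 hψ rfl
    have hb := φ.getElem?_kid2 hψ rfl
    obtain ⟨u1, u2, u3, u4⟩ := un a ha
    obtain ⟨v1, v2, v3, v4⟩ := bin a b ha hb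
    refine run (arC x.num) (16 + x.num) rfl (by cases x <;> rfl) rfl (Nat.le_of_ble_eq_true rfl) fun s' h1 h2 => ?_
    refine ⟨⟨?_, ?_, ?_, ?_, ?_, ?_, ?_, ?_, ?_, ?_, ?_, ?_, fun h => absurd h (by simp [nodePrm, basePrm])⟩,
      ?_, ?_⟩
    case refine_2 => cases x <;> simp [Cmd.run, arC, binC, polC, nodePrm, basePrm, Mode.num]
    all_goals
      simp [Cmd.run, arC, binC, polC, h1, h2, q1, q2, q3, q4, q5, q6, q7, q8, q9, q10, q11, q12, q47, q64,
        nodePrm, State.arr_setArr, Formula.size, Formula.pol, basePrm, x.num_ne_two,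
        u1, u2, u3, u4, v1, v2, v3, v4]

end RAM

/-- Mode `2` consults neither the pop table nor `Td`. Hence the program for a general stage can
compute the pop table itself. -/
theorem newb_popPrm {m n : ℕ} (rs : List (Rule (Fin m) (Fin n))) (F1 : Table) (Td K : ℕ) :
    newb rs F1 Td (popPrm K) = newb rs (fun _ _ => 0) 0 (popPrm K) := by
  funext F p g T
  simp [newb, ebit, good, popPrm]

namespace RAM

variable {m n k : ℕ} {s : State} {S : PDS (Fin m) (Fin n)} {rs : List (Rule (Fin m) (Fin n))}
  {f : Fin k → Finset (Fin m)} {φ : Formula (Fin k)} {p : Fin m} {ω : List (Fin n)}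

/-! ### The whole program -/

def popC : Cmd :=
  .const rgGrp 1 ;; .const rgAbs 0 ;; .const rgPop 1 ;; .const rgFl 0 ;; .const rgNv 0 ;;
  .const rgAp 1 ;; .const rgBp 0 ;; .const rgZb 0 ;; .const rgSb 0 ;; .copy rgDb rgK ;;
  .copy rgAb rgK ;; .copy rgBb rgK

theorem tri_popC {K : ℕ} (hK : s.reg rgK = K) : Tri popC s 12 (PEnv m (popPrm K)) := by
  refine Tri.run rfl (by decide) ⟨?_, ?_, ?_, ?_, ?_, ?_, ?_, ?_, ?_, ?_, ?_, ?_, fun h =>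
    absurd h (by simp [popPrm])⟩ <;> simp [Cmd.run, popC, popPrm, hK]

def deadC : Cmd :=
  .const rgGrp 2 ;; .const rgAbs 0 ;; .const rgPop 0 ;; .const rgFl 1 ;; .const rgNv 0 ;;
  .const rgAp 1 ;; .const rgBp 0 ;; .load rgZb arMul rgN ;; .copy rgSb rgZb ;; .copy rgDb rgZb ;;
  .copy rgAb rgK ;; .copy rgBb rgK

theorem tri_deadC {K d : ℕ} (hK : s.reg rgK = K) (hd : s.arr arMul (s.reg rgN) = d) :
    Tri deadC s 12 (PEnv m (deadPrm K d)) := by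
  refine Tri.run rfl (by decide) ⟨?_, ?_, ?_, ?_, ?_, ?_, ?_, ?_, ?_, ?_, ?_, ?_, fun h =>
    absurd h (by simp [deadPrm, basePrm])⟩ <;> simp [Cmd.run, deadC, deadPrm, basePrm, hK, hd]

/-- Move the table to the array for the reachability of the bottom. -/
def moveC : Cmd :=
  (.add 63 rgG rgOne ;; .load 46 arRow 63) ;;
  forC 46 (.load 63 arF 46 ;; .store arF1 46 63 ;; .const 63 0 ;; .store arF 46 63)

theorem tri_move {c : Dim m n} {F : Table} (hB : BEnv c s) (hF : TabAt c arF F s) :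
    Tri moveC s (c.cells * 6 + 3) fun s' => TabAt c arF1 F s' ∧ TabAt c arF (fun _ _ => 0) s' := by
  refine Tri.le (t := 2 + (c.cells * (4 + 2) + 1)) (by omega) (Tri.bind (Q₁ := fun s' =>
    s'.reg 46 = c.cells) (Tri.run rfl le_rfl (by
      simp [Cmd.run, hB.g, hB.e0.one, hB.row _ le_rfl, Dim.cells])) fun s1 f1 h1 => ?_)
  have hB1 := hB.frame f1 rfl
  have hF1 : s1.arr arF = s.arr arF := f1.arr _ rfl
  refine (Tri.forC' (fun j s' => (∀ i < j, s'.arr arF i = s.arr arF i) ∧ ∀ i < c.cells, j ≤ i →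
    s'.arr arF1 i = s.arr arF i ∧ s'.arr arF i = 0) 4 hB1.e0.one h1 rfl rfl (by decide)
    (fun _ _ _ h => h) ⟨fun i _ => by rw [hF1], fun i h h' => by omega⟩ ?_).imp fun s' _ h => ?_
  · intro j hj s2 f2 h2 ⟨h3, h4⟩
    refine Tri.run rfl le_rfl ?_
    simp only [Cmd.run, State.reg_setReg, State.arr_setReg, State.arr_setArr, State.reg_setArr, h2,
      Nat.reduceEqDiff, if_true, if_false, true_and, false_and]
    refine ⟨fun i hi => ?_, fun i hi hij => ?_⟩
    · rw [if_neg (by omega), h3 i (by omega)]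
    · by_cases he : i = j
      · subst he; simp [h3 i (by omega)]
      · simpa [he] using h4 i hi (by omega)
  · exact ⟨fun g hg T hT => by rw [(h.2 _ (cell_lt hg hT) (Nat.zero_le _)).1]; exact hF g hg T hT,
      fun g hg T hT => (h.2 _ (cell_lt hg hT) (Nat.zero_le _)).2⟩

theorem TabAt.frame {c : Dim m n} {a : ℕ} {F : Table} {s s' : State} (h : TabAt c a F s) {d : Cmd}
    (hf : Frame d s s') (ha : d.wa a = false) : TabAt c a F s' := by
  unfold TabAt; rw [hf.arr a ha]; exact h

/-- The table for the nodes from `j` on has been computed. -/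
structure Done (S : PDS (Fin m) (Fin n)) (rs : List (Rule (Fin m) (Fin n)))
    (f : Fin k → Finset (Fin m)) (φ : Formula (Fin k)) (ω : List (Fin n)) (j : ℕ) (F : Table) :
    Prop where
  small : Small (dim rs φ) F
  inv : rs ≠ [] → Inv S f φ j F
  bot : Bot S f φ (dim rs φ).nG j F (if rs.isEmpty then ω else [])

theorem top_ne (r : Rule (Fin m) (Fin n)) (hr : r ∈ rs) : (r.top : ℕ) ≠ (dim rs φ).nG := by
  have hne : rs.isEmpty = false := by
    rw [← Bool.not_eq_true, List.isEmpty_iff]; rintro h; simp [h] at hr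
  have := r.top.2
  simp only [dim, hne, Bool.false_eq_true, if_false]
  omega

theorem not_step (hrs : ∀ r, r ∈ rs ↔ r ∈ S.Δ) (q : Fin m) (e) :
    ¬ S.Step (q, if rs.isEmpty then ω else []) e := by
  split_ifs with h
  · rintro ⟨t, r, hr, -⟩
    rw [List.isEmpty_iff.1 h] at hrs
    simpa using (hrs r).2 hr
  · exact PDS.not_step_nil

theorem dim_of_ne (h : rs ≠ []) : (dim rs φ).nG = n ∧ (dim rs φ).TC = 2 ^ ((φ.size + 1) * m) := by
  have : rs.isEmpty = false := by simpa using h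
  simp [dim, this]

theorem done_deadTable (hrs : ∀ r, r ∈ rs ↔ r ∈ S.Δ) :
    Done S rs f φ ω φ.size (deadTable φ rs (dim rs φ).nG (dim rs φ).TC) where
  small := Small.iterate (c := dim rs φ) (F := fun _ _ => 0) (k := deadPrm _ _)
    (fun _ _ _ _ => by positivity) (by show φ.size * m + m ≤ (φ.size + 1) * m; rw [Nat.succ_mul]) _
  inv h := by
    obtain ⟨h1, h2⟩ := dim_of_ne (φ := φ) h
    rw [h1, h2]; exact inv_deadTable hrs
  bot := bot_deadTable dim_ok.pos top_ne (not_step hrs)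

theorem Done.nodeStep (hrs : ∀ r, r ∈ rs ↔ r ∈ S.Δ) {j : ℕ} {F : Table} {ψ}
    (h : Done S rs f φ ω (j + 1) F) (hψ : φ.nodes[j]? = some ψ) :
    Done S rs f φ ω j (nodeStep f φ rs (dim rs φ).nG (dim rs φ).TC j ψ F) where
  small := by
    have := Small.iterate (F1 := popTable rs (dim rs φ).nG ((φ.size + 1) * m) (dim rs φ).TC)
      (k := nodePrm φ.size j f ψ) h.small (by
      rw [nodePrm_sb, ← Nat.succ_mul]
      have := φ.end_le hψ
      have := ψ.size_pos
      exact Nat.mul_le_mul_right m (by show j + 1 ≤ φ.size + 1; omega))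
      (m * (((dim rs φ).nG + 1) * (dim rs φ).TC))
    rw [nodePrm_sb] at this
    exact this
  inv hne := by
    obtain ⟨h1, h2⟩ := dim_of_ne (φ := φ) hne
    rw [h1, h2]; exact (h.inv hne).nodeStep hrs hψ
  bot := h.bot.nodeStep dim_ok.pos top_ne (not_step hrs) hψ

/-- Counting down visits children before parents, so their bits, ends and polarities are known in
time. -/
def nodesC : Cmd := .copy 47 rgN ;; forC 47 (decodeC ;; stageC)

/-- The state between the computations for two nodes. -/
structure Mid (S : PDS (Fin m) (Fin n)) (rs : List (Rule (Fin m) (Fin n)))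
    (f : Fin k → Finset (Fin m)) (φ : Formula (Fin k)) (p : Fin m) (ω : List (Fin n)) (j : ℕ)
    (s : State) : Prop where
  ready : Ready rs f φ p ω s
  f1 : TabAt (dim rs φ) arF1 (popTable rs (dim rs φ).nG ((φ.size + 1) * m) (dim rs φ).TC) s
  kids : Kids φ j s
  tab : ∃ F, TabAt (dim rs φ) arF F s ∧ Done S rs f φ ω j F

theorem small_popTable : Small (dim rs φ)
    (popTable rs (dim rs φ).nG ((φ.size + 1) * m) (dim rs φ).TC) :=
  Small.iterate (c := dim rs φ) (F := fun _ _ => 0) (k := popPrm _) (F1 := fun _ _ => 0)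
    (fun _ _ _ _ => by positivity) (by show 0 + m ≤ (φ.size + 1) * m; rw [Nat.succ_mul]; omega) _

theorem tri_nodes (hrs : ∀ r, r ∈ rs ↔ r ∈ S.Δ) (h : Mid S rs f φ p ω φ.size s) :
    Tri nodesC s (φ.size * (3 * m + 82 + (dim rs φ).stageTime) + 2) (Mid S rs f φ p ω 0) := by
  refine Tri.le (t := 1 + (φ.size * (3 * m + 80 + (dim rs φ).stageTime + 2) + 1))
    (by rw [show 3 * m + 80 + (dim rs φ).stageTime + 2 = 3 * m + 82 + (dim rs φ).stageTime by omega]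
        omega)
    (Tri.bind (Q₁ := fun s' => s'.reg 47 = φ.size ∧ Mid S rs f φ p ω φ.size s') ?_
    fun s1 f1 ⟨h1, h2⟩ => ?_)
  · refine (Tri.run (Q := fun s' => s'.reg 47 = φ.size) rfl le_rfl ?_).imp fun s' f' h' => ⟨h', ?_⟩
    · simp [Cmd.run, h.ready.size]
    · obtain ⟨F, hF, hD⟩ := h.tab
      refine ⟨h.ready.frame f' rfl rfl, h.f1.frame f' rfl, ?_, F, hF.frame f' rfl, hD⟩
      unfold Kids; rw [f'.arr arEnd rfl, f'.arr arPol rfl]; exact h.kids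
  refine Tri.forC' (fun j s' => Mid S rs f φ p ω j s') _ h2.ready.b.e0.one h1 rfl rfl (by decide)
    (fun j s v h => ?_) h2 fun j hj s2 f2 h47 hM => ?_
  · obtain ⟨F, hF, hD⟩ := h.tab
    exact ⟨h.ready.frame (Frame.setReg (.const 47 0) s 47 v rfl) rfl rfl, h.f1, h.kids, F, hF, hD⟩
  · obtain ⟨ψ, hψ⟩ : ∃ ψ, φ.nodes[j]? = some ψ :=
      ⟨_, List.getElem?_eq_getElem (by rw [φ.length_nodes]; exact hj)⟩
    obtain ⟨F, hF, hD⟩ := hM.tab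
    refine Tri.bind (tri_decode hM.ready h47 hψ hM.kids) fun s3 f3 ⟨hP, hK⟩ => ?_
    have hR3 := hM.ready.frame f3 rfl rfl
    have hE : SEnv (dim rs φ) (popTable rs (dim rs φ).nG ((φ.size + 1) * m) (dim rs φ).TC)
        (nodePrm φ.size j f ψ) F s3 :=
      ⟨hR3.b, hP, hM.f1.frame f3 rfl, hF.frame f3 rfl⟩
    refine (tri_stage dim_ok hE small_popTable hD.small ?_).imp fun s4 f4 hE4 => ?_
    · rw [nodePrm_sb, ← Nat.succ_mul]
      exact Nat.mul_le_mul_right m (by show j + 1 ≤ φ.size + 1; omega)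
    · refine ⟨hR3.frame f4 rfl rfl, hE4.f1, ?_, _, hE4.f, ?_⟩
      · unfold Kids; rw [f4.arr arEnd rfl, f4.arr arPol rfl]; exact hK
      · rw [nodePrm_sb]; exact hD.nodeStep hrs hψ

/-- One saturation program serves the pop table, the dead bits and all nodes; only the parameters
differ. -/
def tablesC : Cmd := popC ;; stageC ;; moveC ;; deadC ;; stageC ;; nodesC

def tablesTime (rs : List (Rule (Fin m) (Fin n))) (φ : Formula (Fin k)) : ℕ :=
  (φ.size + 2) * (dim rs φ).stageTime + φ.size * (3 * m + 82) + (dim rs φ).cells * 6 + 29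

theorem tri_tables (hrs : ∀ r, r ∈ rs ↔ r ∈ S.Δ) (h : Ready rs f φ p ω s)
    (h1 : ∀ i, s.arr arF1 i = 0) (h2 : ∀ i, s.arr arF i = 0) :
    Tri tablesC s (tablesTime rs φ) (Mid S rs f φ p ω 0) := by
  set c := dim rs φ with hc
  refine Tri.le (t := 12 + (c.stageTime + ((c.cells * 6 + 3) + (12 + (c.stageTime +
    (φ.size * (3 * m + 82 + c.stageTime) + 2)))))) ?_ (Tri.bind (tri_popC (m := m) h.b.e0.k)
    fun s1 f1 e1 => ?_)
  · unfold tablesTime; rw [← hc]; ring_nf; omega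
  have hR1 := h.frame f1 rfl rfl
  have hE1 : SEnv c (fun _ _ => 0) (popPrm c.K) (fun _ _ => 0) s1 :=
    ⟨hR1.b, e1, fun g _ T _ => by rw [f1.arr _ rfl, h1], fun g _ T _ => by rw [f1.arr _ rfl, h2]⟩
  have hz : Small c (fun _ _ => 0) := fun _ _ _ _ => by positivity
  refine Tri.bind (tri_stage dim_ok hE1 hz hz (by show 0 + m ≤ (φ.size + 1) * m; rw [Nat.succ_mul]; omega))
    fun s2 f2 hE2 => ?_
  have hR2 := hR1.frame f2 rfl rfl
  have hT2 := hE2.f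
  rw [newb_popPrm] at hT2
  refine Tri.bind (tri_move hR2.b hT2) fun s3 f3 ⟨hT3, hF3⟩ => ?_
  have hR3 := hR2.frame f3 rfl rfl
  refine Tri.bind (tri_deadC (m := m) (d := φ.size * m) hR3.b.e0.k (by rw [hR3.size, hR3.mul _ (by omega)]))
    fun s4 f4 e4 => ?_
  have hR4 := hR3.frame f4 rfl rfl
  refine Tri.bind (tri_stage dim_ok (k := deadPrm c.K (φ.size * m))
    ⟨hR4.b, e4, hT3.frame f4 rfl, hF3.frame f4 rfl⟩ small_popTable hz
    (by show φ.size * m + m ≤ (φ.size + 1) * m; rw [Nat.succ_mul]))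
    fun s5 f5 hE5 => ?_
  have hR5 := hR4.frame f5 rfl rfl
  refine tri_nodes hrs ⟨hR5, hE5.f1, fun i ψ hi hψ => ?_, _, hE5.f, done_deadTable hrs⟩
  have := φ.end_le hψ
  have := ψ.size_pos
  omega

def answerC : Cmd :=
  (.load 63 arRow rgG ;; .load 60 arF 63) ;;
  forC rgLW (.load 63 0 rgLW ;; .load 63 arRow 63 ;; .add 63 63 60 ;; .load 60 arF 63) ;;
  (.copy 70 60 ;; .copy 71 3) ;; testbit ;;
  (.const 63 0 ;; .load 63 arPol 63 ;; .ite 63 (.sub 0 rgOne 72) (.copy 0 72))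

theorem tri_answer (h : Mid S rs f φ p ω 0 s) :
    Tri answerC s (6 * ω.length + 14 * (dim rs φ).K + 12) fun s' =>
      (Sat S (stdVal (Fin n) f) φ (p, ω) → s'.reg 0 = 1) ∧
      (¬ Sat S (stdVal (Fin n) f) φ (p, ω) → s'.reg 0 = 0) := by
  obtain ⟨F, hF, hD⟩ := h.tab
  have hR := h.ready
  have hok : (dim rs φ).Ok := dim_ok
  -- Without rules the single cell already describes all of `ω`, and no symbol is left to process.
  set w := if rs.isEmpty then [] else ω with hw
  have hlen : w.length ≤ ω.length := by rw [hw]; split_ifs <;> simp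
  refine Tri.le (t := 2 + ((w.length * (4 + 2) + 1) + (2 + ((14 * (dim rs φ).K + 3) + 4)))) (by omega)
    (Tri.bind (Q₁ := fun s' => s'.reg 60 = F (dim rs φ).nG 0) (Tri.run rfl le_rfl ?_) fun s1 f1 h1 => ?_)
  · have := hF (dim rs φ).nG le_rfl 0 hok.pos
    rw [add_zero] at this
    simp [Cmd.run, hR.b.g, hR.b.row (dim rs φ).nG (Nat.le_succ _), this]
  have hR1 := hR.frame f1 rfl rfl
  have hF1 := hF.frame f1 rfl
  have hm : Match S f φ 0 (evalW F w (F (dim rs φ).nG 0)) ω := by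
    have hb := hD.bot.mat
    rw [hw]
    split_ifs with he
    · simpa [he] using hb
    · have hne : rs ≠ [] := by simpa using he
      simp only [he, Bool.false_eq_true, if_false] at hb
      simpa using (hD.inv hne).match_evalW hb ω
  refine Tri.bind (Tri.forC' (fun j s' => s'.reg 60 = evalW F (w.drop j) (F (dim rs φ).nG 0)) 4 hR1.b.e0.one
    (n := w.length) (by rw [hR1.lw, hw]; split_ifs <;> rfl) rfl rfl (by decide) (fun _ _ _ h => h)
    (by simpa using h1) ?_) fun s2 f2 h2 => ?_
  · intro j hj s2 f2 h3 h4
    have hne : rs ≠ [] := by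
      rintro rfl
      simp [hw] at hj
    have hwω : w = ω := by
      have : rs.isEmpty = false := by simpa using hne
      rw [hw, this]; rfl
    clear_value w
    subst hwω
    have hB2 := hR1.b.frame f2 rfl
    have hF2 := hF1.frame f2 rfl
    have h0 : s2.arr 0 = s1.arr 0 := f2.arr _ rfl
    have hwj := hR1.src.word j (by simpa using hj)
    rw [zero_add, List.getElem_map] at hwj
    have hg : (w[j] : ℕ) ≤ (dim rs φ).nG := (w[j]).2.le.trans (hok.g hne)
    have hrng := hD.small.rng (hok.tc hne)
    have hlt := evalW_lt (hok.g hne) hrng (hrng (dim rs φ).nG 0 le_rfl hok.pos) (w.drop (j + 1))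
    refine Tri.run rfl le_rfl ?_
    simp only [Cmd.run, State.reg_setReg, State.arr_setReg, h3, h4, Nat.reduceEqDiff, if_true, if_false,
      h0, hwj, hB2.row _ (hg.trans (Nat.le_succ _)), hF2 _ hg _ hlt]
    rw [List.drop_eq_getElem_cons hj, evalW_cons]
  rw [List.drop_zero] at h2
  have hR2 := f2
  have hE2 := hR1.b.e0.frame f2 rfl rfl rfl
  refine Tri.bind (Q₁ := fun s' => s'.reg 70 = evalW F w (F (dim rs φ).nG 0) ∧ s'.reg 71 = p)
    (Tri.run rfl le_rfl ?_) fun s3 f3 ⟨h3, h4⟩ => ?_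
  · have : s2.reg 3 = p := (f2.reg _ rfl).trans hR1.src.loc
    simp [Cmd.run, h2, this]
  have hE3 := hE2.frame f3 rfl rfl rfl
  refine Tri.bind (tri_testbit hE3 h3 h4 hm.lt) fun s4 f4 h5 => ?_
  have hE4 := hE3.frame f4 rfl rfl rfl
  have hpol : s4.arr arPol 0 = φ.pol.toNat := by
    rw [f4.arr _ rfl, f3.arr _ rfl, f2.arr _ rfl, f1.arr _ rfl]
    exact (h.kids 0 φ le_rfl φ.getElem?_nodes_zero).2
  have hsat := hm.node 0 φ le_rfl φ.getElem?_nodes_zero p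
  rw [zero_mul, zero_add, Stored] at hsat
  refine Tri.run rfl (by decide) ?_
  simp only [Cmd.run, State.reg_ite, State.reg_setReg, State.arr_setReg, Nat.reduceEqDiff, if_true,
    if_false, hpol, h5, hE4.one]
  -- The bit of the root tells `Stored`, so the program negates it if the polarity is set.
  cases hb : (evalW F w (F (dim rs φ).nG 0)).testBit p <;> cases hp : φ.pol <;> simp_all

def mainC : Cmd := setupC ;; tablesC ;; answerC

def mainTime (rs : List (Rule (Fin m) (Fin n))) (φ : Formula (Fin k)) (l : ℕ) : ℕ :=
  (24 * φ.size + 8 * m + 5 * (dim rs φ).K + 5 * (dim rs φ).nG + 23 * rs.length + 70) +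
    (tablesTime rs φ + (6 * l + 14 * (dim rs φ).K + 12))

theorem getElem?_flatMap_of_length {α β : Type*} {g : α → List β} {m : ℕ} (hg : ∀ a, (g a).length = m)
    {q : ℕ} (hq : q < m) (l : List α) (e : ℕ) :
    (l.flatMap g)[e * m + q]? = l[e]?.bind fun a => (g a)[q]? := by
  induction l generalizing e with
  | nil => simp
  | cons a l ih =>
    rw [List.flatMap_cons]
    cases e with
    | zero => rw [zero_mul, zero_add, List.getElem?_append_left (by rw [hg]; exact hq)]; rfl
    | succ e =>
      rw [List.getElem?_append_right (by rw [hg, Nat.succ_mul]; omega), hg, List.getElem?_cons_succ,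
        ← ih]
      congr 1
      rw [Nat.succ_mul]; omega

theorem labels_getD (f : Fin k → Finset (Fin m)) (e : Fin k) {q : ℕ} (hq : q < m) :
    (encLabels f).getD (e * m + q) 0 = (labB f e q).toNat := by
  rw [encLabels, List.getD_eq_getElem?_getD,
    getElem?_flatMap_of_length (fun _ => by rw [List.length_map, List.length_finRange]) hq]
  by_cases h : (⟨q, hq⟩ : Fin m) ∈ f e <;> simp [labB, hq, h]

theorem tri_main (hrs : ∀ r, r ∈ rs ↔ r ∈ S.Δ) :
    Tri mainC (inputState rs f φ p ω) (mainTime rs φ ω.length) fun s' =>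
      (Sat S (stdVal (Fin n) f) φ (p, ω) → s'.reg 0 = 1) ∧
      (¬ Sat S (stdVal (Fin n) f) φ (p, ω) → s'.reg 0 = 0) := by
  refine Tri.bind (tri_setup (f := f) (φ := φ) (p := p) (ω := ω) (rs := rs)
    ⟨rfl, rfl, rfl, At.getD _, At.getD _, At.getD _, fun e q hq => labels_getD f e hq⟩ rfl rfl
    fun _ => rfl) fun s1 f1 h1 => ?_
  refine Tri.bind (tri_tables hrs h1 ?_ ?_) fun s2 _ h2 => tri_answer h2
  · rw [f1.arr _ rfl]; exact fun _ => rfl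
  · rw [f1.arr _ rfl]; exact fun _ => rfl

/-! ### The running time -/

section

variable {m n x a R T : ℕ} {c : Dim m n}

/-- In these bounds `x` stands for `|P|² |φ|`, which dominates `m * K` up to a factor `2`, `R` for
the size of the rules, `a` for the number of symbols and `T` for the number of types. Each level of
loops contributes its number of passes as a factor. -/
theorem Dim.ruleTime_le (hm : m ≤ x) (hx : 1 ≤ x) (hK : c.K ≤ 2 * x) (hmK : m * c.K ≤ 2 * x) :
    c.ruleTime ≤ 326 * x := by
  have : c.ruleTime = 70 * (m * c.K) + 47 * m + 42 * c.K + 55 := by unfold Dim.ruleTime; ring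
  omega

theorem Dim.locTime_le (hm : m ≤ x) (hx : 1 ≤ x) (hK : c.K ≤ 2 * x) (hmK : m * c.K ≤ 2 * x)
    (hR1 : 1 ≤ R) (hR : rulesSize c.rs ≤ R) : c.locTime ≤ 497 * (x * R) := by
  have h1 : c.ruleTime + 9 ≤ 335 * x := by have := Dim.ruleTime_le hm hx hK hmK; omega
  have h2 := Nat.mul_le_mul h1 hR
  have h3 : x ≤ x * R := Nat.le_mul_of_pos_right x hR1
  rw [mul_assoc] at h2
  unfold Dim.locTime
  omega

theorem Dim.cellTime_le (hm : m ≤ x) (hm1 : 1 ≤ m) (hK : c.K ≤ 2 * x) (hmK : m * c.K ≤ 2 * x)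
    (hR1 : 1 ≤ R) (hR : rulesSize c.rs ≤ R) : c.cellTime ≤ 506 * (m * (x * R)) := by
  have hx : 1 ≤ x := hm1.trans hm
  have h0 : 1 ≤ x * R := Nat.mul_pos hx hR1
  have h1 : c.locTime + 2 ≤ 499 * (x * R) := by have := Dim.locTime_le hm hx hK hmK hR1 hR; omega
  have h2 := Nat.mul_le_mul_left m h1
  have h3 : 1 ≤ m * (x * R) := Nat.mul_pos hm1 h0
  rw [mul_left_comm] at h2
  unfold Dim.cellTime
  omega

theorem Dim.cells_le (ha1 : 1 ≤ a) (ha : c.nG ≤ a) (hT : c.TC ≤ T) : c.cells ≤ 2 * (a * T) := by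
  unfold Dim.cells
  rw [← mul_assoc]
  exact Nat.mul_le_mul (by omega) hT

theorem Dim.roundTime_le (hm : m ≤ x) (hm1 : 1 ≤ m) (hK : c.K ≤ 2 * x) (hmK : m * c.K ≤ 2 * x)
    (hR1 : 1 ≤ R) (hR : rulesSize c.rs ≤ R) (ha1 : 1 ≤ a) (ha : c.nG ≤ a) (hT1 : 1 ≤ T)
    (hT : c.TC ≤ T) : c.roundTime ≤ 1039 * (a * T * (m * (x * R))) := by
  have hy : 1 ≤ m * (x * R) := Nat.mul_pos hm1 (Nat.mul_pos (hm1.trans hm) hR1)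
  have h1 : c.cellTime + 2 ≤ 508 * (m * (x * R)) := by
    have := Dim.cellTime_le hm hm1 hK hmK hR1 hR; omega
  generalize m * (x * R) = y at *
  have h2 : c.TC * (c.cellTime + 2) ≤ 508 * (T * y) :=
    (Nat.mul_le_mul hT h1).trans_eq (by ring)
  have h3 : 1 ≤ T * y := Nat.mul_pos hT1 hy
  have h4 : (c.nG + 1) * (c.TC * (c.cellTime + 2) + 5) ≤ 1026 * (a * T * y) :=
    (Nat.mul_le_mul (show c.nG + 1 ≤ 2 * a by omega)
      (show c.TC * (c.cellTime + 2) + 5 ≤ 513 * (T * y) by omega)).trans_eq (by ring)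
  have h5 := Dim.cells_le ha1 ha hT
  have h6 : a * T ≤ a * T * y := Nat.le_mul_of_pos_right _ hy
  have h7 : 1 ≤ a * T := Nat.mul_pos ha1 hT1
  unfold Dim.roundTime
  omega

theorem Dim.stageTime_le (hm : m ≤ x) (hm1 : 1 ≤ m) (hK : c.K ≤ 2 * x) (hmK : m * c.K ≤ 2 * x)
    (hR1 : 1 ≤ R) (hR : rulesSize c.rs ≤ R) (ha1 : 1 ≤ a) (ha : c.nG ≤ a) (hT1 : 1 ≤ T)
    (hT : c.TC ≤ T) : c.stageTime ≤ 2084 * (m * (a * T) * (a * T * (m * (x * R)))) := by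
  have hy : 1 ≤ m * (x * R) := Nat.mul_pos hm1 (Nat.mul_pos (hm1.trans hm) hR1)
  have hz : 1 ≤ a * T := Nat.mul_pos ha1 hT1
  have h0 := Nat.mul_pos hz hy
  have h1 : c.roundTime + 2 ≤ 1041 * (a * T * (m * (x * R))) := by
    have := Dim.roundTime_le hm hm1 hK hmK hR1 hR ha1 ha hT1 hT; omega
  have h2 : m * c.cells * (c.roundTime + 2) ≤ 2082 * (m * (a * T) * (a * T * (m * (x * R)))) :=
    (Nat.mul_le_mul (Nat.mul_le_mul_left m (Dim.cells_le ha1 ha hT)) h1).trans_eq (by ring)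
  have h3 : 1 ≤ m * (a * T) * (a * T * (m * (x * R))) := Nat.mul_pos (Nat.mul_pos hm1 hz) h0
  unfold Dim.stageTime
  omega

end

variable {m n k : ℕ} {rs : List (Rule (Fin m) (Fin n))} {φ : Formula (Fin k)}

theorem length_le_rulesSize {P Γ : Type*} (rs : List (Rule P Γ)) : rs.length ≤ rulesSize rs := by
  induction rs with
  | nil => simp
  | cons r l ih => simp only [rulesSize, List.map_cons, List.sum_cons, List.length_cons] at *; omega

/-- The `|φ| + 2` stages dominate: each costs at most `2084 * Y`, which makes `6252` of the
constant, and the preparation and all other work fit into the remainder. The stack enters only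
through the final evaluation, by `6 * l`. -/
theorem mainTime_le {R a T : ℕ} (hm1 : 1 ≤ m) (hR1 : 1 ≤ R) (hR : rulesSize rs ≤ R)
    (ha1 : 1 ≤ a) (ha : (dim rs φ).nG ≤ a) (hT1 : 1 ≤ T) (hT : (dim rs φ).TC ≤ T) (l : ℕ) :
    mainTime rs φ l ≤ 6600 * (φ.size ^ 2 * m ^ 4 * a ^ 2 * T ^ 2 * R) + 6 * l := by
  have hN : 1 ≤ φ.size := φ.size_pos
  have hK0 : (dim rs φ).K = (φ.size + 1) * m := rfl
  have hlen : rs.length ≤ R := (length_le_rulesSize rs).trans hR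
  generalize hx : m * m * φ.size = x
  have hmm : 1 ≤ m * m := Nat.mul_pos hm1 hm1
  have hm : m ≤ x := by
    rw [← hx, mul_assoc]; exact Nat.le_mul_of_pos_right _ (Nat.mul_pos hm1 hN)
  have hNx : φ.size ≤ x := by rw [← hx]; exact Nat.le_mul_of_pos_left _ hmm
  have hmK : m * (dim rs φ).K ≤ 2 * x :=
    (Nat.mul_le_mul_left m (Nat.mul_le_mul_right m (show φ.size + 1 ≤ 2 * φ.size by omega))).trans_eq
      (by rw [← hx]; ring)
  have hK : (dim rs φ).K ≤ 2 * x := (Nat.le_mul_of_pos_left _ hm1).trans hmK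
  have hx1 : 1 ≤ x := hm1.trans hm
  have hs := Dim.stageTime_le hm hm1 hK hmK hR1 (c := dim rs φ) hR ha1 ha hT1 hT
  have hc := Dim.cells_le (c := dim rs φ) ha1 ha hT
  generalize hY : m * (a * T) * (a * T * (m * (x * R))) = Y at hs
  have hY' : φ.size ^ 2 * m ^ 4 * a ^ 2 * T ^ 2 * R = φ.size * Y := by rw [← hY, ← hx]; ring
  have hy : 1 ≤ m * (x * R) := Nat.mul_pos hm1 (Nat.mul_pos hx1 hR1)
  have hz : 1 ≤ a * T := Nat.mul_pos ha1 hT1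
  have haT : a ≤ a * T := Nat.le_mul_of_pos_right _ hT1
  have h1 : a * T ≤ Y := by
    rw [← hY, mul_comm m, mul_assoc]
    exact Nat.le_mul_of_pos_right _ (Nat.mul_pos hm1 (Nat.mul_pos hz hy))
  have h2 : x * R ≤ Y := by
    rw [← hY, ← mul_assoc, ← mul_assoc]
    exact Nat.le_mul_of_pos_left _ (Nat.mul_pos (Nat.mul_pos (Nat.mul_pos hm1 hz) hz) hm1)
  have h3 : x ≤ x * R := Nat.le_mul_of_pos_right _ hR1
  have h4 : R ≤ x * R := Nat.le_mul_of_pos_left _ hx1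
  have h5 : Y ≤ φ.size * Y := Nat.le_mul_of_pos_left _ hN
  have h6 : (φ.size + 2) * (dim rs φ).stageTime ≤ 6252 * (φ.size * Y) :=
    (Nat.mul_le_mul (show φ.size + 2 ≤ 3 * φ.size by omega) hs).trans_eq (by ring)
  have h7 : φ.size * (3 * m + 82) ≤ 85 * (φ.size * Y) :=
    (Nat.mul_le_mul_left _ (show 3 * m + 82 ≤ 85 * Y by omega)).trans_eq (by ring)
  rw [hY']
  unfold mainTime tablesTime
  omega

theorem sq_le_two_pow (m : ℕ) : m ^ 2 ≤ 2 * 2 ^ m := by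
  induction m with
  | zero => norm_num
  | succ m ih =>
    have : m < 2 ^ m := Nat.lt_two_pow_self
    rw [pow_succ 2 m]
    nlinarith

/-- With rules, the table contributes `2 ^ (2 (N + 1) m)` and one surplus factor `m ≤ 2 ^ m`, in
total at most `2 ^ ((2 N + 3) m)`, and `2 N + 3 ≤ 5 N` as `N ≥ 1`. Without rules, the table is one
cell and the surplus `m ^ 2` is at most `2 * 2 ^ (m N)`, paid for by the term with `l ≥ 1`. The
latter case gives the constant `2 * 6600 + 6`. -/
theorem mainTime_bound (hm1 : 1 ≤ m) {l : ℕ} (h : rs ≠ [] ∨ l ≠ 0) (hn : 1 ≤ n) :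
    mainTime rs φ l ≤ 13206 * (m ^ 2 * φ.size ^ 3 * n *
      (m * n * rulesSize rs * φ.size * 2 ^ (5 * m * φ.size) + 2 ^ (m * φ.size) * l)) := by
  have hN : 1 ≤ φ.size := φ.size_pos
  have hE : 1 ≤ 2 ^ (m * φ.size) := Nat.one_le_two_pow
  have hA : 1 ≤ m ^ 2 * φ.size ^ 3 * n :=
    Nat.mul_pos (Nat.mul_pos (Nat.pow_pos hm1) (Nat.pow_pos hN)) hn
  have hl : l ≤ m ^ 2 * φ.size ^ 3 * n * (2 ^ (m * φ.size) * l) := by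
    rw [← mul_assoc]; exact Nat.le_mul_of_pos_left _ (Nat.mul_pos hA hE)
  rw [mul_add (m ^ 2 * φ.size ^ 3 * n)]
  by_cases hrs : rs = []
  · subst hrs
    have hl0 : 1 ≤ l := by have : l ≠ 0 := by simpa using h
                           omega
    have h1 := mainTime_le (rs := ([] : List (Rule (Fin m) (Fin n)))) (φ := φ) (a := 1) (T := 1) hm1
      le_rfl (by simp [rulesSize]) le_rfl (by simp [dim]) le_rfl (by simp [dim]) l
    have h2 : m ^ 2 ≤ 2 * 2 ^ (m * φ.size) := (sq_le_two_pow m).trans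
      (Nat.mul_le_mul_left 2 (Nat.pow_le_pow_right two_pos (Nat.le_mul_of_pos_right m hN)))
    have h3 : φ.size ^ 2 * m ^ 4 * 1 ^ 2 * 1 ^ 2 * 1 ≤
        2 * (m ^ 2 * φ.size ^ 3 * n * (2 ^ (m * φ.size) * l)) := calc
      _ = (m ^ 2 * φ.size ^ 2) * m ^ 2 := by ring
      _ ≤ (m ^ 2 * φ.size ^ 2 * (φ.size * n)) * (2 * 2 ^ (m * φ.size) * l) :=
        Nat.mul_le_mul (Nat.le_mul_of_pos_right _ (Nat.mul_pos hN hn))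
          (h2.trans (Nat.le_mul_of_pos_right _ hl0))
      _ = _ := by ring
    omega
  · have hR1 : 1 ≤ rulesSize rs :=
      (List.length_pos_of_ne_nil hrs).trans_le (length_le_rulesSize rs)
    have he : rs.isEmpty = false := by simpa using hrs
    have h1 := mainTime_le (rs := rs) (φ := φ) (a := n) hm1 hR1 le_rfl hn (by simp [dim, he])
      Nat.one_le_two_pow (by simp [dim, he]; rfl) l
    have h2 : (2 ^ ((φ.size + 1) * m)) ^ 2 * m ≤ 2 ^ (5 * m * φ.size) := by
      have h : m ≤ 2 ^ m := Nat.lt_two_pow_self.le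
      refine (Nat.mul_le_mul_left _ h).trans ?_
      rw [← pow_mul, ← pow_add]
      refine Nat.pow_le_pow_right two_pos ?_
      nlinarith [Nat.mul_le_mul_left m hN]
    have h3 : φ.size ^ 2 * m ^ 4 * n ^ 2 * (2 ^ ((φ.size + 1) * m)) ^ 2 * rulesSize rs ≤
        m ^ 2 * φ.size ^ 3 * n * (m * n * rulesSize rs * φ.size * 2 ^ (5 * m * φ.size)) := calc
      _ = φ.size ^ 2 * m ^ 3 * n ^ 2 * rulesSize rs * ((2 ^ ((φ.size + 1) * m)) ^ 2 * m) := by ring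
      _ ≤ φ.size ^ 2 * m ^ 3 * n ^ 2 * rulesSize rs * φ.size ^ 2 * 2 ^ (5 * m * φ.size) :=
        Nat.mul_le_mul (Nat.le_mul_of_pos_right _ (by positivity)) h2
      _ = _ := by ring
    omega

theorem rulesSize_eq {S : PDS (Fin m) (Fin n)} (hd : rs.Nodup) (hrs : ∀ r, r ∈ rs ↔ r ∈ S.Δ) :
    S.ruleSize = rulesSize rs := by
  classical
  have : S.Δ = rs.toFinset := by ext r; rw [List.mem_toFinset, hrs]
  rw [PDS.ruleSize, this, rulesSize, List.sum_toFinset _ hd]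

end RAM
end BCARET

theorem mainTheorem2 :
    ∃ (prog : BCARET.RAM.Cmd) (C : ℕ),
      ∀ (nP nΓ nAP : ℕ) (S : BCARET.PDS (Fin nP) (Fin nΓ))
        (rs : List (BCARET.Rule (Fin nP) (Fin nΓ))),
        rs.Nodup → (∀ r, r ∈ rs ↔ r ∈ S.Δ) →
        ∀ (f : Fin nAP → Finset (Fin nP)) (φ : BCARET.Formula (Fin nAP))
          (p : Fin nP) (ω : List (Fin nΓ)),
          ∃ (s : BCARET.RAM.State) (t : ℕ),
            BCARET.RAM.Exec prog (BCARET.inputState rs f φ p ω) s t ∧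
            (BCARET.Sat S (BCARET.stdVal (Fin nΓ) f) φ (p, ω) → s.reg 0 = 1) ∧
            (¬ BCARET.Sat S (BCARET.stdVal (Fin nΓ) f) φ (p, ω) → s.reg 0 = 0) ∧
            (S.Δ.Nonempty ∨ ω ≠ [] →
              t ≤ C * (nP ^ 2 * φ.size ^ 3 * nΓ *
                (nP * nΓ * S.ruleSize * φ.size * 2 ^ (5 * nP * φ.size)
                  + 2 ^ (nP * φ.size) * ω.length))) := by
  refine ⟨BCARET.RAM.mainC, 13206, fun nP nΓ nAP S rs hd hrs f φ p ω => ?_⟩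
  obtain ⟨s, t, he, ht, h1, h2⟩ := BCARET.RAM.tri_main (f := f) (φ := φ) (p := p) (ω := ω) hrs
  refine ⟨s, t, he, h1, h2, fun h => ?_⟩
  rw [BCARET.RAM.rulesSize_eq hd hrs]
  refine ht.trans (BCARET.RAM.mainTime_bound p.pos (h.imp ?_ ?_) ?_)
  · rintro ⟨r, hr⟩ rfl
    exact absurd ((hrs r).2 hr) (List.not_mem_nil)
  · exact fun h h0 => h (List.length_eq_zero_iff.1 h0)
  -- A rule or a stack symbol witnesses that `|Γ|` is positive, without which the bound would be
  -- `0`; `|P|` is positive because of `p`.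
  · rcases h with ⟨r, -⟩ | h
    · cases r <;> exact Fin.pos ‹Fin nΓ›
    · obtain ⟨g, l, rfl⟩ := List.exists_cons_of_ne_nil h
      exact g.pos
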